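/- Let $\Gamma$ be a compact connected metric graph with finite vertex set $V$ and finite edge set $E$ (loops and multiple edges are allowed), each edge $e$ being identified with an interval $[0,L_e]$, $0<L_e<\infty$. Let $q:\Gamma\to\mathbb{R}$ be piecewise continuous, let $\chi_v\in\mathbb{R}\cup\{\infty\}$ for each vertex $v$, where $\chi_v=\infty$ is allowed only at vertices of degree one, and let $\beta=|E|-|V|+1$. Choose a spanning tree of $\Gamma$, enumerate the $\beta$ edges outside it, and choose an interior point $c_j$ on the $j$-th of them, $1\le j\le\beta$. Cutting $\Gamma$ at the points $c_j$ gives a metric tree $T$, in which $c_j$ is replaced by two vertices $c_j^-$, $c_j^+$ of degree one. For $\boldsymbol\alpha=(\alpha_1,\dots,\alpha_\beta)\in\mathbb{R}^\beta$ let $H^{\boldsymbol\alpha}$ be the operator $f\mapsto -f''+qf$ in $L^2(T,\mathbb{C})$ whose domain consists of the functions $f$ that lie in the Sobolev space $H^2$ on every edge of $T$ and satisfy * at every $v\in V$: $f$ is continuous at $v$ and $\sum_{e}\frac{df}{dx_e}(v)=\chi_v f(v)$ (read as $f(v)=0$ if $\chi_v=\infty$), the sum being over the edge ends at $v$; * at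 the new vertices: $f(c_j^+)=e^{i\alpha_j}f(c_j^-)$ and $f'(c_j^+)=-e^{i\alpha_j}f'(c_j^-)$ for $j=1,\dots,\beta$; all derivatives at vertices being taken into the edges. (Every magnetic Schrödinger operator on $\Gamma$ with potential $q$ and these vertex conditions is unitarily equivalent to some $H^{\boldsymbol\alpha}$.) Let $\sigma(\boldsymbol\alpha)\subset\mathbb{C}$ be the spectrum of $H^{\boldsymbol\alpha}$, and let $\lambda_1(\boldsymbol\alpha)\le\lambda_2(\boldsymbol\alpha)\le\cdots$ be its eigenvalues, in increasing order and repeated according to multiplicity. Let $$\Sigma=\{\pi(b_1,\dots,b_\beta): b_j\in\{0,1\}\}.$$ Then for every $\boldsymbol\varsigma\in\Sigma$ and every $\boldsymbol\alpha\in\mathbb{R}^\beta$, $$\sigma(\boldsymbol\varsigma-\boldsymbol\alpha)=\sigma(\boldsymbol\varsigma+\boldsymbol\alpha),$$ together with multiplicity: $\dim\ker(H^{\boldsymbol\varsigma-\boldsymbol\alpha}-z)=\dim\ker(H^{\boldsymbol\varsigma+\boldsymbol\alpha}-z)$ for every $z\in\mathbb{C}$. Consequently, if $n\ge1$ and the eigenvalue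 $\lambda_n(\boldsymbol\varsigma)$ of $H^{\boldsymbol\varsigma}$ is simple, then $\boldsymbol\varsigma$ is a critical point of the function $\boldsymbol\alpha\mapsto\lambda_n(\boldsymbol\alpha)$: this function is differentiable at $\boldsymbol\varsigma$, with derivative $0$. -/

import Mathlib

open MeasureTheory Set Filter Topology

noncomputable section

namespace QG

/-! ### Metric graphs, spanning trees -/

/-- A metric graph with vertex set `V` and edge set `E` (loops and multiple edges allowed): the edge
`e` is identified with `[0, length e]`; the point `0` is glued to the vertex `endpoint e false` and
the point `length e` to the vertex `endpoint e true`. It is compact when `V` and `E` are finite. -/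
structure MetricGraph (V E : Type*) where
  endpoint : E → Bool → V
  length : E → ℝ
  length_pos : ∀ e, 0 < length e

namespace MetricGraph

variable {V E : Type*} (G : MetricGraph V E)

/-- `u` and `v` are joined by a path that uses only edges of `S`. -/
def JoinedIn (S : Set E) : V → V → Prop :=
  Relation.EqvGen fun u v => ∃ e ∈ S, G.endpoint e false = u ∧ G.endpoint e true = v

def Connected : Prop := Nonempty V ∧ ∀ u v, G.JoinedIn Set.univ u v

/-- `S` is the edge set of a spanning tree: it connects all the vertices and contains no cycle, i.e.
the ends of an edge of `S` are not joined by the other edges of `S`. -/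
def IsSpanningTree (S : Set E) : Prop :=
  (∀ u v, G.JoinedIn S u v) ∧
    ∀ e ∈ S, ¬ G.JoinedIn (S \ {e}) (G.endpoint e false) (G.endpoint e true)

/-- The degree of a vertex (a loop counts twice). -/
def degree (v : V) : ℕ := {h : E × Bool | G.endpoint h.1 h.2 = v}.ncard

/-- The first Betti number `|E| - |V| + 1` (of a connected graph). -/
def betti [Fintype V] [Fintype E] (_ : MetricGraph V E) : ℕ :=
  Fintype.card E + 1 - Fintype.card V

end MetricGraph

/-- `q` is piecewise continuous on `[a, b]`: continuous outside a finite set, with finite one-sided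
limits everywhere. -/
def PiecewiseContinuousOn (q : ℝ → ℝ) (a b : ℝ) : Prop :=
  (∃ S : Set ℝ, S.Finite ∧ ContinuousOn q (Icc a b \ S)) ∧
  (∀ x ∈ Ico a b, ∃ l, Tendsto q (𝓝[>] x) (𝓝 l)) ∧
  (∀ x ∈ Ioc a b, ∃ l, Tendsto q (𝓝[<] x) (𝓝 l))

/-- The data of a Schrödinger operator with `δ`-type conditions on a connected metric graph: the
potential `q` and the coefficients `χ`, where `χ v = ⊤` is the Dirichlet condition, allowed at
vertices of degree one only. -/
structure QuantumGraph (V E : Type*) extends MetricGraph V E where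
  connected : toMetricGraph.Connected
  q : E → ℝ → ℝ
  q_pc : ∀ e, PiecewiseContinuousOn (q e) 0 (length e)
  χ : V → WithTop ℝ
  dirichlet_leaf : ∀ v, χ v = ⊤ → toMetricGraph.degree v = 1

/-! ### Cutting the cycles -/

/-- The complement of a spanning tree, enumerated as `edge 0, …, edge (β - 1)`, and an interior point
`pos j` of each of these edges. -/
structure Cut {V E : Type*} [Fintype V] [Fintype E] (G : MetricGraph V E) where
  edge : Fin G.betti → E
  edge_injective : Function.Injective edge
  spanning : G.IsSpanningTree (Set.range edge)ᶜ
  pos : Fin G.betti → ℝ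
  pos_mem : ∀ j, pos j ∈ Ioo 0 (G.length (edge j))

section Tree

variable {V E : Type*} [Fintype V] [Fintype E]

/-- The vertices of the cut tree `T`: those of the graph, and the new vertices
`c_j^- = Sum.inr (j, false)` and `c_j^+ = Sum.inr (j, true)`. -/
abbrev TreeVertex {G : MetricGraph V E} (_ : Cut G) : Type _ := V ⊕ (Fin G.betti × Bool)

/-- The edges of the cut tree `T`: the edges that are not cut, and for each `j` the two pieces of
the `j`-th cut edge: `Sum.inr (j, false)`, ending at `c_j^-`, and `Sum.inr (j, true)`, starting at
`c_j^+`. -/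
abbrev TreeEdge {G : MetricGraph V E} (c : Cut G) : Type _ :=
  {e : E // e ∉ Set.range c.edge} ⊕ (Fin G.betti × Bool)

instance {G : MetricGraph V E} (c : Cut G) : Fintype (TreeEdge c) := Fintype.ofFinite _

/-- The cut tree `T`. -/
def cutTree {G : MetricGraph V E} (c : Cut G) : MetricGraph (TreeVertex c) (TreeEdge c) where
  endpoint
    | Sum.inl e, b => Sum.inl (G.endpoint e.1 b)
    | Sum.inr (j, false), false => Sum.inl (G.endpoint (c.edge j) false)
    | Sum.inr (j, false), true => Sum.inr (j, false)
    | Sum.inr (j, true), false => Sum.inr (j, true)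
    | Sum.inr (j, true), true => Sum.inl (G.endpoint (c.edge j) true)
  length
    | Sum.inl e => G.length e.1
    | Sum.inr (j, false) => c.pos j
    | Sum.inr (j, true) => G.length (c.edge j) - c.pos j
  length_pos := by
    rintro (e | ⟨j, _ | _⟩)
    · exact G.length_pos _
    · exact (c.pos_mem j).1
    · exact sub_pos.2 (c.pos_mem j).2

/-- The potential, as a function on the cut tree. -/
def treePotential (Γ : QuantumGraph V E) (c : Cut Γ.toMetricGraph) : TreeEdge c → ℝ → ℝ
  | Sum.inl e => Γ.q e.1
  | Sum.inr (j, false) => Γ.q (c.edge j)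
  | Sum.inr (j, true) => fun x => Γ.q (c.edge j) (c.pos j + x)

end Tree

/-! ### Function spaces on a metric graph -/

/-- `L²(e)` for an edge of length `L`. -/
abbrev EdgeL2 (L : ℝ) : Type := Lp ℂ 2 (volume.restrict (Icc 0 L))

/-- The Hilbert space `⊕_e L²(e)`. -/
abbrev GraphL2 {V E : Type*} [Fintype E] (G : MetricGraph V E) : Type _ :=
  PiLp 2 fun e : E => EdgeL2 (G.length e)

/-- `f` lies in the Sobolev space `H²(0, L)`, with derivatives `f' = f₁` and `f'' = f₂`: `f` and `f₁`
are absolutely continuous on `[0, L]`, being the integrals of `f₁` and of `f₂ ∈ L²(0, L)`. -/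
structure IsSobolevTwo (L : ℝ) (f f₁ f₂ : ℝ → ℂ) : Prop where
  memLp : MemLp f₂ 2 (volume.restrict (Icc 0 L))
  snd : ∀ x ∈ Icc 0 L, f₁ x = f₁ 0 + ∫ t in (0 : ℝ)..x, f₂ t
  fst : ∀ x ∈ Icc 0 L, f x = f 0 + ∫ t in (0 : ℝ)..x, f₁ t

namespace MetricGraph

variable {V E : Type*} (G : MetricGraph V E)

/-- The value of a function on the graph at an end of an edge. -/
def endValue (f : E → ℝ → ℂ) (e : E) : Bool → ℂ
  | false => f e 0
  | true => f e (G.length e)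

/-- The derivative at an end of an edge, taken into the edge; `f₁` is the derivative with respect to
the coordinate on the edge. -/
def endDeriv (f₁ : E → ℝ → ℂ) (e : E) : Bool → ℂ
  | false => f₁ e 0
  | true => - f₁ e (G.length e)

open Classical in
/-- The `δ`-type condition at the vertex `v` with coefficient `χ` (Dirichlet if `χ = ⊤`):
`f` takes a common value `a` at all edge ends at `v`, and the derivatives into the edges add up to
`χ * a`. -/
def DeltaCondition [Fintype E] (f f₁ : E → ℝ → ℂ) (v : V) (χ : WithTop ℝ) : Prop :=
  ∃ a : ℂ, (∀ e b, G.endpoint e b = v → G.endValue f e b = a) ∧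
    (χ = ⊤ → a = 0) ∧
    ∀ r : ℝ, χ = (r : WithTop ℝ) →
      (∑ h : E × Bool, if G.endpoint h.1 h.2 = v then G.endDeriv f₁ h.1 h.2 else 0) = r * a

end MetricGraph

/-! ### The operator `H^α` on the cut tree -/

section Operator

variable {V E : Type*} [Fintype V] [Fintype E] (Γ : QuantumGraph V E) (c : Cut Γ.toMetricGraph)

/-- The vertex conditions of `H^α` for `f` with derivative `f₁`: those inherited from the graph at
the old vertices, and `f(c_j^+) = e^{iα_j} f(c_j^-)`, `f'(c_j^+) = -e^{iα_j} f'(c_j^-)` at the new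
ones, with derivatives taken into the edges. -/
structure VertexConditions (α : Fin Γ.betti → ℝ) (f f₁ : TreeEdge c → ℝ → ℂ) : Prop where
  delta : ∀ v : V, (cutTree c).DeltaCondition f f₁ (Sum.inl v) (Γ.χ v)
  jump : ∀ j, (cutTree c).endValue f (Sum.inr (j, true)) false =
    Complex.exp (Complex.I * α j) * (cutTree c).endValue f (Sum.inr (j, false)) true
  jump_deriv : ∀ j, (cutTree c).endDeriv f₁ (Sum.inr (j, true)) false =
    -Complex.exp (Complex.I * α j) * (cutTree c).endDeriv f₁ (Sum.inr (j, false)) true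

/-- `(u, w)` is in the graph of `H^α`: `u` is (the class of) a function `f` that is `H²` on every
edge and satisfies the vertex conditions, and `w = -f'' + q f`. -/
def InGraph (α : Fin Γ.betti → ℝ) (u w : GraphL2 (cutTree c)) : Prop :=
  ∃ f f₁ f₂ : TreeEdge c → ℝ → ℂ,
    (∀ e, IsSobolevTwo ((cutTree c).length e) (f e) (f₁ e) (f₂ e)) ∧
    VertexConditions Γ c α f f₁ ∧
    (∀ e, u e =ᵐ[volume.restrict (Icc 0 ((cutTree c).length e))] f e) ∧
    (∀ e, w e =ᵐ[volume.restrict (Icc 0 ((cutTree c).length e))]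
      fun x => -f₂ e x + (treePotential Γ c e x : ℂ) * f e x)

end Operator

theorem IsSobolevTwo.integrable {L : ℝ} {f f₁ f₂ : ℝ → ℂ} (h : IsSobolevTwo L f f₁ f₂) :
    IntegrableOn f₂ (Icc 0 L) :=
  h.memLp.integrable (by norm_num)

theorem IsSobolevTwo.intervalIntegrable {L : ℝ} {f f₁ f₂ : ℝ → ℂ} (h : IsSobolevTwo L f f₁ f₂)
    {x : ℝ} (hx : x ∈ Icc 0 L) : IntervalIntegrable f₂ volume 0 x := by
  rw [intervalIntegrable_iff_integrableOn_Icc_of_le hx.1]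
  exact h.integrable.mono_set (Icc_subset_Icc_right hx.2)

theorem IsSobolevTwo.continuousOn_snd {L : ℝ} {f f₁ f₂ : ℝ → ℂ} (h : IsSobolevTwo L f f₁ f₂) :
    ContinuousOn f₁ (Icc 0 L) :=
  (continuousOn_const.add (intervalIntegral.continuousOn_primitive h.integrable)).congr
    fun x hx => by
      rw [h.snd x hx, intervalIntegral.integral_of_le hx.1]
      rfl

theorem IsSobolevTwo.intervalIntegrable_snd {L : ℝ} {f f₁ f₂ : ℝ → ℂ} (h : IsSobolevTwo L f f₁ f₂)
    {x : ℝ} (hx : x ∈ Icc 0 L) : IntervalIntegrable f₁ volume 0 x := by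
  refine ContinuousOn.intervalIntegrable ?_
  rw [uIcc_of_le hx.1]
  exact h.continuousOn_snd.mono (Icc_subset_Icc_right hx.2)

theorem IsSobolevTwo.continuousOn {L : ℝ} {f f₁ f₂ : ℝ → ℂ} (h : IsSobolevTwo L f f₁ f₂) :
    ContinuousOn f (Icc 0 L) :=
  (continuousOn_const.add (intervalIntegral.continuousOn_primitive
    (h.continuousOn_snd.integrableOn_compact isCompact_Icc))).congr
    fun x hx => by
      rw [h.fst x hx, intervalIntegral.integral_of_le hx.1]
      rfl

theorem IsSobolevTwo.zero (L : ℝ) : IsSobolevTwo L 0 0 0 :=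
  ⟨MemLp.zero, fun _ _ => by simp, fun _ _ => by simp⟩

theorem IsSobolevTwo.add {L : ℝ} {f f₁ f₂ g g₁ g₂ : ℝ → ℂ} (hf : IsSobolevTwo L f f₁ f₂)
    (hg : IsSobolevTwo L g g₁ g₂) : IsSobolevTwo L (f + g) (f₁ + g₁) (f₂ + g₂) := by
  refine ⟨hf.memLp.add hg.memLp, fun x hx => ?_, fun x hx => ?_⟩
  · simp only [Pi.add_apply]
    rw [intervalIntegral.integral_add (hf.intervalIntegrable hx) (hg.intervalIntegrable hx),
      hf.snd x hx, hg.snd x hx]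
    ring
  · simp only [Pi.add_apply]
    rw [intervalIntegral.integral_add (hf.intervalIntegrable_snd hx) (hg.intervalIntegrable_snd hx),
      hf.fst x hx, hg.fst x hx]
    ring

theorem IsSobolevTwo.smul {L : ℝ} {f f₁ f₂ : ℝ → ℂ} (z : ℂ) (hf : IsSobolevTwo L f f₁ f₂) :
    IsSobolevTwo L (z • f) (z • f₁) (z • f₂) := by
  refine ⟨hf.memLp.const_smul z, fun x hx => ?_, fun x hx => ?_⟩
  · simp only [Pi.smul_apply]
    rw [intervalIntegral.integral_smul, hf.snd x hx, smul_add]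
  · simp only [Pi.smul_apply]
    rw [intervalIntegral.integral_smul, hf.fst x hx, smul_add]

theorem MetricGraph.DeltaCondition.comb {V E : Type*} [Fintype E] {G : MetricGraph V E}
    {f f₁ g g₁ : E → ℝ → ℂ} {v : V} {χ : WithTop ℝ} (z y : ℂ) (hf : G.DeltaCondition f f₁ v χ)
    (hg : G.DeltaCondition g g₁ v χ) : G.DeltaCondition (z • f + y • g) (z • f₁ + y • g₁) v χ := by
  obtain ⟨a, ha, ha', hfa⟩ := hf
  obtain ⟨b, hb, hb', hgb⟩ := hg
  refine ⟨z * a + y * b, fun e s hs => ?_, fun h => by simp [ha' h, hb' h], fun r hr => ?_⟩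
  · rw [← ha e s hs, ← hb e s hs]
    cases s <;> simp [endValue]
  · have := congrArg₂ (fun p q => z * p + y * q) (hfa r hr) (hgb r hr)
    simp only [Finset.mul_sum, ← Finset.sum_add_distrib] at this
    rw [show (r : ℂ) * (z * a + y * b) = z * (r * a) + y * (r * b) by ring, ← this]
    refine Finset.sum_congr rfl fun h _ => ?_
    split_ifs
    · rcases h with ⟨e, _ | _⟩ <;> simp [endDeriv] <;> ring
    · simp

theorem VertexConditions.comb {V E : Type*} [Fintype V] [Fintype E] {Γ : QuantumGraph V E}
    {c : Cut Γ.toMetricGraph} {α : Fin Γ.betti → ℝ} {f f₁ g g₁ : TreeEdge c → ℝ → ℂ} (z y : ℂ)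
    (hf : VertexConditions Γ c α f f₁) (hg : VertexConditions Γ c α g g₁) :
    VertexConditions Γ c α (z • f + y • g) (z • f₁ + y • g₁) := by
  refine ⟨fun v => (hf.delta v).comb z y (hg.delta v), fun j => ?_, fun j => ?_⟩
  · have h1 := hf.jump j
    have h2 := hg.jump j
    simp only [MetricGraph.endValue] at h1 h2
    simp only [MetricGraph.endValue, Pi.add_apply, Pi.smul_apply, smul_eq_mul, h1, h2]
    ring
  · have h1 := hf.jump_deriv j
    have h2 := hg.jump_deriv j
    simp only [MetricGraph.endDeriv] at h1 h2
    simp only [MetricGraph.endDeriv, Pi.add_apply, Pi.smul_apply, smul_eq_mul, h1, h2]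
    ring

theorem InGraph.zero {V E : Type*} [Fintype V] [Fintype E] {Γ : QuantumGraph V E}
    {c : Cut Γ.toMetricGraph} {α : Fin Γ.betti → ℝ} : InGraph Γ c α 0 0 := by
  refine ⟨0, 0, 0, fun e => IsSobolevTwo.zero _, ⟨fun v => ⟨0, ?_, ?_, ?_⟩, ?_, ?_⟩, fun e => ?_,
    fun e => ?_⟩
  · rintro e (_ | _) - <;> simp [MetricGraph.endValue]
  · simp
  · intro r _
    rw [mul_zero]
    refine Finset.sum_eq_zero fun h _ => ?_
    rcases h with ⟨e, _ | _⟩ <;> simp [MetricGraph.endDeriv]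
  · simp [MetricGraph.endValue]
  · simp [MetricGraph.endDeriv]
  · exact Lp.coeFn_zero _ _ _
  · refine (Lp.coeFn_zero _ _ _).trans (Eventually.of_forall fun x => ?_)
    simp

theorem InGraph.comb {V E : Type*} [Fintype V] [Fintype E] {Γ : QuantumGraph V E}
    {c : Cut Γ.toMetricGraph} {α : Fin Γ.betti → ℝ} (z y : ℂ) {u w u' w' : GraphL2 (cutTree c)}
    (h : InGraph Γ c α u w) (h' : InGraph Γ c α u' w') :
    InGraph Γ c α (z • u + y • u') (z • w + y • w') := by
  obtain ⟨f, f₁, f₂, hS, hV, hu, hw⟩ := h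
  obtain ⟨g, g₁, g₂, hS', hV', hu', hw'⟩ := h'
  refine ⟨z • f + y • g, z • f₁ + y • g₁, z • f₂ + y • g₂,
    fun e => ((hS e).smul z).add ((hS' e).smul y), hV.comb z y hV', fun e => ?_, fun e => ?_⟩
  · filter_upwards [Lp.coeFn_add (z • u e) (y • u' e), Lp.coeFn_smul z (u e),
      Lp.coeFn_smul y (u' e), hu e, hu' e] with x h1 h2 h3 h4 h5
    refine h1.trans ?_
    simp [h2, h3, h4, h5]
  · filter_upwards [Lp.coeFn_add (z • w e) (y • w' e), Lp.coeFn_smul z (w e),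
      Lp.coeFn_smul y (w' e), hw e, hw' e] with x h1 h2 h3 h4 h5
    refine h1.trans ?_
    simp only [h2, h3, h4, h5, Pi.add_apply, Pi.smul_apply, smul_eq_mul]
    ring

theorem ae_zero_of_primitive_zero {L : ℝ} (hL : 0 < L) {g : ℝ → ℂ} (hg : IntegrableOn g (Icc 0 L))
    (h : ∀ x ∈ Icc 0 L, ∫ t in (0 : ℝ)..x, g t = 0) : g =ᵐ[volume.restrict (Icc 0 L)] 0 := by
  have hg' : IntervalIntegrable g volume 0 L :=
    (intervalIntegrable_iff_integrableOn_Icc_of_le hL.le).2 hg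
  have h0 : ∀ᵐ x : ℝ, x ≠ 0 := by simp [ae_iff, measure_singleton]
  have h1 : ∀ᵐ x : ℝ, x ≠ L := by simp [ae_iff, measure_singleton]
  rw [EventuallyEq, ae_restrict_iff' measurableSet_Icc]
  filter_upwards [hg'.ae_hasDerivAt_integral, h0, h1] with x hx hx0 hx1 hm
  have hd := hx (by rwa [uIcc_of_le hL.le]) 0 left_mem_uIcc
  refine hd.unique ((hasDerivAt_const x (0 : ℂ)).congr_of_eventuallyEq ?_)
  filter_upwards [Icc_mem_nhds (lt_of_le_of_ne hm.1 hx0.symm) (lt_of_le_of_ne hm.2 hx1)] with y hy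
  exact h y hy

/-- `H^α` is single valued. -/
theorem InGraph.eq_zero {V E : Type*} [Fintype V] [Fintype E] {Γ : QuantumGraph V E}
    {c : Cut Γ.toMetricGraph} {α : Fin Γ.betti → ℝ} {w : GraphL2 (cutTree c)}
    (h : InGraph Γ c α 0 w) : w = 0 := by
  obtain ⟨f, f₁, f₂, hS, -, hu, hw⟩ := h
  ext1 e
  have hL := (cutTree c).length_pos e
  have hf : EqOn (f e) 0 (Icc 0 ((cutTree c).length e)) := by
    refine Measure.eqOn_Icc_of_ae_eq volume hL.ne ?_ (hS e).continuousOn continuousOn_const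
    refine (hu e).symm.trans ?_
    exact Lp.coeFn_zero _ _ _
  have h1 : EqOn (f₁ e) 0 (Icc 0 ((cutTree c).length e)) := by
    refine Measure.eqOn_Icc_of_ae_eq volume hL.ne ?_ (hS e).continuousOn_snd continuousOn_const
    refine ae_zero_of_primitive_zero hL ((hS e).continuousOn_snd.integrableOn_compact isCompact_Icc) ?_
    intro x hx
    have := (hS e).fst x hx
    rw [hf hx, hf (left_mem_Icc.2 hL.le)] at this
    simpa using this.symm
  have h2 : f₂ e =ᵐ[volume.restrict (Icc 0 ((cutTree c).length e))] 0 := by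
    refine ae_zero_of_primitive_zero hL (hS e).integrable ?_
    intro x hx
    have := (hS e).snd x hx
    rw [h1 hx, h1 (left_mem_Icc.2 hL.le)] at this
    simpa using this.symm
  refine Lp.ext ((hw e).trans ?_)
  refine EventuallyEq.trans ?_ (Lp.coeFn_zero _ _ _).symm
  filter_upwards [h2, ae_restrict_mem measurableSet_Icc] with x hx hm
  rw [hx, hf hm]
  simp

section Operator

variable {V E : Type*} [Fintype V] [Fintype E] (Γ : QuantumGraph V E) (c : Cut Γ.toMetricGraph)

/-- The graph of `H^α` as a linear subspace. -/
def opGraph (α : Fin Γ.betti → ℝ) :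
    Submodule ℂ (GraphL2 (cutTree c) × GraphL2 (cutTree c)) where
  carrier := {p | InGraph Γ c α p.1 p.2}
  zero_mem' := InGraph.zero
  add_mem' := by
    intro p p' h h'
    simpa using InGraph.comb 1 1 h h'
  smul_mem' := by
    intro z p h
    simpa using InGraph.comb z 0 h h

/-- The operator `H^α` in `L²(T)`. -/
def magneticOp (α : Fin Γ.betti → ℝ) : GraphL2 (cutTree c) →ₗ.[ℂ] GraphL2 (cutTree c) :=
  (opGraph Γ c α).toLinearPMap

/-- The graph of `H^α` is the intended one. -/
theorem mem_graph_magneticOp (α : Fin Γ.betti → ℝ) (u w : GraphL2 (cutTree c)) :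
    (u, w) ∈ (magneticOp Γ c α).graph ↔ InGraph Γ c α u w := by
  rw [magneticOp, Submodule.toLinearPMap_graph_eq]
  · rfl
  · rintro ⟨x, y⟩ hx rfl
    exact InGraph.eq_zero hx

end Operator

/-! ### Spectrum, multiplicity, ordered eigenvalues of an unbounded operator -/

section Spectrum

variable {H : Type*} [NormedAddCommGroup H] [NormedSpace ℂ H]

/-- The spectrum of an unbounded operator: the `z` for which `A - z` has no bounded two-sided
inverse `R : H → dom A`. -/
def spec (A : H →ₗ.[ℂ] H) : Set ℂ :=
  {z | ¬ ∃ R : H →L[ℂ] H,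
    (∀ w : H, ∃ h : R w ∈ A.domain, A ⟨R w, h⟩ - z • R w = w) ∧
    ∀ u : A.domain, R (A u - z • (u : H)) = u}

/-- The eigenspace `ker (A - z)`. -/
def eigenspace (A : H →ₗ.[ℂ] H) (z : ℂ) : Submodule ℂ H :=
  (LinearMap.ker (A.toFun - z • A.domain.subtype)).map A.domain.subtype

/-- The multiplicity of `z` as an eigenvalue (zero if it is not one). -/
def multiplicity (A : H →ₗ.[ℂ] H) (z : ℂ) : Cardinal := Module.rank ℂ (eigenspace A z)

/-- The number of eigenvalues in `(-∞, t]`, counted with multiplicity: the dimension of the sum of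
their (linearly independent) eigenspaces. -/
def eigenCount (A : H →ₗ.[ℂ] H) (t : ℝ) : Cardinal :=
  Module.rank ℂ (⨆ s ∈ Iic t, eigenspace A (s : ℂ) : Submodule ℂ H)

/-- The `n`-th eigenvalue (`n = 1, 2, …`), in increasing order and counted with multiplicity, of an
operator that is bounded from below with discrete spectrum. -/
def nthEigenvalue (A : H →ₗ.[ℂ] H) (n : ℕ) : ℝ :=
  sInf {t : ℝ | (n : Cardinal) ≤ eigenCount A t}

end Spectrum

/-- The set `Σ` of points all of whose coordinates are `0` or `π`. -/
def symmetryPoints (β : ℕ) : Set (Fin β → ℝ) :=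
  {ς | ∃ b : Fin β → Fin 2, ς = fun j => Real.pi * ((b j : ℕ) : ℝ)}

end QG

end

/-! Complex conjugation carries the vertex conditions with phases `e^{iα_j}` to those with the
conjugate phases and leaves everything else alone, because `q` and `χ` are real. At a point `ς` with
coordinates in `{0, π}` one has `e^{2iς_j} = 1`, so the phases of `ς + α` are the conjugates of
those of `ς - α`. Hence conjugation intertwines the two operators antilinearly (`InGraph.conj`). It
sends the eigenspace at `z` to the one at the conjugate of `z`; since the spectrum is real
(`notMem_spec_of_im_ne_zero`), spectrum and multiplicities agree. In particular `λ_n` is even about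
`ς`, so its derivative there vanishes as soon as it exists.

Most of the work is therefore the differentiability of `λ_n` at a simple eigenvalue. Green's
identity and a trace inequality bound all the `H^α` below by one constant (`exists_lowerBound`), so
a single `K` makes every `H^α + K` positive. The equation `(H^α + K) f = g` is written in terms of
`w = -f''` and the Cauchy data of `f` at the start of each edge. It becomes a system whose operator
is the identity plus a compact operator, and `α` enters it only through the scalars `e^{iα_j}`
multiplying fixed rank-one operators. The lower bound gives injectivity, the Fredholm alternative
gives invertibility, and smoothness of inversion makes the compact symmetric resolvent `R(α) = (H^α
+ K)⁻¹` differentiable in operator norm.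

The eigenvalues `λ` of `H^α` correspond to the positive eigenvalues `1/(λ + K)` of `R(α)`. A min-max
comparison (`rank_specSum_perturbation`) encloses the `n`-th of these, near a simple eigenvalue `μ`
of `R(ς)` with unit eigenvector `v`, between `μ + Re⟨(R(α) - R(ς))v, v⟩ ± C‖R(α) - R(ς)‖²`. Both
bounds have the same first-order expansion, so the eigenvalue is differentiable
(`differentiableAt_nthEigenvalue`). Only numbers of eigenvalues above a level are compared; no
perturbed eigenvector has to be followed. -/

noncomputable section

namespace QG

/-! ### Spectral subspaces of compact self-adjoint operators -/

section CompactOperator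

variable {H : Type*} [NormedAddCommGroup H] [InnerProductSpace ℂ H]

/-- The span of the eigenvectors with real eigenvalue in `I`. -/
def specSum (R : H →L[ℂ] H) (I : Set ℝ) : Submodule ℂ H :=
  ⨆ ν ∈ I, Module.End.eigenspace (R : Module.End ℂ H) (ν : ℂ)

theorem specSum_mono (R : H →L[ℂ] H) {I J : Set ℝ} (h : I ⊆ J) : specSum R I ≤ specSum R J :=
  biSup_mono fun _ hi => h hi

theorem eigenspace_le_specSum (R : H →L[ℂ] H) {I : Set ℝ} {ν : ℝ} (h : ν ∈ I) :
    Module.End.eigenspace (R : Module.End ℂ H) (ν : ℂ) ≤ specSum R I :=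
  le_biSup (fun ν : ℝ => Module.End.eigenspace (R : Module.End ℂ H) (ν : ℂ)) h

theorem specSum_eq_of_forall_eigenspace_eq_bot (R : H →L[ℂ] H) {I J : Set ℝ} (h : I ⊆ J)
    (hJ : ∀ ν ∈ J, ν ∉ I → Module.End.eigenspace (R : Module.End ℂ H) (ν : ℂ) = ⊥) :
    specSum R I = specSum R J := by
  refine le_antisymm (specSum_mono R h) (iSup₂_le fun ν hν => ?_)
  by_cases hI : ν ∈ I
  · exact eigenspace_le_specSum R hI
  · rw [hJ ν hν hI]
    exact bot_le

theorem inner_eq_zero_of_mem_eigenspace {R : H →L[ℂ] H} (hR : R.IsSymmetric) {μ ν : ℂ}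
    (h : μ ≠ ν) {x y : H} (hx : x ∈ Module.End.eigenspace (R : Module.End ℂ H) μ)
    (hy : y ∈ Module.End.eigenspace (R : Module.End ℂ H) ν) : inner ℂ x y = 0 :=
  hR.orthogonalFamily_eigenspaces h ⟨x, hx⟩ ⟨y, hy⟩

theorem specSum_isOrtho {R : H →L[ℂ] H} (hR : R.IsSymmetric) {I J : Set ℝ} (h : Disjoint I J) :
    specSum R I ⟂ specSum R J := by
  simp only [specSum, Submodule.isOrtho_iSup_left, Submodule.isOrtho_iSup_right]
  intro ν hν ξ hξ
  rw [Submodule.isOrtho_iff_inner_eq]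
  intro x hx y hy
  refine inner_eq_zero_of_mem_eigenspace hR ?_ hx hy
  intro h'
  obtain rfl := Complex.ofReal_injective h'
  exact Set.disjoint_left.1 h hξ hν

/-- The quadratic form of `R` in terms of the components in the eigenspaces. -/
theorem exists_finsupp_of_mem_specSum {R : H →L[ℂ] H} (hR : R.IsSymmetric) {I : Set ℝ} {x : H}
    (hx : x ∈ specSum R I) : ∃ f : I →₀ H, ‖x‖ ^ 2 = ∑ ν ∈ f.support, ‖f ν‖ ^ 2 ∧
      (inner ℂ (R x) x).re = ∑ ν ∈ f.support, (ν : ℝ) * ‖f ν‖ ^ 2 := by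
  rw [specSum, iSup_subtype', Submodule.mem_iSup_iff_exists_finsupp] at hx
  obtain ⟨f, hf, rfl⟩ := hx
  have key : ∀ ν : I, inner ℂ (f ν) (∑ ξ ∈ f.support, f ξ) = ((‖f ν‖ ^ 2 : ℝ) : ℂ) := by
    intro ν
    rw [inner_sum]
    have hz : ∀ ξ : I, ξ ≠ ν → inner ℂ (f ν) (f ξ) = 0 := fun ξ hξ =>
      inner_eq_zero_of_mem_eigenspace hR
        (fun h => hξ (Subtype.ext (Complex.ofReal_injective h)).symm) (hf ν) (hf ξ)
    rw [Finset.sum_eq_single ν (fun ξ _ hξ => hz ξ hξ)]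
    · rw [inner_self_eq_norm_sq_to_K]
      push_cast
      rfl
    · intro h
      rw [Finsupp.notMem_support_iff.1 h]
      simp
  refine ⟨f, ?_, ?_⟩
  · have : ((‖∑ ξ ∈ f.support, f ξ‖ ^ 2 : ℝ) : ℂ) = ((∑ ν ∈ f.support, ‖f ν‖ ^ 2 : ℝ) : ℂ) := by
      have h := inner_self_eq_norm_sq_to_K (𝕜 := ℂ) (∑ ξ ∈ f.support, f ξ)
      rw [sum_inner, Finset.sum_congr rfl fun ν _ => key ν] at h
      push_cast at h ⊢
      exact h.symm
    exact_mod_cast this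
  · have hRf : ∀ ν : I, R (f ν) = ((ν : ℝ) : ℂ) • f ν := fun ν =>
      Module.End.mem_eigenspace_iff.1 (hf ν)
    rw [Finsupp.sum, map_sum, sum_inner, Complex.re_sum]
    refine Finset.sum_congr rfl fun ν _ => ?_
    rw [hRf, inner_smul_left, key ν, Complex.conj_ofReal, ← Complex.ofReal_mul, Complex.ofReal_re]

theorem le_inner_of_mem_specSum {R : H →L[ℂ] H} (hR : R.IsSymmetric) {m : ℝ} {x : H}
    (hx : x ∈ specSum R (Ici m)) : m * ‖x‖ ^ 2 ≤ (inner ℂ (R x) x).re := by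
  obtain ⟨f, h1, h2⟩ := exists_finsupp_of_mem_specSum hR hx
  rw [h1, h2, Finset.mul_sum]
  exact Finset.sum_le_sum fun ν _ => mul_le_mul_of_nonneg_right ν.2 (sq_nonneg _)

theorem inner_le_of_mem_specSum {R : H →L[ℂ] H} (hR : R.IsSymmetric) {m : ℝ} {x : H}
    (hx : x ∈ specSum R (Iic m)) : (inner ℂ (R x) x).re ≤ m * ‖x‖ ^ 2 := by
  obtain ⟨f, h1, h2⟩ := exists_finsupp_of_mem_specSum hR hx
  rw [h1, h2, Finset.mul_sum]
  exact Finset.sum_le_sum fun ν _ => mul_le_mul_of_nonneg_right ν.2 (sq_nonneg _)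

/-- The algebraic sum of infinitely many eigenspaces need not be closed, but the inequality is a
closed condition. -/
theorem inner_le_of_mem_closure_specSum {R : H →L[ℂ] H} (hR : R.IsSymmetric) {m : ℝ} {x : H}
    (hx : x ∈ (specSum R (Iic m)).topologicalClosure) :
    (inner ℂ (R x) x).re ≤ m * ‖x‖ ^ 2 := by
  have hc : IsClosed {y : H | (inner ℂ (R y) y).re ≤ m * ‖y‖ ^ 2} :=
    isClosed_le (Complex.continuous_re.comp ((R.continuous).inner continuous_id)) (by fun_prop)
  exact closure_minimal (fun y hy => inner_le_of_mem_specSum hR hy) hc hx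

/-- Cauchy–Schwarz turns the bound on the form into a bound on `‖R x‖`, again a closed condition.
For `m > 0` it makes `R` antilipschitz on the closure. -/
theorem mul_norm_le_norm_apply_of_mem_closure {R : H →L[ℂ] H} (hR : R.IsSymmetric) {m : ℝ} {x : H}
    (hx : x ∈ (specSum R (Ici m)).topologicalClosure) : m * ‖x‖ ≤ ‖R x‖ := by
  have hc : IsClosed {y : H | m * ‖y‖ ≤ ‖R y‖} := isClosed_le (by fun_prop) (by fun_prop)
  refine closure_minimal (fun y hy => ?_) hc hx
  have h1 := le_inner_of_mem_specSum hR hy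
  have h2 : (inner ℂ (R y) y).re ≤ ‖R y‖ * ‖y‖ := (Complex.re_le_norm _).trans (norm_inner_le_norm _ _)
  rcases (norm_nonneg y).eq_or_lt with h0 | h0
  · simp [← h0]
  · exact le_of_mul_le_mul_right (by nlinarith) h0

/-- The orthogonal projection of `S` to the smaller space `F` cannot be injective. This is the
dimension count behind both min-max comparisons. -/
theorem exists_mem_orthogonal_of_rank_lt {F S : Submodule ℂ H} [FiniteDimensional ℂ F]
    (h : Module.rank ℂ F < Module.rank ℂ S) : ∃ x ∈ S, x ∈ Fᗮ ∧ x ≠ 0 := by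
  by_contra! hcon
  set P : S →ₗ[ℂ] F := F.orthogonalProjectionOnto.toLinearMap ∘ₗ S.subtype with hP
  refine h.not_ge (LinearMap.rank_le_of_injective P ?_)
  rw [← LinearMap.ker_eq_bot, LinearMap.ker_eq_bot']
  intro x hx
  refine Subtype.ext (hcon x x.2 ?_)
  exact Submodule.orthogonalProjectionOnto_eq_zero_iff.1 hx

/-- A subspace of finite codimension on which the quadratic form is small bounds the number of
eigenvalues above. -/
theorem rank_specSum_le {R : H →L[ℂ] H} (hR : R.IsSymmetric)
    {F : Submodule ℂ H} [FiniteDimensional ℂ F] {m m' : ℝ}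
    (hF : ∀ x ∈ Fᗮ, (inner ℂ (R x) x).re ≤ m * ‖x‖ ^ 2) (hm : m < m') :
    Module.rank ℂ (specSum R (Ici m')) ≤ Module.rank ℂ F := by
  by_contra! h
  obtain ⟨x, hxS, hxo, hx0⟩ := exists_mem_orthogonal_of_rank_lt h
  have h1 := le_inner_of_mem_specSum hR hxS
  have h2 := hF x hxo
  have h3 : 0 < ‖x‖ ^ 2 := by positivity
  nlinarith

variable [CompleteSpace H]

/-- Split `x` along the closure `N` of the `J`-part. The remainder is orthogonal to the eigenspaces
in `I` because `x` and `N` are, and to those in `J` by construction; there are no non-real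
eigenvalues. The spectral theorem for compact symmetric operators makes it zero. -/
theorem orthogonal_specSum_le {R : H →L[ℂ] H} (hc : IsCompactOperator R) (hR : R.IsSymmetric)
    {I J : Set ℝ} (hIJ : I ∪ J = univ) (hd : Disjoint I J) :
    (specSum R I)ᗮ ≤ (specSum R J).topologicalClosure := by
  intro x hx
  set N := (specSum R J).topologicalClosure with hN
  have : CompleteSpace N := (Submodule.isClosed_topologicalClosure _).completeSpace_coe
  have hNo : Nᗮ = (specSum R J)ᗮ := Submodule.orthogonal_closure _
  have hNI : N ≤ (specSum R I)ᗮ :=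
    Submodule.topologicalClosure_minimal _ ((specSum_isOrtho hR hd).symm)
      (Submodule.isClosed_orthogonal _)
  obtain ⟨a, ha, b, hb, rfl⟩ := N.exists_add_mem_mem_orthogonal x
  have hbI : b ∈ (specSum R I)ᗮ := by
    simpa using Submodule.sub_mem _ hx (hNI ha)
  have hb0 : b ∈ (⨆ μ, Module.End.eigenspace (R : Module.End ℂ H) μ)ᗮ := by
    rw [← Submodule.iInf_orthogonal, Submodule.mem_iInf]
    intro μ
    by_cases hμ : Module.End.eigenspace (R : Module.End ℂ H) μ = ⊥
    · simp [hμ]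
    · have hev : Module.End.HasEigenvalue (R : Module.End ℂ H) μ := hμ
      have hreal := hR.conj_eigenvalue_eq_self hev
      obtain ⟨ν, rfl⟩ := Complex.conj_eq_iff_real.1 hreal
      rcases (hIJ ▸ mem_univ ν : ν ∈ I ∪ J) with h | h
      · exact Submodule.orthogonal_le (eigenspace_le_specSum R h) hbI
      · rw [hNo] at hb
        exact Submodule.orthogonal_le (eigenspace_le_specSum R h) hb
  rw [ContinuousLinearMap.orthogonalComplement_iSup_eigenspaces_eq_bot hc hR,
    Submodule.mem_bot] at hb0
  simpa [hb0] using ha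

theorem inner_le_of_mem_orthogonal {R : H →L[ℂ] H} (hc : IsCompactOperator R) (hR : R.IsSymmetric)
    {m : ℝ} {x : H} (hx : x ∈ (specSum R (Ici m))ᗮ) : (inner ℂ (R x) x).re ≤ m * ‖x‖ ^ 2 := by
  refine inner_le_of_mem_closure_specSum hR ?_
  refine Submodule.topologicalClosure_mono (specSum_mono R Iio_subset_Iic_self) ?_
  refine orthogonal_specSum_le hc hR ?_ ?_ hx
  · rw [union_comm]; exact Iio_union_Ici
  · exact Set.disjoint_left.2 fun y (hy : m ≤ y) (hy' : y < m) => hy.not_gt hy'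

/-- On the closure of the sum `R` is bounded below, hence a closed embedding, and it is compact; so
the closed unit ball there is compact and Riesz's theorem applies. -/
theorem finiteDimensional_specSum {R : H →L[ℂ] H} (hc : IsCompactOperator R) (hR : R.IsSymmetric)
    {m : ℝ} (hm : 0 < m) : FiniteDimensional ℂ (specSum R (Ici m)) := by
  set N := (specSum R (Ici m)).topologicalClosure with hN
  have : CompleteSpace N := (Submodule.isClosed_topologicalClosure _).completeSpace_coe
  set g : N →L[ℂ] H := R.comp N.subtypeL with hg
  have hanti : AntilipschitzWith (Real.toNNReal m⁻¹) g := by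
    refine ContinuousLinearMap.antilipschitz_of_bound _ fun x => ?_
    rw [Real.coe_toNNReal _ (by positivity)]
    have := mul_norm_le_norm_apply_of_mem_closure hR x.2
    rw [inv_mul_eq_div, le_div_iff₀ hm, mul_comm]
    exact this
  have hemb := hanti.isClosedEmbedding g.uniformContinuous
  have hgc : IsCompactOperator g := hc.comp_clm N.subtypeL
  obtain ⟨K, hK, hKs⟩ := hgc.image_closedBall_subset_compact 1
  have hball : IsCompact (Metric.closedBall (0 : N) 1) :=
    (hemb.isCompact_preimage hK).of_isClosed_subset Metric.isClosed_closedBall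
      fun x hx => hKs ⟨x, hx, rfl⟩
  have : FiniteDimensional ℂ N := FiniteDimensional.of_isCompact_closedBall ℂ one_pos hball
  exact Submodule.finiteDimensional_of_le (Submodule.le_topologicalClosure _)

/-- A subspace on which the quadratic form is large bounds the number of eigenvalues below. -/
theorem le_rank_specSum {R : H →L[ℂ] H} (hc : IsCompactOperator R) (hR : R.IsSymmetric)
    {S : Submodule ℂ H} {m m' : ℝ} (hS : ∀ x ∈ S, m * ‖x‖ ^ 2 ≤ (inner ℂ (R x) x).re)
    (hm' : 0 < m') (hm : m' < m) : Module.rank ℂ S ≤ Module.rank ℂ (specSum R (Ici m')) := by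
  by_contra! h
  have := finiteDimensional_specSum hc hR hm'
  obtain ⟨x, hxS, hxo, hx0⟩ := exists_mem_orthogonal_of_rank_lt h
  have h1 := inner_le_of_mem_orthogonal hc hR hxo
  have h2 := hS x hxS
  have h3 : 0 < ‖x‖ ^ 2 := by positivity
  nlinarith

/-- The nonzero eigenvalues of a compact self-adjoint operator are isolated. -/
theorem exists_gap {R : H →L[ℂ] H} (hc : IsCompactOperator R) (hR : R.IsSymmetric) {μ : ℝ}
    (hμ : 0 < μ) : ∃ δ > 0, δ < μ ∧ specSum R (Ici μ) = specSum R (Ici (μ - δ)) ∧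
      specSum R (Ioi μ) = specSum R (Ici (μ + δ)) := by
  have := finiteDimensional_specSum hc hR (half_pos hμ)
  -- `T` collects the eigenvalues above `μ / 2`. Eigenvectors for distinct elements of `T` are
  -- independent in a finite-dimensional space, so `T` is finite.
  set T : Set ℝ := {ν | μ / 2 ≤ ν ∧ Module.End.eigenspace (R : Module.End ℂ H) (ν : ℂ) ≠ ⊥}
  have hT : T.Finite := by
    have hex : ∀ ν : T, ∃ x : specSum R (Ici (μ / 2)),
        Module.End.HasEigenvector (R : Module.End ℂ H) ((ν : ℝ) : ℂ) x := by
      rintro ⟨ν, hν, hne⟩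
      obtain ⟨x, hx, hx0⟩ := Submodule.exists_mem_ne_zero_of_ne_bot hne
      exact ⟨⟨x, eigenspace_le_specSum R hν hx⟩, hx, hx0⟩
    choose x hx using hex
    have hli : LinearIndependent ℂ fun ν : T => ((x ν : specSum R (Ici (μ / 2))) : H) :=
      Module.End.eigenvectors_linearIndependent' (R : Module.End ℂ H) (fun ν : T => ((ν : ℝ) : ℂ))
        (fun a b h => Subtype.ext (Complex.ofReal_injective h)) _ hx
    have hli' : LinearIndependent ℂ x :=
      LinearIndependent.of_comp (specSum R (Ici (μ / 2))).subtype hli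
    exact Set.finite_coe_iff.1 hli'.finite
  have hnhds : (T \ {μ})ᶜ ∈ 𝓝 μ := (hT.subset sdiff_subset).isClosed.isOpen_compl.mem_nhds (by simp)
  obtain ⟨ε, hε, hball⟩ := Metric.mem_nhds_iff.1 hnhds
  -- Half of `ε` keeps the closed interval `[μ - δ, μ + δ]` inside the open ball; the cap `μ / 2`
  -- keeps it in the range covered by `T` and gives `δ < μ`.
  set δ := min (ε / 2) (μ / 2) with hδ
  have hδε : δ ≤ ε / 2 := min_le_left _ _
  have hδμ : δ ≤ μ / 2 := min_le_right _ _
  have hδ0 : 0 < δ := lt_min (half_pos hε) (half_pos hμ)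
  have hbot : ∀ ν : ℝ, μ - δ ≤ ν → ν ≤ μ + δ → ν ≠ μ →
      Module.End.eigenspace (R : Module.End ℂ H) (ν : ℂ) = ⊥ := by
    intro ν h1 h2 h3
    by_contra hne
    have : ν ∈ Metric.ball μ ε := by
      rw [Metric.mem_ball, Real.dist_eq, abs_lt]
      constructor <;> linarith
    exact hball this ⟨⟨by linarith, hne⟩, h3⟩
  refine ⟨δ, hδ0, by linarith, ?_, ?_⟩
  · refine specSum_eq_of_forall_eigenspace_eq_bot R (Ici_subset_Ici.2 (by linarith)) ?_
    intro ν h1 h2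
    have h2' : ν < μ := not_le.1 h2
    exact hbot ν h1 (by linarith) h2'.ne
  · refine (specSum_eq_of_forall_eigenspace_eq_bot R (fun ν h => ?_) ?_).symm
    · exact lt_of_lt_of_le (by linarith) (show μ + δ ≤ ν from h)
    · intro ν h1 h2
      have h2' : ν < μ + δ := not_le.1 h2
      have h1' : μ < ν := h1
      exact hbot ν (by linarith) h2'.le h1'.ne'

end CompactOperator

/-! ### Perturbation of a simple eigenvalue -/

section Perturbation

variable {H : Type*} [NormedAddCommGroup H] [InnerProductSpace ℂ H]

/-- There is no cross term: `A y` is orthogonal to the eigenvector `v` because `A` is symmetric. -/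
theorem inner_apply_smul_add {A : H →L[ℂ] H} (hA : A.IsSymmetric) {v y : H} {μ : ℝ}
    (hv : ‖v‖ = 1) (hAv : A v = (μ : ℂ) • v) (hy : inner ℂ v y = 0) (c : ℂ) :
    (inner ℂ (A (c • v + y)) (c • v + y)).re = μ * ‖c‖ ^ 2 + (inner ℂ (A y) y).re := by
  have h1 : inner ℂ (A y) v = 0 := by
    have : inner ℂ (A y) v = inner ℂ y (A v) := hA y v
    rw [this, hAv, inner_smul_right, inner_eq_zero_symm.1 hy, mul_zero]
  have h2 : inner ℂ v v = (1 : ℂ) := by rw [inner_self_eq_norm_sq_to_K, hv]; simp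
  simp only [map_add, map_smul, hAv, inner_add_left, inner_add_right, inner_smul_left,
    inner_smul_right, hy, h1, h2, mul_zero, add_zero, zero_add, mul_one, Complex.conj_ofReal]
  rw [Complex.add_re]
  congr 1
  rw [← mul_assoc, mul_comm c, ← Complex.normSq_eq_conj_mul_self, Complex.normSq_eq_norm_sq,
    ← Complex.ofReal_mul, Complex.ofReal_re, mul_comm]

/-- Only the term in `⟨P v, v⟩` is kept exact, since it produces the derivative of the eigenvalue;
the others carry a factor `‖y‖` and are estimated by the operator norm. -/
theorem inner_perturbation_le (P : H →L[ℂ] H) {v y : H} (hv : ‖v‖ = 1) (c : ℂ) :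
    (inner ℂ (P (c • v + y)) (c • v + y)).re ≤
      (inner ℂ (P v) v).re * ‖c‖ ^ 2 + 2 * ‖P‖ * ‖c‖ * ‖y‖ + ‖P‖ * ‖y‖ ^ 2 := by
  have e : inner ℂ (P (c • v + y)) (c • v + y) = ((‖c‖ ^ 2 : ℝ) : ℂ) * inner ℂ (P v) v +
      inner ℂ (P (c • v)) y + inner ℂ (P y) (c • v) + inner ℂ (P y) y := by
    rw [← Complex.normSq_eq_norm_sq, Complex.normSq_eq_conj_mul_self]
    simp only [map_add, map_smul, inner_add_left, inner_add_right, inner_smul_left,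
      inner_smul_right]
    ring
  have b : ∀ a b : H, (inner ℂ (P a) b).re ≤ ‖P‖ * ‖a‖ * ‖b‖ := fun a b =>
    (Complex.re_le_norm _).trans ((norm_inner_le_norm _ _).trans
      (mul_le_mul_of_nonneg_right (P.le_opNorm a) (norm_nonneg b)))
  have hc : ‖c • v‖ = ‖c‖ := by rw [norm_smul, hv, mul_one]
  have b1 := b (c • v) y
  have b2 := b y (c • v)
  have b3 := b y y
  rw [hc] at b1 b2
  rw [e]
  simp only [Complex.add_re, Complex.re_ofReal_mul]
  nlinarith

/-- The quadratic form of `A + P` near a simple eigenvalue `μ` of `A`, on a subspace where `μ` is the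
top of the spectrum of `A`. -/
theorem inner_add_perturbation_le {A P : H →L[ℂ] H} (hA : A.IsSymmetric) {v y : H} {μ δ : ℝ}
    (hδ : 0 < δ) (hv : ‖v‖ = 1) (hAv : A v = (μ : ℂ) • v) (hy : inner ℂ v y = 0)
    (hAy : (inner ℂ (A y) y).re ≤ (μ - δ) * ‖y‖ ^ 2) (hP : ‖P‖ ≤ δ / 4) (c : ℂ) :
    (inner ℂ ((A + P) (c • v + y)) (c • v + y)).re ≤
      (μ + (inner ℂ (P v) v).re + 2 / δ * ‖P‖ ^ 2) * ‖c • v + y‖ ^ 2 := by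
  have hn : ‖c • v + y‖ ^ 2 = ‖c‖ ^ 2 + ‖y‖ ^ 2 := by
    have := norm_add_sq_eq_norm_sq_add_norm_sq_of_inner_eq_zero (𝕜 := ℂ) (c • v) y
      (by rw [inner_smul_left, hy, mul_zero])
    rw [norm_smul, hv, mul_one] at this
    simpa [sq] using this
  have h1 := inner_apply_smul_add hA hv hAv hy c
  have h2 := inner_perturbation_le P (y := y) hv c
  have hp : |(inner ℂ (P v) v).re| ≤ ‖P‖ := by
    refine (Complex.abs_re_le_norm _).trans ((norm_inner_le_norm _ _).trans ?_)
    simpa [hv] using P.le_opNorm v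
  rw [add_apply, inner_add_left, Complex.add_re, h1, hn]
  set p := (inner ℂ (P v) v).re
  set ε := ‖P‖
  have hε : 0 ≤ ε := norm_nonneg _
  have hp' := (abs_le.1 hp).1
  -- The weights are chosen so that the cross term costs only second order in `ε` on `‖c‖²` and half
  -- of the gap `δ` on `‖y‖²`.
  have am : 2 * ε * ‖c‖ * ‖y‖ ≤ 2 / δ * ε ^ 2 * ‖c‖ ^ 2 + δ / 2 * ‖y‖ ^ 2 := by
    have : 2 / δ * ε ^ 2 * ‖c‖ ^ 2 + δ / 2 * ‖y‖ ^ 2 - 2 * ε * ‖c‖ * ‖y‖ =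
        2 / δ * (ε * ‖c‖ - δ / 2 * ‖y‖) ^ 2 := by field_simp; ring
    have h : 0 ≤ 2 / δ * (ε * ‖c‖ - δ / 2 * ‖y‖) ^ 2 := by positivity
    linarith
  have h3 : 0 ≤ 2 / δ * ε ^ 2 * ‖y‖ ^ 2 := by positivity
  -- The other half of the gap pays for `ε‖y‖²` and for a negative `p`. As `p ≥ -ε`, this needs `2ε
  -- ≤ δ / 2`, whence the threshold `δ / 4`.
  have h4 : 0 ≤ (δ / 2 + p - ε) * ‖y‖ ^ 2 := mul_nonneg (by linarith) (sq_nonneg _)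
  nlinarith

variable [CompleteSpace H]

/-- First order perturbation theory for the number of eigenvalues above a given level. -/
theorem rank_specSum_perturbation {A : H →L[ℂ] H} (hc : IsCompactOperator A) (hA : A.IsSymmetric)
    {μ : ℝ} (hμ : 0 < μ)
    (hsimple : Module.rank ℂ (Module.End.eigenspace (A : Module.End ℂ H) (μ : ℂ)) = 1) {n : ℕ}
    (hlow : ∀ ν, 0 < ν → ν < μ → (n : Cardinal) ≤ Module.rank ℂ (specSum A (Ici ν)))
    (hhigh : ∀ ν, μ < ν → Module.rank ℂ (specSum A (Ici ν)) < n) :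
    ∃ (v : H) (C : ℝ) (ε : ℝ), 0 < ε ∧ ∀ R : H →L[ℂ] H, IsCompactOperator R → R.IsSymmetric →
      ‖R - A‖ ≤ ε →
      (∀ m, 0 < m → m < μ + (inner ℂ ((R - A) v) v).re - C * ‖R - A‖ ^ 2 →
        (n : Cardinal) ≤ Module.rank ℂ (specSum R (Ici m))) ∧
      ∀ m, μ + (inner ℂ ((R - A) v) v).re + C * ‖R - A‖ ^ 2 < m →
        Module.rank ℂ (specSum R (Ici m)) < n := by
  obtain ⟨δ, hδ, hδμ, hge, hgt⟩ := exists_gap hc hA hμ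
  obtain ⟨v₀, hv₀0, hv₀⟩ := finrank_eq_one_iff'.1 (Module.finrank_eq_of_rank_eq hsimple)
  set v : H := ((‖(v₀ : H)‖⁻¹ : ℝ) : ℂ) • (v₀ : H) with hvdef
  have hv₀n : ‖(v₀ : H)‖ ≠ 0 := by simpa using hv₀0
  have hv : ‖v‖ = 1 := by
    rw [hvdef, norm_smul, Complex.norm_real, Real.norm_of_nonneg (by positivity)]
    exact inv_mul_cancel₀ hv₀n
  have hvm : v ∈ Module.End.eigenspace (A : Module.End ℂ H) (μ : ℂ) :=
    Submodule.smul_mem _ _ v₀.2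
  have hAv : A v = (μ : ℂ) • v := Module.End.mem_eigenspace_iff.1 hvm
  have hspan : ∀ x ∈ Module.End.eigenspace (A : Module.End ℂ H) (μ : ℂ), ∃ c : ℂ, c • v = x := by
    intro x hx
    obtain ⟨c, hcx⟩ := hv₀ ⟨x, hx⟩
    refine ⟨c * ‖(v₀ : H)‖, ?_⟩
    have hcx' : c • (v₀ : H) = x := congrArg Subtype.val hcx
    rw [hvdef, smul_smul, ← hcx']
    congr 1
    push_cast
    rw [mul_assoc, mul_inv_cancel₀ (by exact_mod_cast hv₀n), mul_one]
  have hIci : Ici μ = insert μ (Ioi μ) := Ioi_insert.symm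
  have hsup : specSum A (Ici μ) =
      Module.End.eigenspace (A : Module.End ℂ H) (μ : ℂ) ⊔ specSum A (Ioi μ) := by
    rw [hIci, specSum, iSup_insert]
    rfl
  have hortho : ∀ y ∈ specSum A (Ioi μ), inner ℂ v y = 0 := by
    intro y hy
    have h1 : v ∈ specSum A {μ} := eigenspace_le_specSum A (mem_singleton μ) hvm
    exact (Submodule.isOrtho_iff_inner_eq.1
      (specSum_isOrtho hA (I := {μ}) (J := Ioi μ) (by simp))) v h1 y hy
  refine ⟨v, 2 / δ, δ / 4, by positivity, fun R hRc hR hRA => ?_⟩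
  set P := R - A with hP
  have hRP : R = A + P := by rw [hP]; abel
  constructor
  · intro m hm0 hm
    have hn : (n : Cardinal) ≤ Module.rank ℂ (specSum A (Ici μ)) := by
      -- `hlow` speaks only of levels strictly below `μ`; the spectral gap carries it to `μ` itself.
      rw [hge]
      exact hlow _ (by linarith) (by linarith)
    refine hn.trans (le_rank_specSum hRc hR (fun x hx => ?_) hm0 hm)
    rw [hsup, Submodule.mem_sup] at hx
    obtain ⟨x', hx', y, hy, rfl⟩ := hx
    obtain ⟨c, rfl⟩ := hspan x' hx'
    have hAy : (μ + δ) * ‖y‖ ^ 2 ≤ (inner ℂ (A y) y).re :=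
      le_inner_of_mem_specSum hA (hgt ▸ hy)
    have hnA : (-A).IsSymmetric := fun a b => by
      have : inner ℂ (A a) b = inner ℂ a (A b) := hA a b
      simp [this]
    -- On the spectral subspace of `[μ, ∞)` the eigenvalue `μ` is at the bottom. Changing signs puts
    -- it at the top, and yields a lower bound for the form of `R`.
    have := inner_add_perturbation_le (A := -A) (P := -P) (v := v) (y := y) (μ := -μ) hnA hδ hv
      (by simp [hAv]) (hortho y hy) (by simp; linarith) (by rwa [norm_neg]) c
    rw [← neg_add, ← hRP, norm_neg] at this
    simp only [neg_apply, inner_neg_left, Complex.neg_re] at this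
    linarith
  · intro m hm
    have hrank : Module.rank ℂ (specSum A (Ioi μ)) < n := by
      rw [hgt]
      exact hhigh _ (by linarith)
    have hfd : FiniteDimensional ℂ (specSum A (Ioi μ)) := by
      rw [hgt]
      exact finiteDimensional_specSum hc hA (by linarith)
    -- Test space: the complement of the eigenvectors strictly above `μ`, which number fewer than
    -- `n`. There `x = c v + y` with `y` orthogonal to everything at or above `μ`, so by the gap the
    -- form of `A` at `y` is at most `(μ - δ)‖y‖²`.
    refine lt_of_le_of_lt (rank_specSum_le hR (F := specSum A (Ioi μ)) (fun x hx => ?_) hm) hrank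
    set y := x - (inner ℂ v x : ℂ) • v with hy
    have hxy : x = (inner ℂ v x : ℂ) • v + y := by rw [hy]; abel
    have hvy : inner ℂ v y = 0 := by
      rw [hy, inner_sub_right, inner_smul_right, inner_self_eq_norm_sq_to_K, hv]
      simp
    have hvo : v ∈ (specSum A (Ioi μ))ᗮ := by
      rw [Submodule.mem_orthogonal']
      exact hortho
    have hyo : y ∈ (specSum A (Ici μ))ᗮ := by
      rw [hsup, ← Submodule.inf_orthogonal]
      refine ⟨?_, Submodule.sub_mem _ hx (Submodule.smul_mem _ _ hvo)⟩
      refine (Submodule.mem_orthogonal _ _).2 fun z hz => ?_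
      obtain ⟨c, rfl⟩ := hspan z hz
      rw [inner_smul_left, hvy, mul_zero]
    have := inner_add_perturbation_le (P := P) hA hδ hv hAv hvy
      (inner_le_of_mem_orthogonal hc hA (hge ▸ hyo)) hRA (inner ℂ v x)
    rwa [← hRP, ← hxy] at this

end Perturbation

/-! ### Eigenvalues of an operator with compact resolvent -/

section Resolvent

variable {H : Type*} [NormedAddCommGroup H] [InnerProductSpace ℂ H]

/-- `R` behaves as the resolvent at `-K` of an operator `T > -K`, as far as eigenvectors are
concerned. -/
structure EigenResolvent (T : H →ₗ.[ℂ] H) (K : ℝ) (R : H →L[ℂ] H) : Prop where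
  eigenspace_eq_bot : ∀ s : ℝ, s ≤ -K → eigenspace T (s : ℂ) = ⊥
  eigenspace_eq : ∀ s : ℝ, -K < s →
    eigenspace T (s : ℂ) = Module.End.eigenspace (R : Module.End ℂ H) (((s + K)⁻¹ : ℝ) : ℂ)

variable {T : H →ₗ.[ℂ] H} {K : ℝ} {R : H →L[ℂ] H}

theorem EigenResolvent.eigenCount_of_le (h : EigenResolvent T K R) {t : ℝ} (ht : t ≤ -K) :
    eigenCount T t = 0 := by
  have : (⨆ s ∈ Iic t, eigenspace T (s : ℂ) : Submodule ℂ H) = ⊥ := by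
    rw [iSup₂_eq_bot]
    exact fun s hs => h.eigenspace_eq_bot s (le_trans hs ht)
  rw [eigenCount, this, rank_bot]

/-- The map `s ↦ 1/(s + K)` is an order-reversing bijection from `(-K, ∞)` to `(0, ∞)`, and there
are no eigenvalues at or below `-K`. -/
theorem EigenResolvent.eigenCount_eq (h : EigenResolvent T K R) {t : ℝ} (ht : -K < t) :
    eigenCount T t = Module.rank ℂ (specSum R (Ici (t + K)⁻¹)) := by
  have : (⨆ s ∈ Iic t, eigenspace T (s : ℂ) : Submodule ℂ H) = specSum R (Ici (t + K)⁻¹) := by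
    refine le_antisymm (iSup₂_le fun s hs => ?_) (iSup₂_le fun ν hν => ?_)
    · rcases le_or_gt s (-K) with hsK | hsK
      · rw [h.eigenspace_eq_bot s hsK]
        exact bot_le
      · rw [h.eigenspace_eq s hsK]
        refine eigenspace_le_specSum R ?_
        have hs' : s ≤ t := hs
        exact inv_anti₀ (show 0 < s + K by linarith) (show s + K ≤ t + K by linarith)
    · have hpos : 0 < (t + K)⁻¹ := inv_pos.2 (by linarith)
      have hν' : (t + K)⁻¹ ≤ ν := hν
      have hν0 : 0 < ν := hpos.trans_le hν'
      have e : Module.End.eigenspace (R : Module.End ℂ H) (ν : ℂ) =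
          eigenspace T ((ν⁻¹ - K : ℝ) : ℂ) := by
        rw [h.eigenspace_eq _ (by have := inv_pos.2 hν0; linarith), sub_add_cancel, inv_inv]
      rw [e]
      refine le_biSup (fun s : ℝ => eigenspace T (s : ℂ)) ?_
      have := inv_anti₀ hpos hν'
      rw [inv_inv] at this
      show ν⁻¹ - K ≤ t
      linarith
  rw [eigenCount, this]

theorem EigenResolvent.lt_of_le_eigenCount (h : EigenResolvent T K R) {t : ℝ} {n : ℕ} (hn : 1 ≤ n)
    (ht : (n : Cardinal) ≤ eigenCount T t) : -K < t := by
  by_contra! hle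
  rw [h.eigenCount_of_le hle] at ht
  have : (n : Cardinal) = 0 := le_antisymm ht zero_le
  rw [Nat.cast_eq_zero] at this
  omega

/-- The set in the infimum is bounded below by `-K` because `n ≥ 1`; otherwise `sInf` could be a
default value. -/
theorem EigenResolvent.nthEigenvalue_le (h : EigenResolvent T K R) {n : ℕ} (hn : 1 ≤ n) {m : ℝ}
    (hm : 0 < m) (hle : (n : Cardinal) ≤ Module.rank ℂ (specSum R (Ici m))) :
    nthEigenvalue T n ≤ m⁻¹ - K := by
  refine csInf_le ⟨-K, fun t ht => (h.lt_of_le_eigenCount hn ht).le⟩ ?_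
  have : -K < m⁻¹ - K := by have := inv_pos.2 hm; linarith
  show (n : Cardinal) ≤ eigenCount T (m⁻¹ - K)
  rwa [h.eigenCount_eq this, sub_add_cancel, inv_inv]

/-- The level `m₀` serves only to make the set in the infimum nonempty; `sInf ∅` would be `0`. -/
theorem EigenResolvent.le_nthEigenvalue (h : EigenResolvent T K R) {n : ℕ} (hn : 1 ≤ n) {m m₀ : ℝ}
    (hm : 0 < m) (hne : 0 < m₀ ∧ (n : Cardinal) ≤ Module.rank ℂ (specSum R (Ici m₀)))
    (hlt : ∀ m', m < m' → Module.rank ℂ (specSum R (Ici m')) < n) :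
    m⁻¹ - K ≤ nthEigenvalue T n := by
  refine le_csInf ⟨m₀⁻¹ - K, ?_⟩ fun t ht => ?_
  · have : -K < m₀⁻¹ - K := by have := inv_pos.2 hne.1; linarith
    show (n : Cardinal) ≤ eigenCount T (m₀⁻¹ - K)
    rw [h.eigenCount_eq this, sub_add_cancel, inv_inv]
    exact hne.2
  · have hK := h.lt_of_le_eigenCount hn ht
    by_contra! hcon
    refine (hlt (t + K)⁻¹ ?_).not_ge ?_
    · rw [lt_inv_comm₀ hm (by linarith)]
      linarith
    · rw [← h.eigenCount_eq hK]
      exact ht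

variable [CompleteSpace H]

/-- The `n`-th eigenvalue is differentiable where it is simple. -/
theorem differentiableAt_nthEigenvalue {X : Type*} [NormedAddCommGroup X] [NormedSpace ℝ X]
    {T : X → H →ₗ.[ℂ] H} {K : ℝ} {R : X → H →L[ℂ] H}
    (h : ∀ x, EigenResolvent (T x) K (R x)) (hc : ∀ x, IsCompactOperator (R x))
    (hR : ∀ x, (R x).IsSymmetric) {x₀ : X} (hd : DifferentiableAt ℝ R x₀) {n : ℕ} (hn : 1 ≤ n)
    (hne : ∃ m₀ > 0, (n : Cardinal) ≤ Module.rank ℂ (specSum (R x₀) (Ici m₀)))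
    (hsimple : multiplicity (T x₀) (nthEigenvalue (T x₀) n : ℂ) = 1) :
    DifferentiableAt ℝ (fun x => nthEigenvalue (T x) n) x₀ := by
  set l := nthEigenvalue (T x₀) n with hl
  obtain ⟨m₀, hm₀, hm₀n⟩ := hne
  have hlK : -K < l := by
    by_contra! hle
    rw [multiplicity, (h x₀).eigenspace_eq_bot l hle, rank_bot] at hsimple
    exact zero_ne_one hsimple
  set μ := (l + K)⁻¹ with hμdef
  have hμ : 0 < μ := inv_pos.2 (by linarith)
  have hbdd : BddBelow {t : ℝ | (n : Cardinal) ≤ eigenCount (T x₀) t} :=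
    ⟨-K, fun t ht => ((h x₀).lt_of_le_eigenCount hn ht).le⟩
  have hnonempty : {t : ℝ | (n : Cardinal) ≤ eigenCount (T x₀) t}.Nonempty := by
    refine ⟨m₀⁻¹ - K, ?_⟩
    have : -K < m₀⁻¹ - K := by have := inv_pos.2 hm₀; linarith
    show (n : Cardinal) ≤ eigenCount (T x₀) (m₀⁻¹ - K)
    rwa [(h x₀).eigenCount_eq this, sub_add_cancel, inv_inv]
  have hlow : ∀ ν, 0 < ν → ν < μ → (n : Cardinal) ≤ Module.rank ℂ (specSum (R x₀) (Ici ν)) := by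
    intro ν hν hνμ
    have hlt : l < ν⁻¹ - K := by
      have := (lt_inv_comm₀ hν (by linarith : 0 < l + K)).1 hνμ
      linarith
    obtain ⟨t, ht, htl⟩ := exists_lt_of_csInf_lt hnonempty hlt
    have htK := (h x₀).lt_of_le_eigenCount hn ht
    rw [mem_ofPred_eq, (h x₀).eigenCount_eq htK] at ht
    refine ht.trans (Submodule.rank_mono (specSum_mono _ (Ici_subset_Ici.2 ?_)))
    rw [le_inv_comm₀ hν (by linarith)]
    linarith
  have hhigh : ∀ ν, μ < ν → Module.rank ℂ (specSum (R x₀) (Ici ν)) < n := by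
    intro ν hν
    by_contra! hcon
    have h1 := (h x₀).nthEigenvalue_le hn (hμ.trans hν) hcon
    have h2 : ν⁻¹ < l + K := inv_lt_of_inv_lt₀ (by linarith) hν
    linarith
  have hs : Module.rank ℂ (Module.End.eigenspace (R x₀ : Module.End ℂ H) (μ : ℂ)) = 1 := by
    rw [← (h x₀).eigenspace_eq l hlK]
    exact hsimple
  obtain ⟨v, C, ε, hε, hpert⟩ := rank_specSum_perturbation (hc x₀) (hR x₀) hμ hs hlow hhigh
  -- the two functions that enclose the eigenvalue of the resolvent
  set p : X → ℝ := fun x => μ + (inner ℂ ((R x - R x₀) v) v).re with hp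
  set g : X → ℝ := fun x => C * ‖R x - R x₀‖ ^ 2 with hg
  have hdv : DifferentiableAt ℝ (fun x => (R x - R x₀) v) x₀ := by
    have h1 : DifferentiableAt ℝ (fun x => R x - R x₀) x₀ := hd.sub_const _
    exact ((ContinuousLinearMap.apply ℂ H v).restrictScalars ℝ).differentiableAt.comp x₀ h1
  have hpd : DifferentiableAt ℝ p x₀ := by
    refine DifferentiableAt.const_add _ ?_
    have : DifferentiableAt ℝ (fun x => inner ℂ v ((R x - R x₀) v)) x₀ :=
      ((innerSL ℂ v).restrictScalars ℝ).differentiableAt.comp x₀ hdv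
    have h2 := Complex.reCLM.differentiableAt.comp x₀ this
    refine h2.congr_of_eventuallyEq (Eventually.of_forall fun x => ?_)
    show (inner ℂ ((R x - R x₀) v) v).re = (inner ℂ v ((R x - R x₀) v)).re
    rw [← inner_conj_symm, Complex.conj_re]
  -- `g` is quadratically small, so adding or subtracting it does not change the first-order
  -- expansion.
  have hgd : HasFDerivAt g (0 : X →L[ℝ] ℝ) x₀ := by
    have h1 : (fun x => R x - R x₀) =O[𝓝 x₀] fun x => x - x₀ := hd.isBigO_sub
    rw [hasFDerivAt_iff_isLittleO]
    have h2 : (fun x => ‖R x - R x₀‖ ^ 2) =o[𝓝 x₀] fun x => x - x₀ := by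
      have h3 : (fun x => ‖R x - R x₀‖ ^ 2) =O[𝓝 x₀] fun x => ‖x - x₀‖ ^ 2 := h1.norm_norm.pow 2
      refine h3.trans_isLittleO ?_
      exact Asymptotics.isLittleO_pow_sub_sub x₀ (by norm_num)
    simpa [hg] using h2.const_mul_left C
  have hp0 : p x₀ = μ := by simp [hp]
  have hg0 : g x₀ = 0 := by simp [hg]
  obtain ⟨p', hp'⟩ := hpd
  have hminus : HasFDerivAt (fun x => (p x - g x)⁻¹ - K) (-(μ ^ 2)⁻¹ • p') x₀ := by
    have := (hasDerivAt_inv (x := p x₀ - g x₀) (by rw [hp0, hg0]; simpa using hμ.ne')).comp_hasFDerivAt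
      x₀ (hp'.sub hgd)
    simpa [hp0, hg0] using this.sub_const K
  have hplus : HasFDerivAt (fun x => (p x + g x)⁻¹ - K) (-(μ ^ 2)⁻¹ • p') x₀ := by
    have := (hasDerivAt_inv (x := p x₀ + g x₀) (by rw [hp0, hg0]; simpa using hμ.ne')).comp_hasFDerivAt
      x₀ (hp'.add hgd)
    simpa [hp0, hg0] using this.sub_const K
  have hcontR : ∀ᶠ x in 𝓝 x₀, ‖R x - R x₀‖ ≤ ε := by
    have : Tendsto (fun x => ‖R x - R x₀‖) (𝓝 x₀) (𝓝 0) := by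
      have h1 : ContinuousAt (fun x => ‖R x - R x₀‖) x₀ :=
        (hd.continuousAt.sub continuousAt_const).norm
      simpa [ContinuousAt] using h1
    exact this.eventually (ge_mem_nhds hε)
  have hposm : ∀ᶠ x in 𝓝 x₀, 0 < p x - g x := by
    refine (hp'.continuousAt.sub hgd.continuousAt).eventually (lt_mem_nhds ?_)
    simpa [hp0, hg0] using hμ
  have hposp : ∀ᶠ x in 𝓝 x₀, 0 < p x + g x := by
    refine (hp'.continuousAt.add hgd.continuousAt).eventually (lt_mem_nhds ?_)
    simpa [hp0, hg0] using hμ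
  have hupper : ∀ᶠ x in 𝓝 x₀, nthEigenvalue (T x) n ≤ (p x - g x)⁻¹ - K := by
    filter_upwards [hcontR, hposm] with x hx1 hx2
    -- The count is known only for levels strictly below `p x - g x`; let the level increase to it.
    have hlim : Tendsto (fun m : ℝ => m⁻¹ - K) (𝓝[<] (p x - g x)) (𝓝 ((p x - g x)⁻¹ - K)) :=
      ((tendsto_inv₀ hx2.ne').mono_left nhdsWithin_le_nhds).sub_const K
    refine ge_of_tendsto hlim ?_
    filter_upwards [self_mem_nhdsWithin, nhdsWithin_le_nhds (lt_mem_nhds hx2)] with m hm hm0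
    exact (h x).nthEigenvalue_le hn hm0 ((hpert (R x) (hc x) (hR x) hx1).1 m hm0 hm)
  have hlower : ∀ᶠ x in 𝓝 x₀, (p x + g x)⁻¹ - K ≤ nthEigenvalue (T x) n := by
    filter_upwards [hcontR, hposm, hposp] with x hx1 hx2 hx3
    have hm : 0 < (p x - g x) / 2 := by linarith
    exact (h x).le_nthEigenvalue hn hx3
      ⟨hm, (hpert (R x) (hc x) (hR x) hx1).1 _ hm (show _ < p x - g x by linarith)⟩
      (hpert (R x) (hc x) (hR x) hx1).2
  refine ⟨-(μ ^ 2)⁻¹ • p', ?_⟩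
  have hl0 : μ⁻¹ - K = l := by rw [hμdef, inv_inv]; ring
  rw [hasFDerivAt_iff_isLittleO] at hminus hplus ⊢
  simp only [hp0, hg0, sub_zero, add_zero, hl0] at hminus hplus
  rw [Asymptotics.isLittleO_iff] at hminus hplus ⊢
  intro r hr
  -- Squeeze: both enclosing functions take the value `l` at `x₀` and have the same derivative
  -- there.
  filter_upwards [hminus hr, hplus hr, hupper, hlower] with x h1 h2 h3 h4
  rw [Real.norm_eq_abs, abs_le] at h1 h2 ⊢
  exact ⟨by linarith [h2.1], by linarith [h1.2]⟩

/-- A positive definite operator has as many positive eigenvalues as the space has dimensions. -/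
theorem exists_le_rank_specSum {R : H →L[ℂ] H} (hc : IsCompactOperator R) (hR : R.IsSymmetric)
    (hpos : ∀ x, x ≠ 0 → 0 < (inner ℂ (R x) x).re) (hinf : ¬ FiniteDimensional ℂ H) (n : ℕ) :
    ∃ m > 0, (n : Cardinal) ≤ Module.rank ℂ (specSum R (Ici m)) := by
  have hrank : (n : Cardinal) ≤ Module.rank ℂ H := by
    rw [FiniteDimensional, Module.finite_def, ← Module.finite_def, ← Module.rank_lt_aleph0_iff] at hinf
    exact (Cardinal.natCast_lt_aleph0).le.trans (not_lt.1 hinf)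
  obtain ⟨s, hs, hli⟩ := exists_finset_linearIndependent_of_le_rank hrank
  set S := Submodule.span ℂ (s : Set H) with hS
  have hfd : FiniteDimensional ℂ S := FiniteDimensional.span_finset ℂ s
  have hSr : (n : Cardinal) ≤ Module.rank ℂ S := by
    have := rank_span_set hli
    rw [hS, this]
    simp [hs]
  have hcomp : IsCompact (Metric.sphere (0 : S) 1) := isCompact_sphere 0 1
  have hcont : Continuous fun x : S => (inner ℂ (R x) (x : H)).re :=
    Complex.continuous_re.comp ((R.continuous.comp continuous_subtype_val).inner
      continuous_subtype_val)
  -- On a finite-dimensional subspace the positive form attains its minimum over the unit sphere,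
  -- and that minimum is positive. The sphere is empty only when the subspace is zero, where any
  -- constant will do.
  have hbound : ∃ m > 0, ∀ x ∈ S, m * ‖x‖ ^ 2 ≤ (inner ℂ (R x) x).re := by
    rcases (Metric.sphere (0 : S) 1).eq_empty_or_nonempty with hemp | hne
    · refine ⟨1, one_pos, fun x hx => ?_⟩
      by_cases hx0 : x = 0
      · simp [hx0]
      · have hx1 : ‖x‖ ≠ 0 := norm_ne_zero_iff.2 hx0
        have : ((‖x‖⁻¹ : ℝ) : ℂ) • (⟨x, hx⟩ : S) ∈ Metric.sphere (0 : S) 1 := by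
          simp [norm_smul, hx1]
        rw [hemp] at this
        exact this.elim
    · obtain ⟨x₀, hx₀, hmin⟩ := hcomp.exists_isMinOn hne hcont.continuousOn
      have hx₀1 : ‖(x₀ : H)‖ = 1 := by simpa using hx₀
      have hx₀0 : (x₀ : H) ≠ 0 := fun h => by simp [h] at hx₀1
      refine ⟨_, hpos x₀ hx₀0, fun x hx => ?_⟩
      by_cases hx0 : x = 0
      · simp [hx0]
      · have hx1 : ‖x‖ ≠ 0 := norm_ne_zero_iff.2 hx0
        have hy : ((‖x‖⁻¹ : ℝ) : ℂ) • (⟨x, hx⟩ : S) ∈ Metric.sphere (0 : S) 1 := by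
          simp [norm_smul, hx1]
        have h1 := hmin hy
        simp only [mem_ofPred_eq, Submodule.coe_smul, map_smul, inner_smul_left, inner_smul_right,
          Complex.conj_ofReal, Complex.re_ofReal_mul] at h1
        calc _ ≤ (‖x‖⁻¹ * (‖x‖⁻¹ * (inner ℂ (R x) x).re)) * ‖x‖ ^ 2 :=
              mul_le_mul_of_nonneg_right h1 (sq_nonneg _)
          _ = (inner ℂ (R x) x).re := by field_simp
  obtain ⟨m, hm, hb⟩ := hbound
  -- Halving provides the strict inequality that `le_rank_specSum` requires.
  exact ⟨m / 2, by linarith, hSr.trans (le_rank_specSum hc hR hb (by linarith) (by linarith))⟩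

end Resolvent

/-! ### Integration by parts for absolutely continuous complex functions -/

section IntegrationByParts

/-- Increments of the primitive of `w` are dominated by those of the primitive of `‖w‖`, which
reduces the claim to the real-valued case. -/
theorem absolutelyContinuousOnInterval_primitive {w : ℝ → ℂ} {a b : ℝ}
    (h : IntervalIntegrable w volume a b) :
    AbsolutelyContinuousOnInterval (fun x => ∫ t in a..x, w t) a b := by
  have hn := h.norm.absolutelyContinuousOnInterval_intervalIntegral left_mem_uIcc
  rw [absolutelyContinuousOnInterval_iff] at hn ⊢
  intro ε hε
  obtain ⟨δ, hδ, H⟩ := hn ε hε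
  refine ⟨δ, hδ, fun E hE hlt => lt_of_le_of_lt (Finset.sum_le_sum fun i hi => ?_) (H E hE hlt)⟩
  obtain ⟨h1, h2⟩ := hE.1 i hi
  have hsub : ∀ {y}, y ∈ uIcc a b → IntervalIntegrable w volume a y := fun hy =>
    h.mono_set (uIcc_subset_uIcc left_mem_uIcc hy)
  rw [dist_comm, dist_eq_norm, intervalIntegral.integral_interval_sub_left (hsub h2) (hsub h1),
    dist_comm, Real.dist_eq,
    intervalIntegral.integral_interval_sub_left (hsub h2).norm (hsub h1).norm]
  exact intervalIntegral.norm_integral_le_abs_integral_norm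

theorem AbsolutelyContinuousOnInterval.const (z : ℂ) (a b : ℝ) :
    AbsolutelyContinuousOnInterval (fun _ : ℝ => z) a b := by
  rw [absolutelyContinuousOnInterval_iff]
  exact fun ε hε => ⟨1, one_pos, fun E _ _ => by simpa using hε⟩

/-- The product rule, in integrated form. -/
theorem mul_eq_add_integral {L : ℝ} {u u' v v' : ℝ → ℂ}
    (hu' : IntegrableOn u' (Icc 0 L)) (hv' : IntegrableOn v' (Icc 0 L))
    (hu : ∀ x ∈ Icc 0 L, u x = u 0 + ∫ t in (0 : ℝ)..x, u' t)
    (hv : ∀ x ∈ Icc 0 L, v x = v 0 + ∫ t in (0 : ℝ)..x, v' t) {x : ℝ} (hx : x ∈ Icc 0 L) :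
    u x * v x = u 0 * v 0 + ∫ t in (0 : ℝ)..x, (u' t * v t + u t * v' t) := by
  have hL : 0 ≤ L := hx.1.trans hx.2
  have hIu : IntervalIntegrable u' volume 0 L :=
    (intervalIntegrable_iff_integrableOn_Icc_of_le hL).2 hu'
  have hIv : IntervalIntegrable v' volume 0 L :=
    (intervalIntegrable_iff_integrableOn_Icc_of_le hL).2 hv'
  -- `u` and `v` are controlled on `[0, L]` only; `U` and `W` agree with them there and have
  -- two-sided derivatives almost everywhere on it.
  set U : ℝ → ℂ := fun x => u 0 + ∫ t in (0 : ℝ)..x, u' t with hU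
  set W : ℝ → ℂ := fun x => v 0 + ∫ t in (0 : ℝ)..x, v' t with hW
  have hUac : AbsolutelyContinuousOnInterval U 0 L :=
    (AbsolutelyContinuousOnInterval.const (u 0) 0 L).fun_add
      (absolutelyContinuousOnInterval_primitive hIu)
  have hWac : AbsolutelyContinuousOnInterval W 0 L :=
    (AbsolutelyContinuousOnInterval.const (v 0) 0 L).fun_add
      (absolutelyContinuousOnInterval_primitive hIv)
  have hI : IntervalIntegrable (fun t => u' t * W t + U t * v' t) volume 0 L :=
    (hIu.mul_continuousOn hWac.continuousOn).add (hIv.continuousOn_mul hUac.continuousOn)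
  -- `g` is absolutely continuous with derivative zero almost everywhere, hence constant.
  set g : ℝ → ℂ := fun x => U x • W x - ∫ t in (0 : ℝ)..x, (u' t * W t + U t * v' t) with hg
  have hgac : AbsolutelyContinuousOnInterval g 0 L :=
    (hUac.smul hWac).fun_sub (absolutelyContinuousOnInterval_primitive hI)
  obtain ⟨C, hC⟩ := hgac.const_of_ae_hasDerivAt_zero (by
    filter_upwards [hIu.ae_hasDerivAt_integral, hIv.ae_hasDerivAt_integral,
      hI.ae_hasDerivAt_integral] with x h1 h2 h3 hx
    have d1 : HasDerivAt U (u' x) x := (h1 hx 0 left_mem_uIcc).const_add (u 0)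
    have d2 : HasDerivAt W (v' x) x := (h2 hx 0 left_mem_uIcc).const_add (v 0)
    have d3 := (d1.mul d2).sub (h3 hx 0 left_mem_uIcc)
    rw [sub_self] at d3
    exact d3)
  rw [uIcc_of_le hL] at hC
  have h0 := hC 0 (left_mem_Icc.2 hL)
  have hx' := hC x hx
  have e : ∫ t in (0 : ℝ)..x, (u' t * v t + u t * v' t) =
      ∫ t in (0 : ℝ)..x, (u' t * W t + U t * v' t) := by
    refine intervalIntegral.integral_congr fun t ht => ?_
    rw [uIcc_of_le hx.1] at ht
    have ht' : t ∈ Icc 0 L := ⟨ht.1, ht.2.trans hx.2⟩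
    simp only [hU, hW]
    rw [← hu t ht', ← hv t ht']
  rw [e, hu x hx, hv x hx]
  simp only [hg, smul_eq_mul, intervalIntegral.integral_same, sub_zero] at h0 hx'
  have hU0 : U 0 = u 0 := by simp [hU]
  have hW0 : W 0 = v 0 := by simp [hW]
  rw [hU0, hW0] at h0
  show U x * W x = _
  rw [h0, ← hx']
  ring

theorem IsSobolevTwo.conj {L : ℝ} {f f₁ f₂ : ℝ → ℂ} (h : IsSobolevTwo L f f₁ f₂) :
    IsSobolevTwo L (fun x => star (f x)) (fun x => star (f₁ x)) (fun x => star (f₂ x)) := by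
  refine ⟨h.memLp.star, fun x hx => ?_, fun x hx => ?_⟩
  · simp only [h.snd x hx, star_add, Complex.star_def]
    rw [intervalIntegral.integral_of_le hx.1, intervalIntegral.integral_of_le hx.1, integral_conj]
  · simp only [h.fst x hx, star_add, Complex.star_def]
    rw [intervalIntegral.integral_of_le hx.1, intervalIntegral.integral_of_le hx.1, integral_conj]

variable {L : ℝ} {f f₁ f₂ g g₁ g₂ : ℝ → ℂ}

theorem IsSobolevTwo.integrable_fst (h : IsSobolevTwo L f f₁ f₂) : IntegrableOn f₁ (Icc 0 L) :=
  h.continuousOn_snd.integrableOn_compact isCompact_Icc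

/-- Green's first identity on an edge. -/
theorem IsSobolevTwo.green (hL : 0 ≤ L) (hf : IsSobolevTwo L f f₁ f₂) (hg : IsSobolevTwo L g g₁ g₂) :
    ∫ x in Icc 0 L, star (g x) * -f₂ x = (∫ x in Icc 0 L, star (g₁ x) * f₁ x) +
      (star (g 0) * f₁ 0 + star (g L) * -f₁ L) := by
  have h := mul_eq_add_integral (u := fun x => star (g x)) hg.conj.integrable_fst hf.integrable
    hg.conj.fst hf.snd (right_mem_Icc.2 hL)
  rw [intervalIntegral.integral_of_le hL, ← integral_Icc_eq_integral_Ioc, integral_add] at h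
  · simp only [mul_neg]
    rw [integral_neg]
    linear_combination h
  · exact (hg.conj.continuousOn_snd.mul hf.continuousOn_snd).integrableOn_compact isCompact_Icc
  · exact hf.integrable.continuousOn_mul hg.conj.continuousOn isCompact_Icc

/-- The difference is the integral of `(|f|²)' = 2 Re (f̄ f₁)`, estimated by the
arithmetic–geometric mean inequality with weight `ε`. -/
theorem IsSobolevTwo.normSq_le (hf : IsSobolevTwo L f f₁ f₂) {ε : ℝ} (hε : 0 < ε)
    {x y : ℝ} (hx : x ∈ Icc 0 L) (hy : y ∈ Icc 0 L) :
    ‖f y‖ ^ 2 ≤ ‖f x‖ ^ 2 +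
      (ε⁻¹ * (∫ t in Icc 0 L, ‖f t‖ ^ 2) + ε * ∫ t in Icc 0 L, ‖f₁ t‖ ^ 2) := by
  have hL : 0 ≤ L := hx.1.trans hx.2
  set k : ℝ → ℂ := fun t => star (f₁ t) * f t + star (f t) * f₁ t with hk
  have hkc : ContinuousOn k (Icc 0 L) :=
    (hf.conj.continuousOn_snd.mul hf.continuousOn).add (hf.conj.continuousOn.mul hf.continuousOn_snd)
  have hkI : IntegrableOn k (Icc 0 L) := hkc.integrableOn_compact isCompact_Icc
  have h : ∀ z ∈ Icc 0 L, ((‖f z‖ ^ 2 : ℝ) : ℂ) = ((‖f 0‖ ^ 2 : ℝ) : ℂ) + ∫ t in (0 : ℝ)..z, k t := by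
    intro z hz
    have := mul_eq_add_integral (u := fun x => star (f x)) hf.conj.integrable_fst hf.integrable_fst
      hf.conj.fst hf.fst hz
    simpa [hk, Complex.conj_mul'] using this
  have hI : ∀ z ∈ Icc 0 L, IntervalIntegrable k volume 0 z := fun z hz =>
    (intervalIntegrable_iff_integrableOn_Icc_of_le hz.1).2 (hkI.mono_set (Icc_subset_Icc_right hz.2))
  have e : ((‖f y‖ ^ 2 - ‖f x‖ ^ 2 : ℝ) : ℂ) = ∫ t in x..y, k t := by
    rw [← intervalIntegral.integral_interval_sub_left (hI y hy) (hI x hx)]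
    push_cast
    have h1 := h y hy
    have h2 := h x hx
    push_cast at h1 h2
    rw [h1, h2]
    ring
  have i1 : IntegrableOn (fun t => ‖f t‖ ^ 2) (Icc 0 L) :=
    (hf.continuousOn.norm.pow 2).integrableOn_compact isCompact_Icc
  have i2 : IntegrableOn (fun t => ‖f₁ t‖ ^ 2) (Icc 0 L) :=
    (hf.continuousOn_snd.norm.pow 2).integrableOn_compact isCompact_Icc
  have hle : ‖∫ t in x..y, k t‖ ≤ ∫ t in Icc 0 L, (ε⁻¹ * ‖f t‖ ^ 2 + ε * ‖f₁ t‖ ^ 2) := by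
    have hsub : uIoc x y ⊆ Icc 0 L := by
      refine uIoc_subset_uIcc.trans ?_
      rw [← uIcc_of_le hL] at hx hy ⊢
      exact uIcc_subset_uIcc hx hy
    refine intervalIntegral.norm_integral_le_integral_norm_uIoc.trans ?_
    refine (setIntegral_mono_set hkI.norm (Eventually.of_forall fun t => norm_nonneg _)
      hsub.eventuallyLE).trans ?_
    refine setIntegral_mono_on hkI.norm ((i1.const_mul _).add (i2.const_mul _)) measurableSet_Icc
      fun t _ => ?_
    have : ‖k t‖ ≤ 2 * ‖f t‖ * ‖f₁ t‖ := by
      refine (norm_add_le _ _).trans ?_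
      simp only [norm_mul, norm_star]
      linarith
    refine this.trans ?_
    have e : ε⁻¹ * ‖f t‖ ^ 2 + ε * ‖f₁ t‖ ^ 2 - 2 * ‖f t‖ * ‖f₁ t‖ =
        ε⁻¹ * (‖f t‖ - ε * ‖f₁ t‖) ^ 2 := by field_simp; ring
    have : 0 ≤ ε⁻¹ * (‖f t‖ - ε * ‖f₁ t‖) ^ 2 := by positivity
    linarith
  rw [integral_add (i1.const_mul _) (i2.const_mul _), integral_const_mul, integral_const_mul,
    ← e, Complex.norm_real] at hle
  have := (le_abs_self _).trans hle
  linarith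

/-- The trace inequality: point values are controlled by the `H¹` norm, with a small constant in
front of the derivative. -/
theorem IsSobolevTwo.trace_le (hL : 0 < L) (hf : IsSobolevTwo L f f₁ f₂) {ε : ℝ} (hε : 0 < ε)
    {y : ℝ} (hy : y ∈ Icc 0 L) :
    ‖f y‖ ^ 2 ≤ (L⁻¹ + ε⁻¹) * (∫ t in Icc 0 L, ‖f t‖ ^ 2) + ε * ∫ t in Icc 0 L, ‖f₁ t‖ ^ 2 := by
  have i1 : IntegrableOn (fun t => ‖f t‖ ^ 2) (Icc 0 L) :=
    (hf.continuousOn.norm.pow 2).integrableOn_compact isCompact_Icc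
  set B := ε⁻¹ * (∫ t in Icc 0 L, ‖f t‖ ^ 2) + ε * ∫ t in Icc 0 L, ‖f₁ t‖ ^ 2 with hB
  -- Integrate the pointwise comparison over the reference point `x`; dividing by `L` then gives the
  -- term `L⁻¹`.
  have h : ∫ _ in Icc 0 L, (‖f y‖ ^ 2 - B) ≤ ∫ t in Icc 0 L, ‖f t‖ ^ 2 := by
    refine setIntegral_mono_on (integrableOn_const (by simp)) i1 measurableSet_Icc fun x hx => ?_
    have := hf.normSq_le hε hx hy
    linarith
  rw [setIntegral_const, Real.volume_real_Icc_of_le hL.le, sub_zero, smul_eq_mul] at h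
  have h2 := mul_le_mul_of_nonneg_left h (inv_nonneg.2 hL.le)
  rw [← mul_assoc, inv_mul_cancel₀ hL.ne', one_mul] at h2
  rw [add_mul]
  linarith

end IntegrationByParts

/-! ### Piecewise continuous potentials -/

section Potential

/-- Near each point `q` is bounded on either side by the one-sided limits, and at the point by its
own value; compactness makes this uniform. -/
theorem PiecewiseContinuousOn.exists_bound {q : ℝ → ℝ} {a b : ℝ} (h : PiecewiseContinuousOn q a b) :
    ∃ B, ∀ x ∈ Icc a b, |q x| ≤ B := by
  refine isCompact_Icc.induction_on (p := fun s => ∃ B, ∀ x ∈ s, |q x| ≤ B) ⟨0, by simp⟩ ?_ ?_ ?_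
  · rintro s t hst ⟨B, hB⟩
    exact ⟨B, fun x hx => hB x (hst hx)⟩
  · rintro s t ⟨B, hB⟩ ⟨B', hB'⟩
    refine ⟨max B B', fun x hx => ?_⟩
    rcases hx with hx | hx
    · exact (hB x hx).trans (le_max_left _ _)
    · exact (hB' x hx).trans (le_max_right _ _)
  · intro x hx
    have hbd : ∀ {F : Filter ℝ} {l : ℝ}, Tendsto q F (𝓝 l) → ∀ᶠ y in F, |q y| ≤ |l| + 1 := by
      intro F l hl
      exact hl.abs.eventually (ge_mem_nhds (by linarith))
    have hr : ∃ B, ∀ᶠ y in 𝓝[>] x, y ∈ Icc a b → |q y| ≤ B := by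
      rcases hx.2.eq_or_lt with rfl | hlt
      · refine ⟨0, ?_⟩
        filter_upwards [self_mem_nhdsWithin] with y hy hy'
        exact absurd hy'.2 (not_le.2 hy)
      · obtain ⟨l, hl⟩ := h.2.1 x ⟨hx.1, hlt⟩
        exact ⟨_, (hbd hl).mono fun y hy _ => hy⟩
    have hl : ∃ B, ∀ᶠ y in 𝓝[<] x, y ∈ Icc a b → |q y| ≤ B := by
      rcases hx.1.eq_or_lt with rfl | hlt
      · refine ⟨0, ?_⟩
        filter_upwards [self_mem_nhdsWithin] with y hy hy'
        exact absurd hy'.1 (not_le.2 hy)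
      · obtain ⟨l, hl⟩ := h.2.2 x ⟨hlt, hx.2⟩
        exact ⟨_, (hbd hl).mono fun y hy _ => hy⟩
    obtain ⟨B₁, h₁⟩ := hr
    obtain ⟨B₂, h₂⟩ := hl
    refine ⟨{y | |q y| ≤ max (max B₁ B₂) |q x|}, ?_, max (max B₁ B₂) |q x|, fun y hy => hy⟩
    rw [mem_nhdsWithin_iff_eventually]
    rw [eventually_nhdsWithin_iff] at h₁ h₂
    filter_upwards [h₁, h₂] with y hy₁ hy₂ hy
    rcases lt_trichotomy y x with h | rfl | h
    · exact (hy₂ h hy).trans ((le_max_right _ _).trans (le_max_left _ _))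
    · exact le_max_right _ _
    · exact (hy₁ h hy).trans ((le_max_left _ _).trans (le_max_left _ _))

theorem PiecewiseContinuousOn.aestronglyMeasurable {q : ℝ → ℝ} {a b : ℝ}
    (h : PiecewiseContinuousOn q a b) : AEStronglyMeasurable q (volume.restrict (Icc a b)) := by
  obtain ⟨S, hS, hc⟩ := h.1
  have hm : MeasurableSet (Icc a b \ S) := measurableSet_Icc.diff hS.measurableSet
  have e : volume.restrict (Icc a b) = volume.restrict (Icc a b \ S) :=
    Measure.restrict_congr_set (sdiff_null_ae_eq_self (hS.measure_zero _)).symm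
  rw [e]
  exact hc.aestronglyMeasurable hm

/-- Bounded and measurable on `[0, L]`. -/
def IsBoundedPotential (q : ℝ → ℝ) (L : ℝ) : Prop :=
  AEStronglyMeasurable q (volume.restrict (Icc 0 L)) ∧ ∃ B, ∀ x ∈ Icc 0 L, |q x| ≤ B

variable {V E : Type*} [Fintype V] [Fintype E]

theorem isBoundedPotential_treePotential (Γ : QuantumGraph V E) (c : Cut Γ.toMetricGraph)
    (e : TreeEdge c) : IsBoundedPotential (treePotential Γ c e) ((cutTree c).length e) := by
  rcases e with e | ⟨j, _ | _⟩
  · exact ⟨(Γ.q_pc e.1).aestronglyMeasurable, (Γ.q_pc e.1).exists_bound⟩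
  · have hsub : Icc 0 (c.pos j) ⊆ Icc 0 (Γ.length (c.edge j)) :=
      Icc_subset_Icc_right (c.pos_mem j).2.le
    obtain ⟨B, hB⟩ := (Γ.q_pc (c.edge j)).exists_bound
    exact ⟨(Γ.q_pc (c.edge j)).aestronglyMeasurable.mono_measure (Measure.restrict_mono hsub le_rfl),
      B, fun x hx => hB x (hsub hx)⟩
  · obtain ⟨B, hB⟩ := (Γ.q_pc (c.edge j)).exists_bound
    have hpos := c.pos_mem j
    have hsub : ∀ x ∈ Icc 0 (Γ.length (c.edge j) - c.pos j),
        c.pos j + x ∈ Icc 0 (Γ.length (c.edge j)) := fun x hx =>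
      ⟨by linarith [hx.1, hpos.1], by linarith [hx.2]⟩
    refine ⟨?_, B, fun x hx => hB _ (hsub x hx)⟩
    have hmp := measurePreserving_add_left (volume : Measure ℝ) (c.pos j)
    have hemb : MeasurableEmbedding (fun x : ℝ => c.pos j + x) := measurableEmbedding_addLeft _
    have hres := hmp.restrict_preimage_emb hemb (Icc 0 (Γ.length (c.edge j)))
    have := (Γ.q_pc (c.edge j)).aestronglyMeasurable.comp_measurePreserving hres
    exact this.mono_measure (Measure.restrict_mono hsub le_rfl)

end Potential

/-! ### The quadratic form of `H^α` -/

section VertexSum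

open Classical in
/-- The sum over the edge ends at a vertex. -/
def MetricGraph.vertexSum {V E M : Type*} [Fintype E] [AddCommMonoid M] (G : MetricGraph V E)
    (F : E × Bool → M) (v : V) : M :=
  ∑ h : E × Bool, if G.endpoint h.1 h.2 = v then F h else 0

variable {V E M : Type*} [Fintype E] (G : MetricGraph V E)

theorem MetricGraph.sum_vertexSum [Fintype V] [AddCommMonoid M] (F : E × Bool → M) :
    ∑ v, G.vertexSum F v = ∑ h, F h := by
  classical
  simp only [vertexSum]
  rw [Finset.sum_comm]
  refine Finset.sum_congr rfl fun h _ => ?_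
  rw [Finset.sum_eq_single (G.endpoint h.1 h.2)]
  · rw [if_pos rfl]
  · exact fun v _ hv => if_neg hv.symm
  · simp

theorem MetricGraph.le_vertexSum {F : E × Bool → ℝ} (hF : ∀ h, 0 ≤ F h) {v : V} {h : E × Bool}
    (hh : G.endpoint h.1 h.2 = v) : F h ≤ G.vertexSum F v := by
  classical
  have := Finset.single_le_sum (f := fun h : E × Bool => if G.endpoint h.1 h.2 = v then F h else 0)
    (fun h _ => by split_ifs <;> simp [hF]) (Finset.mem_univ h)
  rw [if_pos hh] at this
  refine this.trans (le_of_eq ?_)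
  exact Finset.sum_congr rfl fun h _ => by congr

theorem MetricGraph.vertexSum_eq_zero [AddCommMonoid M] {F : E × Bool → M} {v : V}
    (hv : ∀ h : E × Bool, G.endpoint h.1 h.2 ≠ v) : G.vertexSum F v = 0 :=
  Finset.sum_eq_zero fun h _ => if_neg (hv h)

theorem MetricGraph.vertexSum_mul {F k : E × Bool → ℂ} {v : V} {b : ℂ}
    (hk : ∀ h : E × Bool, G.endpoint h.1 h.2 = v → k h = b) :
    G.vertexSum (fun h => k h * F h) v = b * G.vertexSum F v := by
  rw [vertexSum, vertexSum, Finset.mul_sum]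
  refine Finset.sum_congr rfl fun h _ => ?_
  split_ifs with hh
  · rw [hk h hh]
  · rw [mul_zero]

end VertexSum

/-! ### Boundary terms at the vertices and at the cuts -/

section Boundary

variable {V E : Type*} [Fintype V] [Fintype E] {Γ : QuantumGraph V E} {c : Cut Γ.toMetricGraph}

/-- A new vertex has degree one: `c_j^-` is the terminal end (`true`) of the piece `(j, false)`, and
`c_j^+` the initial end (`false`) of `(j, true)`. Hence the `!b`. -/
theorem vertexSum_inr {M : Type*} [AddCommMonoid M] (F : TreeEdge c × Bool → M)
    (j : Fin Γ.betti) (b : Bool) :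
    (cutTree c).vertexSum F (Sum.inr (j, b)) = F (Sum.inr (j, b), !b) := by
  rw [MetricGraph.vertexSum, Finset.sum_eq_single (Sum.inr (j, b), !b)]
  · rw [if_pos]
    cases b <;> rfl
  · rintro ⟨e | ⟨i, _ | _⟩, _ | _⟩ - hne <;> rw [if_neg] <;>
      simp only [cutTree, reduceCtorEq, not_false_eq_true, Sum.inr.injEq]
    · rintro h
      cases h
      exact hne rfl
    · rintro h
      cases h
      exact hne rfl
  · simp

/-- A sum over all edge ends of the cut tree, sorted by vertices. -/
theorem sum_ends_eq {M : Type*} [AddCommMonoid M] (F : TreeEdge c × Bool → M) :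
    ∑ h, F h = (∑ v : V, (cutTree c).vertexSum F (Sum.inl v)) +
      ∑ j, (F (Sum.inr (j, false), true) + F (Sum.inr (j, true), false)) := by
  rw [← (cutTree c).sum_vertexSum F, Fintype.sum_sum_type]
  congr 1
  rw [Fintype.sum_prod_type]
  refine Finset.sum_congr rfl fun j _ => ?_
  rw [Fintype.sum_bool, vertexSum_inr, vertexSum_inr, add_comm]
  rfl

/-- The boundary form. -/
def boundaryForm (c : Cut Γ.toMetricGraph) (f₁ g : TreeEdge c → ℝ → ℂ) : ℂ :=
  ∑ h : TreeEdge c × Bool, star ((cutTree c).endValue g h.1 h.2) * (cutTree c).endDeriv f₁ h.1 h.2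

/-- The contribution of the vertex `v` to the boundary form. -/
def vertexForm (c : Cut Γ.toMetricGraph) (f₁ g : TreeEdge c → ℝ → ℂ) (v : V) : ℂ :=
  (cutTree c).vertexSum (fun h => star ((cutTree c).endValue g h.1 h.2) *
    (cutTree c).endDeriv f₁ h.1 h.2) (Sum.inl v)

variable {α : Fin Γ.betti → ℝ} {f f₁ g g₁ : TreeEdge c → ℝ → ℂ}

/-- At each cut the contributions of `c_j^-` and `c_j^+` cancel: the phase of `f₁` meets the
conjugate phase of `g`, and the inward derivative changes sign. What is left does not involve `α`.
-/
theorem boundaryForm_eq (hf : VertexConditions Γ c α f f₁) (hg : VertexConditions Γ c α g g₁) :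
    boundaryForm c f₁ g = ∑ v, vertexForm c f₁ g v := by
  rw [boundaryForm, sum_ends_eq]
  simp only [vertexForm, add_eq_left]
  refine Finset.sum_eq_zero fun j _ => ?_
  rw [hg.jump j, hf.jump_deriv j, star_mul', Complex.star_def, ← Complex.exp_conj]
  have : Complex.exp ((starRingEnd ℂ) (Complex.I * α j)) * Complex.exp (Complex.I * α j) = 1 := by
    rw [← Complex.exp_add]
    simp
  linear_combination (-(starRingEnd ℂ) ((cutTree c).endValue g (Sum.inr (j, false)) true) *
    (cutTree c).endDeriv f₁ (Sum.inr (j, false)) true) * this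

/-- The common value of `g` factors out of the sum of derivatives. At a Dirichlet vertex `b = 0`, so
the default `0` for `⊤` is harmless. -/
theorem vertexForm_eq {v : V} {a b : ℂ}
    (hg : ∀ e s, (cutTree c).endpoint e s = Sum.inl v → (cutTree c).endValue g e s = b)
    (hb : Γ.χ v = ⊤ → b = 0)
    (hf : ∀ r : ℝ, Γ.χ v = (r : WithTop ℝ) →
      (cutTree c).vertexSum (fun h => (cutTree c).endDeriv f₁ h.1 h.2) (Sum.inl v) = r * a) :
    vertexForm c f₁ g v = ((Γ.χ v).untopD 0 : ℝ) * (star b * a) := by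
  rw [vertexForm, (cutTree c).vertexSum_mul (b := star b) fun h hh => by rw [hg _ _ hh]]
  cases hχ : Γ.χ v with
  | top => simp [hb hχ]
  | coe r =>
    rw [hf r hχ, WithTop.untopD_coe]
    ring

theorem star_vertexForm (hf : VertexConditions Γ c α f f₁) (hg : VertexConditions Γ c α g g₁)
    (v : V) : star (vertexForm c g₁ f v) = vertexForm c f₁ g v := by
  obtain ⟨a, ha, ha', hfa⟩ := hf.delta v
  obtain ⟨b, hb, hb', hgb⟩ := hg.delta v
  rw [vertexForm_eq hb hb' hfa, vertexForm_eq ha ha' hgb]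
  simp only [star_mul', Complex.star_def, Complex.conj_ofReal, Complex.conj_conj]
  ring

/-- If `v` has an edge end, `|a|²` is one of the terms of the sum on the left; if not, both sides
vanish. -/
theorem neg_le_re_vertexForm (hf : VertexConditions Γ c α f f₁) {X : ℝ} {v : V}
    (hX : |(Γ.χ v).untopD 0| ≤ X) :
    -(X * (cutTree c).vertexSum (fun h => ‖(cutTree c).endValue f h.1 h.2‖ ^ 2) (Sum.inl v)) ≤
      (vertexForm c f₁ f v).re := by
  have hnn : ∀ h : TreeEdge c × Bool, 0 ≤ ‖(cutTree c).endValue f h.1 h.2‖ ^ 2 :=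
    fun h => sq_nonneg _
  have hX0 : 0 ≤ X := (abs_nonneg _).trans hX
  by_cases hv : ∃ h : TreeEdge c × Bool, (cutTree c).endpoint h.1 h.2 = Sum.inl v
  · obtain ⟨h₀, hh₀⟩ := hv
    obtain ⟨a, ha, ha', hfa⟩ := hf.delta v
    have hsum := (cutTree c).le_vertexSum hnn hh₀
    rw [ha _ _ hh₀] at hsum
    rw [vertexForm_eq ha ha' hfa, Complex.re_ofReal_mul, Complex.star_def, Complex.conj_mul',
      ← Complex.ofReal_pow, Complex.ofReal_re]
    have h1 := (abs_le.1 hX).1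
    have h2 := mul_le_mul_of_nonneg_left hsum hX0
    have h3 := mul_le_mul_of_nonneg_right h1 (sq_nonneg ‖a‖)
    linarith
  · push Not at hv
    rw [vertexForm, (cutTree c).vertexSum_eq_zero hv, (cutTree c).vertexSum_eq_zero hv]
    simp

theorem neg_le_re_boundaryForm (hf : VertexConditions Γ c α f f₁) {X : ℝ}
    (hX : ∀ v, |(Γ.χ v).untopD 0| ≤ X) (hX0 : 0 ≤ X) :
    -(X * ∑ h : TreeEdge c × Bool, ‖(cutTree c).endValue f h.1 h.2‖ ^ 2) ≤
      (boundaryForm c f₁ f).re := by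
  rw [boundaryForm_eq hf hf, Complex.re_sum]
  refine le_trans ?_ (Finset.sum_le_sum fun v _ => neg_le_re_vertexForm hf (hX v))
  rw [Finset.sum_neg_distrib, neg_le_neg_iff, ← Finset.mul_sum, sum_ends_eq]
  refine mul_le_mul_of_nonneg_left (le_add_of_nonneg_right ?_) hX0
  exact Finset.sum_nonneg fun j _ => add_nonneg (sq_nonneg _) (sq_nonneg _)

end Boundary

/-! ### The energy form: symmetry and lower bound -/

section Form

variable {V E : Type*} [Fintype V] [Fintype E] {Γ : QuantumGraph V E} {c : Cut Γ.toMetricGraph}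

/-- The energy form on an edge. -/
def edgeForm (L : ℝ) (q : ℝ → ℝ) (f f₁ g g₁ : ℝ → ℂ) : ℂ :=
  (∫ x in Icc 0 L, star (g₁ x) * f₁ x) + ∫ x in Icc 0 L, (q x : ℂ) * (star (g x) * f x)

theorem star_edgeForm (L : ℝ) (q : ℝ → ℝ) (f f₁ g g₁ : ℝ → ℂ) :
    star (edgeForm L q g g₁ f f₁) = edgeForm L q f f₁ g g₁ := by
  simp only [edgeForm, star_add, Complex.star_def, ← integral_conj, map_mul, Complex.conj_conj,
    Complex.conj_ofReal]
  simp only [mul_comm]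

theorem IsBoundedPotential.integrableOn_mul {L : ℝ} {q : ℝ → ℝ} (hq : IsBoundedPotential q L)
    {k : ℝ → ℂ} (hk : IntegrableOn k (Icc 0 L)) :
    IntegrableOn (fun x => (q x : ℂ) * k x) (Icc 0 L) := by
  obtain ⟨hm, B, hB⟩ := hq
  refine Integrable.bdd_mul (c := B) hk (Complex.continuous_ofReal.comp_aestronglyMeasurable hm) ?_
  filter_upwards [ae_restrict_mem measurableSet_Icc] with x hx
  simpa using hB x hx

theorem IsSobolevTwo.integral_green {L : ℝ} {q : ℝ → ℝ} {f f₁ f₂ g g₁ g₂ : ℝ → ℂ} (hL : 0 ≤ L)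
    (hq : IsBoundedPotential q L) (hf : IsSobolevTwo L f f₁ f₂) (hg : IsSobolevTwo L g g₁ g₂) :
    ∫ x in Icc 0 L, star (g x) * (-f₂ x + (q x : ℂ) * f x) = edgeForm L q f f₁ g g₁ +
      (star (g 0) * f₁ 0 + star (g L) * -f₁ L) := by
  have e : ∀ x, star (g x) * (-f₂ x + (q x : ℂ) * f x) =
      star (g x) * -f₂ x + (q x : ℂ) * (star (g x) * f x) := fun x => by ring
  simp only [e]
  rw [integral_add, hf.green hL hg, edgeForm]
  · ring
  · exact hf.integrable.neg.continuousOn_mul hg.conj.continuousOn isCompact_Icc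
  · exact hq.integrableOn_mul
      ((hg.conj.continuousOn.mul hf.continuousOn).integrableOn_compact isCompact_Icc)

variable {α : Fin Γ.betti → ℝ}

/-- Green's identity summed over the edges. No vertex conditions are needed here; they act only
through the boundary form. -/
theorem inner_eq_form {f f₁ f₂ g g₁ g₂ : TreeEdge c → ℝ → ℂ} {u w : GraphL2 (cutTree c)}
    (hf : ∀ e, IsSobolevTwo ((cutTree c).length e) (f e) (f₁ e) (f₂ e))
    (hg : ∀ e, IsSobolevTwo ((cutTree c).length e) (g e) (g₁ e) (g₂ e))
    (hu : ∀ e, u e =ᵐ[volume.restrict (Icc 0 ((cutTree c).length e))] g e)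
    (hw : ∀ e, w e =ᵐ[volume.restrict (Icc 0 ((cutTree c).length e))]
      fun x => -f₂ e x + (treePotential Γ c e x : ℂ) * f e x) :
    inner ℂ u w = (∑ e, edgeForm ((cutTree c).length e) (treePotential Γ c e) (f e) (f₁ e) (g e)
      (g₁ e)) + boundaryForm c f₁ g := by
  have hb : boundaryForm c f₁ g = ∑ e : TreeEdge c, (star (g e 0) * f₁ e 0 +
      star (g e ((cutTree c).length e)) * -f₁ e ((cutTree c).length e)) := by
    rw [boundaryForm, Fintype.sum_prod_type]
    refine Finset.sum_congr rfl fun e _ => ?_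
    rw [Fintype.sum_bool, add_comm]
    rfl
  rw [hb, ← Finset.sum_add_distrib, PiLp.inner_apply]
  refine Finset.sum_congr rfl fun e _ => ?_
  rw [← (hf e).integral_green ((cutTree c).length_pos e).le
    (isBoundedPotential_treePotential Γ c e) (hg e), L2.inner_def]
  refine integral_congr_ae ?_
  filter_upwards [hu e, hw e] with x h1 h2
  rw [h1, h2, RCLike.inner_apply, mul_comm]
  rfl

/-- `H^α` is symmetric. -/
theorem InGraph.inner_comm {u w u' w' : GraphL2 (cutTree c)} (h : InGraph Γ c α u w)
    (h' : InGraph Γ c α u' w') : inner ℂ w u' = inner ℂ u w' := by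
  obtain ⟨f, f₁, f₂, hS, hV, hu, hw⟩ := h
  obtain ⟨g, g₁, g₂, hS', hV', hu', hw'⟩ := h'
  rw [← inner_conj_symm, inner_eq_form hS hS' hu' hw, inner_eq_form hS' hS hu hw',
    ← Complex.star_def, star_add, star_sum, boundaryForm_eq hV hV', boundaryForm_eq hV' hV, star_sum]
  congr 1
  · exact Finset.sum_congr rfl fun e _ => star_edgeForm _ _ _ _ _ _
  · exact Finset.sum_congr rfl fun v _ => star_vertexForm hV' hV v

theorem re_edgeForm_ge {L B : ℝ} {q : ℝ → ℝ} {f f₁ f₂ : ℝ → ℂ}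
    (hq : IsBoundedPotential q L) (hB : ∀ x ∈ Icc 0 L, |q x| ≤ B) (hf : IsSobolevTwo L f f₁ f₂) :
    (∫ x in Icc 0 L, ‖f₁ x‖ ^ 2) - B * (∫ x in Icc 0 L, ‖f x‖ ^ 2) ≤
      (edgeForm L q f f₁ f f₁).re := by
  have i1 : IntegrableOn (fun t => ‖f t‖ ^ 2) (Icc 0 L) :=
    (hf.continuousOn.norm.pow 2).integrableOn_compact isCompact_Icc
  have i2 : IntegrableOn (fun t => q t * ‖f t‖ ^ 2) (Icc 0 L) := by
    refine Integrable.bdd_mul (c := B) i1 hq.1 ?_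
    filter_upwards [ae_restrict_mem measurableSet_Icc] with x hx
    exact hB x hx
  have e1 : ∫ x in Icc 0 L, star (f₁ x) * f₁ x = ((∫ x in Icc 0 L, ‖f₁ x‖ ^ 2 : ℝ) : ℂ) := by
    rw [← integral_complex_ofReal]
    simp [Complex.conj_mul']
  have e2 : ∫ x in Icc 0 L, (q x : ℂ) * (star (f x) * f x) =
      ((∫ x in Icc 0 L, q x * ‖f x‖ ^ 2 : ℝ) : ℂ) := by
    rw [← integral_complex_ofReal]
    simp [Complex.conj_mul']
  rw [edgeForm, e1, e2, Complex.add_re, Complex.ofReal_re, Complex.ofReal_re, sub_eq_add_neg,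
    ← neg_mul, ← integral_const_mul]
  refine add_le_add_right (setIntegral_mono_on (i1.const_mul _) i2 measurableSet_Icc
    fun x hx => ?_) _
  exact mul_le_mul_of_nonneg_right (abs_le.1 (hB x hx)).1 (sq_nonneg _)

/-- `H^α` is bounded from below, uniformly in `α`. -/
theorem exists_lowerBound (Γ : QuantumGraph V E) (c : Cut Γ.toMetricGraph) :
    ∃ K : ℝ, 0 ≤ K ∧ ∀ (α : Fin Γ.betti → ℝ) (u w : GraphL2 (cutTree c)), InGraph Γ c α u w →
      -(K * ‖u‖ ^ 2) ≤ (inner ℂ u w).re := by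
  have hq := isBoundedPotential_treePotential Γ c
  choose B hB using fun e => (hq e).2
  have hB0 : ∀ e, 0 ≤ B e := fun e =>
    (abs_nonneg _).trans (hB e 0 (left_mem_Icc.2 ((cutTree c).length_pos e).le))
  set X : ℝ := ∑ v, |(Γ.χ v).untopD 0| with hXdef
  have hX0 : 0 ≤ X := Finset.sum_nonneg fun v _ => abs_nonneg _
  have hX : ∀ v, |(Γ.χ v).untopD 0| ≤ X := fun v =>
    Finset.single_le_sum (f := fun v => |(Γ.χ v).untopD 0|) (fun v _ => abs_nonneg _)
      (Finset.mem_univ v)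
  -- Each edge has two ends, so the trace terms cost `2Xε` times the kinetic energy. This `ε` makes
  -- that at most `1`, and the summand `1` covers `X = 0`.
  set ε : ℝ := (2 * X + 1)⁻¹ with hεdef
  have hε : 0 < ε := by positivity
  set k : TreeEdge c → ℝ := fun e => B e + 2 * X * (((cutTree c).length e)⁻¹ + ε⁻¹) with hk
  have hk0 : ∀ e, 0 ≤ k e := fun e => by
    have := hB0 e
    have := (cutTree c).length_pos e
    positivity
  refine ⟨∑ e, k e, Finset.sum_nonneg fun e _ => hk0 e, fun α u w h => ?_⟩
  obtain ⟨f, f₁, f₂, hS, hV, hu, hw⟩ := h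
  set N : TreeEdge c → ℝ := fun e => ∫ x in Icc 0 ((cutTree c).length e), ‖f e x‖ ^ 2 with hN
  set D : TreeEdge c → ℝ := fun e => ∫ x in Icc 0 ((cutTree c).length e), ‖f₁ e x‖ ^ 2 with hD
  have hN0 : ∀ e, 0 ≤ N e := fun e => integral_nonneg fun x => sq_nonneg _
  have hD0 : ∀ e, 0 ≤ D e := fun e => integral_nonneg fun x => sq_nonneg _
  have hnorm : ‖u‖ ^ 2 = ∑ e, N e := by
    rw [PiLp.norm_sq_eq_of_L2]
    refine Finset.sum_congr rfl fun e _ => ?_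
    have h1 : ‖u e‖ ^ 2 = (inner ℂ (u e) (u e)).re := by
      rw [inner_self_eq_norm_sq_to_K]
      norm_cast
    rw [h1, L2.inner_def]
    have h2 : ∫ x in Icc 0 ((cutTree c).length e), inner ℂ (u e x) (u e x) = ((N e : ℝ) : ℂ) := by
      rw [hN, ← integral_complex_ofReal]
      refine integral_congr_ae ?_
      filter_upwards [hu e] with x hx
      rw [hx, inner_self_eq_norm_sq_to_K]
      push_cast
      rfl
    rw [h2, Complex.ofReal_re]
  have hbd := neg_le_re_boundaryForm hV hX hX0
  have hends : ∑ h : TreeEdge c × Bool, ‖(cutTree c).endValue f h.1 h.2‖ ^ 2 ≤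
      ∑ e, 2 * ((((cutTree c).length e)⁻¹ + ε⁻¹) * N e + ε * D e) := by
    rw [Fintype.sum_prod_type]
    refine Finset.sum_le_sum fun e _ => ?_
    have hL := (cutTree c).length_pos e
    have h0 := (hS e).trace_le hL hε (left_mem_Icc.2 hL.le)
    have h1 := (hS e).trace_le hL hε (right_mem_Icc.2 hL.le)
    rw [Fintype.sum_bool]
    simp only [MetricGraph.endValue]
    linarith
  have hedge : ∑ e, (D e - B e * N e) ≤ (∑ e, edgeForm ((cutTree c).length e)
      (treePotential Γ c e) (f e) (f₁ e) (f e) (f₁ e)).re := by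
    rw [Complex.re_sum]
    exact Finset.sum_le_sum fun e _ => re_edgeForm_ge (hq e) (hB e) (hS e)
  rw [inner_eq_form hS hS hu hw, Complex.add_re, hnorm]
  have hX2 : 2 * X * ε ≤ 1 := by
    rw [hεdef, ← div_eq_mul_inv, div_le_one (by positivity)]
    linarith
  have hfin : -((∑ e, k e) * ∑ e, N e) ≤ (∑ e, (D e - B e * N e)) -
      X * ∑ e, 2 * ((((cutTree c).length e)⁻¹ + ε⁻¹) * N e + ε * D e) := by
    rw [Finset.mul_sum, Finset.mul_sum, ← Finset.sum_sub_distrib, ← Finset.sum_neg_distrib]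
    refine Finset.sum_le_sum fun e _ => ?_
    have h1 : k e ≤ ∑ e, k e := Finset.single_le_sum (fun e _ => hk0 e) (Finset.mem_univ e)
    have h2 := mul_le_mul_of_nonneg_right h1 (hN0 e)
    have h3 := mul_le_mul_of_nonneg_right hX2 (hD0 e)
    simp only [hk] at h2 ⊢
    linarith
  have := mul_le_mul_of_nonneg_left hends hX0
  linarith

end Form

/-! ### Operators on an edge -/

section Edge

variable {L : ℝ}

theorem integrableOn_edge (w : EdgeL2 L) : IntegrableOn w (Icc 0 L) :=
  (Lp.memLp w).integrable (by norm_num)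

theorem intervalIntegrable_edge (w : EdgeL2 L) {x y : ℝ} (hx : x ∈ Icc 0 L) (hy : y ∈ Icc 0 L) :
    IntervalIntegrable w volume x y := by
  refine (intervalIntegrable_iff.2 ((integrableOn_edge w).mono_set ?_))
  refine uIoc_subset_uIcc.trans ?_
  have hL := hx.1.trans hx.2
  rw [← uIcc_of_le hL] at hx hy ⊢
  exact uIcc_subset_uIcc hx hy

/-- Cauchy–Schwarz against the indicator function of `(x, y]`. -/
theorem norm_integral_edge_le (w : EdgeL2 L) {x y : ℝ} (hx : x ∈ Icc 0 L) (hy : y ∈ Icc 0 L)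
    (hxy : x ≤ y) : ‖∫ t in x..y, w t‖ ≤ √(y - x) * ‖w‖ := by
  have hsub : Ioc x y ⊆ Icc 0 L := fun t ht => ⟨hx.1.trans ht.1.le, ht.2.trans hy.2⟩
  have hμ : (volume.restrict (Icc 0 L)) (Ioc x y) = ENNReal.ofReal (y - x) := by
    rw [Measure.restrict_apply measurableSet_Ioc, inter_eq_self_of_subset_left hsub, Real.volume_Ioc]
  have hμ' : (volume.restrict (Icc 0 L)) (Ioc x y) ≠ ⊤ := by rw [hμ]; exact ENNReal.ofReal_ne_top
  have e : ∫ t in x..y, w t =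
      inner ℂ (indicatorConstLp 2 measurableSet_Ioc hμ' (1 : ℂ)) w := by
    rw [L2.inner_indicatorConstLp_one, intervalIntegral.integral_of_le hxy,
      Measure.restrict_restrict measurableSet_Ioc, inter_eq_self_of_subset_left hsub]
  rw [e]
  refine (norm_inner_le_norm _ _).trans (mul_le_mul_of_nonneg_right ?_ (norm_nonneg _))
  rw [norm_indicatorConstLp (by norm_num) (by norm_num), Measure.real, hμ,
    ENNReal.toReal_ofReal (by linarith), norm_one, one_mul, Real.sqrt_eq_rpow]
  norm_num

theorem norm_integral_sub_edge_le (w : EdgeL2 L) {x y : ℝ} (hx : x ∈ Icc 0 L) (hy : y ∈ Icc 0 L) :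
    ‖(∫ t in (0 : ℝ)..y, w t) - ∫ t in (0 : ℝ)..x, w t‖ ≤ √|y - x| * ‖w‖ := by
  have h0 : (0 : ℝ) ∈ Icc 0 L := left_mem_Icc.2 (hx.1.trans hx.2)
  rw [intervalIntegral.integral_interval_sub_left (intervalIntegrable_edge w h0 hy)
    (intervalIntegrable_edge w h0 hx)]
  rcases le_total x y with h | h
  · rw [abs_of_nonneg (by linarith)]
    exact norm_integral_edge_le w hx hy h
  · rw [abs_of_nonpos (by linarith), neg_sub, intervalIntegral.integral_symm, norm_neg]
    exact norm_integral_edge_le w hy hx h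

/-- The primitive that vanishes at `0`, as a continuous function. -/
def primitiveFun (w : EdgeL2 L) : C(Icc (0 : ℝ) L, ℂ) where
  toFun x := ∫ t in (0 : ℝ)..x, w t
  continuous_toFun := by
    rw [continuous_iff_continuousAt]
    intro x
    have : Tendsto (fun y : Icc (0 : ℝ) L => √|(y : ℝ) - x| * ‖w‖) (𝓝 x) (𝓝 0) := by
      have hc : Continuous fun y : Icc (0 : ℝ) L => √|(y : ℝ) - x| * ‖w‖ := by fun_prop
      simpa using hc.tendsto x
    rw [ContinuousAt, tendsto_iff_norm_sub_tendsto_zero]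
    exact squeeze_zero (fun _ => norm_nonneg _)
      (fun y => norm_integral_sub_edge_le w x.2 y.2) this

theorem primitiveFun_apply (w : EdgeL2 L) (x : Icc (0 : ℝ) L) :
    primitiveFun w x = ∫ t in (0 : ℝ)..x, w t := rfl

theorem norm_primitiveFun_le (w : EdgeL2 L) : ‖primitiveFun w‖ ≤ √|L| * ‖w‖ := by
  refine (ContinuousMap.norm_le _ (by positivity)).2 fun x => ?_
  have h := norm_integral_sub_edge_le w (left_mem_Icc.2 (x.2.1.trans x.2.2)) x.2
  rw [intervalIntegral.integral_same, sub_zero, sub_zero] at h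
  refine h.trans (mul_le_mul_of_nonneg_right (Real.sqrt_le_sqrt ?_) (norm_nonneg _))
  rw [abs_of_nonneg x.2.1]
  exact x.2.2.trans (le_abs_self _)

variable (L) in
/-- The Volterra operator `w ↦ ∫₀ˣ w`. -/
def primitive : EdgeL2 L →L[ℂ] C(Icc (0 : ℝ) L, ℂ) :=
  LinearMap.mkContinuous
    { toFun := primitiveFun
      map_add' := fun w w' => by
        ext x
        have h0 : (0 : ℝ) ∈ Icc 0 L := left_mem_Icc.2 (x.2.1.trans x.2.2)
        simp only [primitiveFun_apply, ContinuousMap.add_apply]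
        rw [← intervalIntegral.integral_add (intervalIntegrable_edge w h0 x.2)
          (intervalIntegrable_edge w' h0 x.2), intervalIntegral.integral_of_le x.2.1,
          intervalIntegral.integral_of_le x.2.1]
        refine setIntegral_congr_ae₀ measurableSet_Ioc.nullMeasurableSet ?_
        have := (ae_restrict_iff' measurableSet_Icc).1 (Lp.coeFn_add w w')
        filter_upwards [this] with t ht ht'
        exact ht ⟨ht'.1.le, ht'.2.trans x.2.2⟩
      map_smul' := fun z w => by
        ext x
        simp only [primitiveFun_apply, ContinuousMap.smul_apply, RingHom.id_apply]
        rw [← intervalIntegral.integral_smul, intervalIntegral.integral_of_le x.2.1,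
          intervalIntegral.integral_of_le x.2.1]
        refine setIntegral_congr_ae₀ measurableSet_Ioc.nullMeasurableSet ?_
        have := (ae_restrict_iff' measurableSet_Icc).1 (Lp.coeFn_smul z w)
        filter_upwards [this] with t ht ht'
        exact ht ⟨ht'.1.le, ht'.2.trans x.2.2⟩ }
    (√|L|) norm_primitiveFun_le

theorem primitive_apply (w : EdgeL2 L) (x : Icc (0 : ℝ) L) :
    primitive L w x = ∫ t in (0 : ℝ)..x, w t := rfl

/-- Primitives of functions in the unit ball of `L²` are uniformly bounded and uniformly Hölder of
exponent `1/2`, so Arzelà–Ascoli applies. -/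
theorem isCompactOperator_primitive : IsCompactOperator (primitive L) := by
  let Φ := ContinuousMap.linearIsometryBoundedOfCompact (Icc (0 : ℝ) L) ℂ ℂ
  let T : EdgeL2 L →L[ℂ] BoundedContinuousFunction (Icc (0 : ℝ) L) ℂ :=
    (Φ.toContinuousLinearEquiv : C(Icc (0 : ℝ) L, ℂ) →L[ℂ] _).comp (primitive L)
  have hT : IsCompactOperator T := by
    refine (isCompactOperator_iff_isCompact_closure_image_closedBall
      (T : EdgeL2 L →ₗ[ℂ] BoundedContinuousFunction (Icc (0 : ℝ) L) ℂ) one_pos).2 ?_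
    refine BoundedContinuousFunction.arzela_ascoli (Metric.closedBall (0 : ℂ) √|L|)
      (isCompact_closedBall _ _) _ ?_ ?_
    · rintro _ x ⟨w, hw, rfl⟩
      rw [mem_closedBall_zero_iff] at hw ⊢
      have h1 : ‖primitive L w x‖ ≤ ‖primitive L w‖ := ContinuousMap.norm_coe_le_norm _ x
      refine h1.trans ((norm_primitiveFun_le w).trans ?_)
      exact mul_le_of_le_one_right (Real.sqrt_nonneg _) hw
    · refine Metric.equicontinuous_of_continuity_modulus (fun d => √d) ?_ _ ?_
      · simpa using Real.continuous_sqrt.tendsto 0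
      · rintro x y ⟨_, w, hw, rfl⟩
        rw [mem_closedBall_zero_iff] at hw
        rw [dist_comm, dist_comm x y, dist_eq_norm, Subtype.dist_eq, Real.dist_eq]
        exact (norm_integral_sub_edge_le w x.2 y.2).trans
          (mul_le_of_le_one_right (Real.sqrt_nonneg _) hw)
  exact hT.clm_comp (Φ.symm.toContinuousLinearEquiv :
    BoundedContinuousFunction (Icc (0 : ℝ) L) ℂ →L[ℂ] C(Icc (0 : ℝ) L, ℂ))

theorem memLp_IccExtend (hL : 0 ≤ L) (g : C(Icc (0 : ℝ) L, ℂ)) :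
    MemLp (IccExtend hL g) 2 (volume.restrict (Icc 0 L)) := by
  refine MemLp.of_bound (g.continuous.Icc_extend' (h := hL)).aestronglyMeasurable ‖g‖ ?_
  exact Eventually.of_forall fun x => g.norm_coe_le_norm _

/-- The inclusion of `C([0, L])` in `L²`. -/
def toEdgeL2 (hL : 0 ≤ L) : C(Icc (0 : ℝ) L, ℂ) →L[ℂ] EdgeL2 L :=
  LinearMap.mkContinuous
    { toFun := fun g => (memLp_IccExtend hL g).toLp
      map_add' := fun g g' => by
        rw [← MemLp.toLp_add]
        rfl
      map_smul' := fun z g => by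
        rw [RingHom.id_apply, ← MemLp.toLp_const_smul]
        rfl }
    (measureUnivNNReal (volume.restrict (Icc (0 : ℝ) L)) ^ (2 : ENNReal).toReal⁻¹) fun g => by
      refine Lp.norm_le_of_ae_bound (norm_nonneg g) ?_
      filter_upwards [(memLp_IccExtend hL g).coeFn_toLp] with x hx
      refine le_of_eq_of_le (congrArg norm hx) ?_
      exact g.norm_coe_le_norm _

theorem toEdgeL2_ae (hL : 0 ≤ L) (g : C(Icc (0 : ℝ) L, ℂ)) :
    toEdgeL2 hL g =ᵐ[volume.restrict (Icc 0 L)] IccExtend hL g :=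
  (memLp_IccExtend hL g).coeFn_toLp

theorem toEdgeL2_injective (hL : 0 < L) : Function.Injective (toEdgeL2 hL.le) := by
  rw [injective_iff_map_eq_zero]
  intro g hg
  have h1 : IccExtend hL.le g =ᵐ[volume.restrict (Icc 0 L)] fun _ => (0 : ℂ) := by
    refine (toEdgeL2_ae hL.le g).symm.trans ?_
    rw [hg]
    exact Lp.coeFn_zero _ _ _
  have h2 : EqOn (IccExtend hL.le g) (fun _ => 0) (Icc 0 L) :=
    Measure.eqOn_Icc_of_ae_eq volume hL.ne h1
      (g.continuous.Icc_extend' (h := hL.le)).continuousOn continuousOn_const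
  ext x
  have := h2 x.2
  rwa [IccExtend_of_mem _ _ x.2] at this

variable {q : ℝ → ℝ}

theorem IsBoundedPotential.memLp_mul (hq : IsBoundedPotential q L) (w : EdgeL2 L) :
    MemLp (fun x => (q x : ℂ) * w x) 2 (volume.restrict (Icc 0 L)) := by
  obtain ⟨hm, B, hB⟩ := hq
  refine (Lp.memLp w).of_le_mul (c := B)
    ((Complex.continuous_ofReal.comp_aestronglyMeasurable hm).mul (Lp.aestronglyMeasurable w)) ?_
  filter_upwards [ae_restrict_mem measurableSet_Icc] with x hx
  rw [norm_mul, Complex.norm_real]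
  exact mul_le_mul_of_nonneg_right (hB x hx) (norm_nonneg _)

/-- Multiplication by a bounded potential. -/
def mulPotential (hq : IsBoundedPotential q L) : EdgeL2 L →L[ℂ] EdgeL2 L :=
  LinearMap.mkContinuousOfExistsBound
    { toFun := fun w => (hq.memLp_mul w).toLp
      map_add' := fun w w' => by
        rw [← MemLp.toLp_add]
        refine MemLp.toLp_congr _ _ ?_
        filter_upwards [Lp.coeFn_add w w'] with x hx
        rw [hx]
        simp [mul_add]
      map_smul' := fun z w => by
        rw [RingHom.id_apply, ← MemLp.toLp_const_smul]
        refine MemLp.toLp_congr _ _ ?_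
        filter_upwards [Lp.coeFn_smul z w] with x hx
        rw [hx]
        simp [mul_left_comm] }
    (by
      obtain ⟨B, hB⟩ := hq.2
      refine ⟨B, fun w => Lp.norm_le_mul_norm_of_ae_le_mul ?_⟩
      filter_upwards [(hq.memLp_mul w).coeFn_toLp, ae_restrict_mem measurableSet_Icc] with x hx hm
      refine le_of_eq_of_le (congrArg norm hx) ?_
      rw [norm_mul, Complex.norm_real]
      exact mul_le_mul_of_nonneg_right (hB x hm) (norm_nonneg _))

theorem mulPotential_ae (hq : IsBoundedPotential q L) (w : EdgeL2 L) :
    mulPotential hq w =ᵐ[volume.restrict (Icc 0 L)] fun x => (q x : ℂ) * w x :=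
  (hq.memLp_mul w).coeFn_toLp

/-- The indicators of the disjoint intervals `(L/(k+2), L/(k+1)]` are nonzero and pairwise
orthogonal. -/
theorem not_finiteDimensional_edgeL2 (hL : 0 < L) : ¬ FiniteDimensional ℂ (EdgeL2 L) := by
  intro hfd
  let s : ℕ → Set ℝ := fun k => Ioc (L / (k + 2)) (L / (k + 1))
  have hs : ∀ k, MeasurableSet (s k) := fun k => measurableSet_Ioc
  have hsub : ∀ k, s k ⊆ Icc 0 L := fun k x hx => by
    refine ⟨le_trans (by positivity) hx.1.le, hx.2.trans ?_⟩
    exact div_le_self hL.le (by linarith [k.cast_nonneg (α := ℝ)])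
  have hfin : ∀ k, (volume.restrict (Icc 0 L)) (s k) ≠ ⊤ := fun k => measure_ne_top _ _
  have hdisj : ∀ i j, i < j → Disjoint (s i) (s j) := fun i j hij => by
    refine Set.disjoint_left.2 fun x hx hx' => ?_
    have h1 : L / (i + 2) < x := hx.1
    have h2 : x ≤ L / (j + 1) := hx'.2
    have h3 : L / ((j : ℝ) + 1) ≤ L / (i + 2) := by
      refine div_le_div_of_nonneg_left hL.le (by positivity) ?_
      have : (i : ℝ) + 1 ≤ j := by exact_mod_cast hij
      linarith
    linarith
  let v : ℕ → EdgeL2 L := fun k => indicatorConstLp 2 (hs k) (hfin k) (1 : ℂ)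
  have hinner : ∀ i j, inner ℂ (v i) (v j) = ((volume.restrict (Icc 0 L)).real (s i ∩ s j) : ℂ) := by
    intro i j
    have := L2.inner_indicatorConstLp_indicatorConstLp (𝕜 := ℂ) (hs i) (hs j) (hfin i) (hfin j)
      (1 : ℂ) (1 : ℂ)
    simpa using this
  have hli : LinearIndependent ℂ v := by
    refine linearIndependent_of_ne_zero_of_inner_eq_zero (fun k hk => ?_) fun i j hij => ?_
    · have h0 := hinner k k
      rw [hk, inner_zero_left, inter_self, Measure.real, Measure.restrict_apply (hs k),
        inter_eq_self_of_subset_left (hsub k), Real.volume_Ioc] at h0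
      have hlt : L / ((k : ℝ) + 2) < L / (k + 1) :=
        div_lt_div_of_pos_left hL (by positivity) (by linarith)
      rw [ENNReal.toReal_ofReal (by linarith)] at h0
      have h0' : L / ((k : ℝ) + 1) - L / (k + 2) = 0 := by exact_mod_cast h0.symm
      linarith
    · show inner ℂ (v i) (v j) = 0
      rw [hinner]
      rcases lt_or_gt_of_ne hij with h | h
      · simp [(hdisj i j h).inter_eq]
      · simp [(hdisj j i h).symm.inter_eq]
  exact not_finite_iff_infinite.2 inferInstance hli.finite

end Edge

/-! ### The resolvent of `H^α`

A function in `H²` of every edge is `a + b x - ∫₀ˣ∫₀ᵗ w` with `w = -f''`. In terms of `w` and the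
Cauchy data `(a, b)`, the equation `(H^α + K) f = g` becomes a linear system `A (w, (a, b)) = (g, 0)`
where `A` is a compact perturbation of the identity. -/

section Resolvent

variable {V E : Type*} [Fintype V] [Fintype E] (Γ : QuantumGraph V E) (c : Cut Γ.toMetricGraph)

/-- Second derivatives and Cauchy data at the starting points of the edges. -/
abbrev CauchyData : Type _ := GraphL2 (cutTree c) × (TreeEdge c × Bool → ℂ)

variable {Γ} {c}

theorem treeLength_nonneg (e : TreeEdge c) : 0 ≤ (cutTree c).length e :=
  ((cutTree c).length_pos e).le

/-- A coordinate of the Cauchy data. -/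
def dataCoord (h : TreeEdge c × Bool) : CauchyData Γ c →L[ℂ] ℂ :=
  (ContinuousLinearMap.proj h).comp (ContinuousLinearMap.snd ℂ _ _)

/-- The source `w = -f''` on the edge `e`. Among the scalar data, `(e, false)` is the value and `(e,
true)` the derivative of `f`, both at the start of `e`. -/
def dataSource (e : TreeEdge c) : CauchyData Γ c →L[ℂ] EdgeL2 ((cutTree c).length e) :=
  (PiLp.proj 2 _ e).comp (ContinuousLinearMap.fst ℂ _ _)

/-- The derivative of the function with given Cauchy data. -/
def dataDeriv (e : TreeEdge c) : CauchyData Γ c →L[ℂ] C(Icc (0 : ℝ) ((cutTree c).length e), ℂ) :=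
  (dataCoord (e, true)).smulRight 1 - (primitive _).comp (dataSource e)

/-- The coordinate function on an edge. -/
def coordFun (L : ℝ) : C(Icc (0 : ℝ) L, ℂ) := ⟨fun x => ((x : ℝ) : ℂ), by fun_prop⟩

/-- The function with given Cauchy data. -/
def dataFun (e : TreeEdge c) : CauchyData Γ c →L[ℂ] C(Icc (0 : ℝ) ((cutTree c).length e), ℂ) :=
  (dataCoord (e, false)).smulRight 1 + (dataCoord (e, true)).smulRight (coordFun _) -
    (primitive _).comp ((toEdgeL2 (treeLength_nonneg e)).comp ((primitive _).comp (dataSource e)))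

theorem isCompactOperator_smulRight {X Y : Type*} [NormedAddCommGroup X] [NormedSpace ℂ X]
    [NormedAddCommGroup Y] [NormedSpace ℂ Y] (φ : X →L[ℂ] ℂ) (y : Y) :
    IsCompactOperator (φ.smulRight y) :=
  (isCompactOperator_of_locallyCompactSpace_dom φ).clm_comp
    (ContinuousLinearMap.toSpanSingleton ℂ y)

theorem isCompactOperator_dataFun (e : TreeEdge c) :
    IsCompactOperator (dataFun (Γ := Γ) e) :=
  ((isCompactOperator_smulRight _ _).add (isCompactOperator_smulRight _ _)).sub
    (isCompactOperator_primitive.comp_clm _)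

open Classical in
/-- The inclusion of `L²` of an edge in `L²` of the graph. -/
def edgeInclusion (e : TreeEdge c) : EdgeL2 ((cutTree c).length e) →L[ℂ] GraphL2 (cutTree c) :=
  ((PiLp.continuousLinearEquiv 2 ℂ fun e : TreeEdge c => EdgeL2 ((cutTree c).length e)).symm :
    (∀ e : TreeEdge c, EdgeL2 ((cutTree c).length e)) →L[ℂ] GraphL2 (cutTree c)).comp
    (ContinuousLinearMap.single ℂ (fun e : TreeEdge c => EdgeL2 ((cutTree c).length e)) e)

open Classical in
theorem edgeInclusion_apply (e : TreeEdge c) (y : EdgeL2 ((cutTree c).length e)) :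
    edgeInclusion e y = WithLp.toLp 2
      (Pi.single e y : ∀ e : TreeEdge c, EdgeL2 ((cutTree c).length e)) := rfl

theorem sum_edgeInclusion_apply (y : ∀ e : TreeEdge c, EdgeL2 ((cutTree c).length e))
    (e : TreeEdge c) : (∑ e', edgeInclusion e' (y e') : GraphL2 (cutTree c)) e = y e := by
  classical
  simp only [edgeInclusion_apply]
  rw [← WithLp.toLp_sum, Finset.univ_sum_single]

/-- The function with given Cauchy data, in `L²`. -/
def dataL2 : CauchyData Γ c →L[ℂ] GraphL2 (cutTree c) :=
  ∑ e, (edgeInclusion e).comp ((toEdgeL2 (treeLength_nonneg e)).comp (dataFun e))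

theorem dataL2_apply (x : CauchyData Γ c) (e : TreeEdge c) :
    dataL2 x e = toEdgeL2 (treeLength_nonneg e) (dataFun e x) := by
  rw [dataL2, sum_apply]
  exact sum_edgeInclusion_apply (fun e => toEdgeL2 (treeLength_nonneg e) (dataFun e x)) e

theorem isCompactOperator_sum {ι X Y : Type*} [NormedAddCommGroup X] [NormedSpace ℂ X]
    [NormedAddCommGroup Y] [NormedSpace ℂ Y] (s : Finset ι) {T : ι → X →L[ℂ] Y}
    (hT : ∀ i ∈ s, IsCompactOperator (T i)) : IsCompactOperator (∑ i ∈ s, T i : X →L[ℂ] Y) :=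
  Submodule.sum_mem (compactOperator (RingHom.id ℂ) X Y) hT

theorem isCompactOperator_dataL2 : IsCompactOperator (dataL2 (Γ := Γ) (c := c)) :=
  isCompactOperator_sum _ fun e _ =>
    ((isCompactOperator_dataFun e).clm_comp (toEdgeL2 (treeLength_nonneg e))).clm_comp
      (edgeInclusion e)

variable (Γ c) in
/-- Multiplication by the potential. -/
def graphPotential : GraphL2 (cutTree c) →L[ℂ] GraphL2 (cutTree c) :=
  ∑ e, (edgeInclusion e).comp
    ((mulPotential (isBoundedPotential_treePotential Γ c e)).comp (PiLp.proj 2 _ e))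

theorem graphPotential_apply (u : GraphL2 (cutTree c)) (e : TreeEdge c) :
    graphPotential Γ c u e = mulPotential (isBoundedPotential_treePotential Γ c e) (u e) := by
  rw [graphPotential, sum_apply]
  exact sum_edgeInclusion_apply
    (fun e => mulPotential (isBoundedPotential_treePotential Γ c e) (u e)) e

/-- The value at an edge end. -/
def dataEndValue (h : TreeEdge c × Bool) : CauchyData Γ c →L[ℂ] ℂ :=
  (ContinuousMap.evalCLM ℂ (if h.2 then (⟨_, right_mem_Icc.2 (treeLength_nonneg h.1)⟩ : Icc _ _)
    else ⟨0, left_mem_Icc.2 (treeLength_nonneg h.1)⟩)).comp (dataFun h.1)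

/-- The derivative into the edge at an edge end. -/
def dataEndDeriv (h : TreeEdge c × Bool) : CauchyData Γ c →L[ℂ] ℂ :=
  if h.2 then -(ContinuousMap.evalCLM ℂ
    (⟨_, right_mem_Icc.2 (treeLength_nonneg h.1)⟩ : Icc _ _)).comp (dataDeriv h.1)
  else (ContinuousMap.evalCLM ℂ
    (⟨0, left_mem_Icc.2 (treeLength_nonneg h.1)⟩ : Icc _ _)).comp (dataDeriv h.1)

/-- The part of the vertex conditions that is independent of `α`, one condition for each edge end. -/
def conditionConst (h : TreeEdge c × Bool) : CauchyData Γ c →L[ℂ] ℂ :=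
  match (cutTree c).endpoint h.1 h.2 with
  | Sum.inl v =>
    match Γ.χ v with
    | ⊤ => dataEndValue h
    | (r : ℝ) =>
      -- `h₀` is a reference end at `v`. There is one equation per end and none to spare for the
      -- derivative condition, so that condition is added to each continuity equation. The row of
      -- `h₀` then reduces to the derivative condition, and subtracting it from the other rows gives
      -- continuity.
      let h₀ := @Classical.epsilon _ ⟨h⟩ fun h' : TreeEdge c × Bool =>
        (cutTree c).endpoint h'.1 h'.2 = Sum.inl v
      dataEndValue h - dataEndValue h₀ + ((cutTree c).vertexSum dataEndDeriv (Sum.inl v) -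
        (r : ℂ) • dataEndValue h₀)
  -- The row of `c_j^-` carries the jump of the value and that of `c_j^+` the jump of the
  -- derivative; here stand the terms without phase.
  | Sum.inr (j, false) => dataEndValue (Sum.inr (j, true), false)
  | Sum.inr (j, true) => dataEndDeriv (Sum.inr (j, true), false)

/-- The coefficient of `e^{iα_j}` in the vertex conditions. -/
def conditionPhase (j : Fin Γ.betti) (b : Bool) : CauchyData Γ c →L[ℂ] ℂ :=
  if b then dataEndDeriv (Sum.inr (j, false), true)
  else -dataEndValue (Sum.inr (j, false), true)

open Classical in
/-- The compact operator `A - 1`. -/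
def systemConst (Γ : QuantumGraph V E) (c : Cut Γ.toMetricGraph) (K : ℝ) :
    CauchyData Γ c →L[ℂ] CauchyData Γ c :=
  (ContinuousLinearMap.inl ℂ _ _).comp
      ((graphPotential Γ c + (K : ℂ) • ContinuousLinearMap.id ℂ _).comp dataL2) +
    -- Subtracting the coordinates cancels the identity in the scalar component of `1 + (A - 1)`,
    -- leaving just the conditions.
    ∑ h, (conditionConst h - dataCoord h).smulRight ((0, Pi.single h 1) : CauchyData Γ c)

-- A fixed rank-one operator in the row of the new vertex `p`; `α` enters `A` only through its
-- scalar coefficient.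
open Classical in
def systemPhase (Γ : QuantumGraph V E) (c : Cut Γ.toMetricGraph) (p : Fin Γ.betti × Bool) :
    CauchyData Γ c →L[ℂ] CauchyData Γ c :=
  (conditionPhase p.1 p.2).smulRight ((0, Pi.single (Sum.inr p, !p.2) 1) : CauchyData Γ c)

/-- The operator `A`. -/
def systemOp (Γ : QuantumGraph V E) (c : Cut Γ.toMetricGraph) (K : ℝ) (α : Fin Γ.betti → ℝ) :
    CauchyData Γ c →L[ℂ] CauchyData Γ c :=
  1 + (systemConst Γ c K + ∑ p, Complex.exp (Complex.I * α p.1) • systemPhase Γ c p)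

/-- The potential term factors through the compact map `dataL2`, and everything else has finite
rank. -/
theorem isCompactOperator_system (K : ℝ) (α : Fin Γ.betti → ℝ) :
    IsCompactOperator (systemConst Γ c K +
      ∑ p, Complex.exp (Complex.I * α p.1) • systemPhase Γ c p :
        CauchyData Γ c →L[ℂ] CauchyData Γ c) := by
  refine IsCompactOperator.add (IsCompactOperator.add ?_ ?_) ?_
  · exact (isCompactOperator_dataL2.clm_comp
      (graphPotential Γ c + (K : ℂ) • ContinuousLinearMap.id ℂ (GraphL2 (cutTree c)))).clm_comp
        (ContinuousLinearMap.inl ℂ (GraphL2 (cutTree c)) (TreeEdge c × Bool → ℂ))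
  · exact isCompactOperator_sum _ fun h _ => isCompactOperator_smulRight _ _
  · exact isCompactOperator_sum _ fun p _ => Submodule.smul_mem
      (compactOperator (RingHom.id ℂ) (CauchyData Γ c) (CauchyData Γ c)) _
      (isCompactOperator_smulRight (conditionPhase p.1 p.2) _)

/-- With `w = -f''` this is `-f'' + q f + K f`. -/
theorem systemOp_fst (K : ℝ) (α : Fin Γ.betti → ℝ) (x : CauchyData Γ c) :
    (systemOp Γ c K α x).1 = x.1 + (graphPotential Γ c (dataL2 x) + (K : ℂ) • dataL2 x) := by
  simp [systemOp, systemConst, systemPhase, sum_apply, Prod.fst_sum]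

open Classical in
theorem systemOp_snd (K : ℝ) (α : Fin Γ.betti → ℝ) (x : CauchyData Γ c) (h : TreeEdge c × Bool) :
    (systemOp Γ c K α x).2 h = conditionConst h x + ∑ p : Fin Γ.betti × Bool,
      if h = (Sum.inr p, !p.2) then Complex.exp (Complex.I * α p.1) * conditionPhase p.1 p.2 x
        else 0 := by
  have h1 : (∑ h', (conditionConst h' x - dataCoord h' x) •
      (Pi.single h' 1 : TreeEdge c × Bool → ℂ)) h = conditionConst h x - x.2 h := by
    rw [Finset.sum_apply, Finset.sum_eq_single h]
    · simp [dataCoord]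
    · intro h' _ hne
      simp [hne.symm]
    · simp
  have e : (systemOp Γ c K α x).2 = x.2 + ((∑ h', (conditionConst h' x - dataCoord h' x) •
      (Pi.single h' 1 : TreeEdge c × Bool → ℂ)) + ∑ p : Fin Γ.betti × Bool,
        (Complex.exp (Complex.I * α p.1) * conditionPhase p.1 p.2 x) •
          (Pi.single (Sum.inr p, !p.2) 1 : TreeEdge c × Bool → ℂ)) := by
    simp only [systemOp, systemConst, systemPhase, add_apply, sum_apply,
      Prod.snd_add, Prod.snd_sum, ContinuousLinearMap.comp_apply, ContinuousLinearMap.inl_apply,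
      ContinuousLinearMap.smulRight_apply, Prod.smul_mk, smul_zero, zero_add, smul_apply,
      sub_apply, smul_smul, one_apply_eq_self]
  rw [e, Pi.add_apply, Pi.add_apply, h1, Finset.sum_apply]
  have h2 : ∀ p : Fin Γ.betti × Bool, ((Complex.exp (Complex.I * α p.1) *
      conditionPhase p.1 p.2 x) • (Pi.single (Sum.inr p, !p.2) 1 : TreeEdge c × Bool → ℂ)) h =
      if h = (Sum.inr p, !p.2) then Complex.exp (Complex.I * α p.1) * conditionPhase p.1 p.2 x
        else 0 := by
    intro p
    rw [Pi.smul_apply, Pi.single_apply]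
    split_ifs <;> simp
  rw [Finset.sum_congr rfl fun p _ => h2 p, ← add_assoc, add_sub_cancel]

/-- The functions with given Cauchy data, on the whole line. -/
def lineFun (x : CauchyData Γ c) (e : TreeEdge c) : ℝ → ℂ :=
  IccExtend (treeLength_nonneg e) (dataFun e x)

def lineDeriv (x : CauchyData Γ c) (e : TreeEdge c) : ℝ → ℂ :=
  IccExtend (treeLength_nonneg e) (dataDeriv e x)

theorem lineDeriv_apply (x : CauchyData Γ c) (e : TreeEdge c) {t : ℝ}
    (ht : t ∈ Icc 0 ((cutTree c).length e)) :
    lineDeriv x e t = x.2 (e, true) - ∫ s in (0 : ℝ)..t, x.1 e s := by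
  rw [lineDeriv, IccExtend_of_mem _ _ ht]
  simp only [dataDeriv, dataCoord, dataSource, sub_apply, ContinuousMap.sub_apply,
    ContinuousLinearMap.smulRight_apply, ContinuousMap.smul_apply, ContinuousLinearMap.comp_apply,
    primitive_apply, ContinuousMap.one_apply, smul_eq_mul, mul_one]
  rfl

theorem lineFun_apply (x : CauchyData Γ c) (e : TreeEdge c) {t : ℝ}
    (ht : t ∈ Icc 0 ((cutTree c).length e)) :
    lineFun x e t = x.2 (e, false) + ∫ s in (0 : ℝ)..t, lineDeriv x e s := by
  have hL := treeLength_nonneg e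
  have e1 : ∫ s in (0 : ℝ)..t, lineDeriv x e s =
      x.2 (e, true) * t - ∫ s in (0 : ℝ)..t, toEdgeL2 hL (primitive _ (x.1 e)) s := by
    have h0 : (0 : ℝ) ∈ Icc 0 ((cutTree c).length e) := left_mem_Icc.2 hL
    have e2 : ∫ s in (0 : ℝ)..t, lineDeriv x e s =
        ∫ s in (0 : ℝ)..t, (x.2 (e, true) - toEdgeL2 hL (primitive _ (x.1 e)) s) := by
      rw [intervalIntegral.integral_of_le ht.1, intervalIntegral.integral_of_le ht.1]
      refine setIntegral_congr_ae₀ measurableSet_Ioc.nullMeasurableSet ?_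
      have := (ae_restrict_iff' measurableSet_Icc).1 (toEdgeL2_ae hL (primitive _ (x.1 e)))
      filter_upwards [this] with s hs hs'
      have hm : s ∈ Icc 0 ((cutTree c).length e) := ⟨hs'.1.le, hs'.2.trans ht.2⟩
      rw [hs hm, lineDeriv_apply x e hm, IccExtend_of_mem _ _ hm]
      rfl
    rw [e2, intervalIntegral.integral_sub (by simp) (intervalIntegrable_edge _ h0 ht),
      intervalIntegral.integral_const]
    simp [mul_comm]
  rw [e1, lineFun, IccExtend_of_mem _ _ ht]
  simp only [dataFun, dataCoord, dataSource, sub_apply, add_apply, ContinuousMap.sub_apply,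
    ContinuousMap.add_apply,
    ContinuousLinearMap.smulRight_apply, ContinuousMap.smul_apply, ContinuousLinearMap.comp_apply,
    primitive_apply, ContinuousMap.one_apply, smul_eq_mul, mul_one, add_sub_assoc]
  rfl

theorem isSobolevTwo_line (x : CauchyData Γ c) (e : TreeEdge c) :
    IsSobolevTwo ((cutTree c).length e) (lineFun x e) (lineDeriv x e) (fun t => -x.1 e t) := by
  have hL := treeLength_nonneg e
  have h0 : (0 : ℝ) ∈ Icc 0 ((cutTree c).length e) := left_mem_Icc.2 hL
  refine ⟨(Lp.memLp (x.1 e)).neg, fun t ht => ?_, fun t ht => ?_⟩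
  · rw [lineDeriv_apply x e ht, lineDeriv_apply x e h0, intervalIntegral.integral_same, sub_zero,
      intervalIntegral.integral_neg, sub_eq_add_neg]
  · rw [lineFun_apply x e ht, lineFun_apply x e h0, intervalIntegral.integral_same, add_zero]

theorem endValue_lineFun (x : CauchyData Γ c) (e : TreeEdge c) (b : Bool) :
    (cutTree c).endValue (lineFun x) e b = dataEndValue (e, b) x := by
  cases b
  · exact IccExtend_of_mem _ _ (left_mem_Icc.2 (treeLength_nonneg e))
  · exact IccExtend_of_mem _ _ (right_mem_Icc.2 (treeLength_nonneg e))

theorem endDeriv_lineDeriv (x : CauchyData Γ c) (e : TreeEdge c) (b : Bool) :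
    (cutTree c).endDeriv (lineDeriv x) e b = dataEndDeriv (e, b) x := by
  cases b
  · exact IccExtend_of_mem _ _ (left_mem_Icc.2 (treeLength_nonneg e))
  · exact congrArg Neg.neg (IccExtend_of_mem _ _ (right_mem_Icc.2 (treeLength_nonneg e)))

end Resolvent

/-! ### Fredholm alternative and differentiable families of inverses -/

section FredholmFamily

variable {X Y H Z ι : Type*} [NormedAddCommGroup X] [NormedSpace ℂ X] [CompleteSpace X]
  [NormedAddCommGroup Y] [NormedSpace ℝ Y] [NormedAddCommGroup H] [NormedSpace ℂ H]

/-- The Fredholm alternative. -/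
theorem isUnit_one_add_of_injective {C : X →L[ℂ] X} (hC : IsCompactOperator C)
    (hinj : ∀ x, (1 + C) x = 0 → x = 0) : IsUnit (1 + C) := by
  have hC' : IsCompactOperator (-C : X →L[ℂ] X) :=
    Submodule.neg_mem (compactOperator (RingHom.id ℂ) X X) hC
  rcases hC'.hasEigenvalue_or_mem_resolventSet one_ne_zero with h | h
  · obtain ⟨x, hx, hx0⟩ := h.exists_hasEigenvector
    refine absurd (hinj x ?_) hx0
    have h1 : (-C) x = (1 : ℂ) • x := Module.End.mem_eigenspace_iff.1 hx
    rw [one_smul, neg_apply] at h1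
    rw [add_apply, one_apply_eq_self, ← neg_neg (C x), h1, add_neg_cancel]
  · rw [spectrum.mem_resolventSet_iff] at h
    simpa using h

/-- Inversion is differentiable at units, the coefficients are differentiable, and `B ↦ U B J` is
bounded and linear. The parameter is real, hence the restriction of scalars. -/
theorem differentiable_comp_inverse [Fintype ι] {φ : ι → Y → ℂ} (hφ : ∀ i, Differentiable ℝ (φ i))
    (S₀ : X →L[ℂ] X) (S : ι → X →L[ℂ] X)
    (hU : ∀ y, IsUnit (1 + (S₀ + ∑ i, φ i y • S i) : X →L[ℂ] X)) (U : X →L[ℂ] H) (J : H →L[ℂ] X) :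
    Differentiable ℝ fun y =>
      (U.comp (Ring.inverse (1 + (S₀ + ∑ i, φ i y • S i) : X →L[ℂ] X))).comp J := by
  have h1 : Differentiable ℝ fun y => (1 + (S₀ + ∑ i, φ i y • S i) : X →L[ℂ] X) := by
    refine Differentiable.const_add _ (Differentiable.const_add _ ?_)
    exact Differentiable.fun_sum fun i _ => (hφ i).smul_const (S i)
  intro y
  have h2 : DifferentiableAt ℝ (Ring.inverse : (X →L[ℂ] X) → X →L[ℂ] X)
      (1 + (S₀ + ∑ i, φ i y • S i)) :=
    (differentiableAt_inverse (𝕜 := ℂ) (hU y)).restrictScalars ℝ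
  have h3 := DifferentiableAt.comp y h2 (h1 y)
  let F : (X →L[ℂ] X) →L[ℂ] (H →L[ℂ] H) :=
    ((ContinuousLinearMap.compL ℂ H X H).flip J).comp (ContinuousLinearMap.compL ℂ X X H U)
  have h4 : DifferentiableAt ℝ F
      (Ring.inverse (1 + (S₀ + ∑ i, φ i y • S i) : X →L[ℂ] X)) :=
    (F.differentiableAt (𝕜 := ℂ)).restrictScalars ℝ
  exact DifferentiableAt.comp y h4 h3

end FredholmFamily

/-! ### Construction and properties of the resolvent of `H^α` -/

section Resolvent

variable {V E : Type*} [Fintype V] [Fintype E] {Γ : QuantumGraph V E} {c : Cut Γ.toMetricGraph}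
  {K : ℝ} {α : Fin Γ.betti → ℝ}

theorem systemOp_snd_of_endpoint_eq_inl (x : CauchyData Γ c) {h : TreeEdge c × Bool} {v : V}
    (hv : (cutTree c).endpoint h.1 h.2 = Sum.inl v) :
    (systemOp Γ c K α x).2 h = conditionConst h x := by
  classical
  rw [systemOp_snd, Finset.sum_eq_zero, add_zero]
  rintro ⟨j, b⟩ -
  refine if_neg ?_
  rintro rfl
  cases b <;> cases hv

theorem systemOp_snd_inr (x : CauchyData Γ c) (j : Fin Γ.betti) (b : Bool) :
    (systemOp Γ c K α x).2 (Sum.inr (j, b), !b) = conditionConst (Sum.inr (j, b), !b) x +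
      Complex.exp (Complex.I * α j) * conditionPhase j b x := by
  classical
  rw [systemOp_snd, Finset.sum_eq_single (j, b)]
  · rw [if_pos rfl]
  · intro p _ hp
    refine if_neg fun h => hp ?_
    exact (Sum.inr.inj (congrArg Prod.fst h)).symm
  · simp

theorem conditionConst_of_top (x : CauchyData Γ c) {h : TreeEdge c × Bool} {v : V}
    (hv : (cutTree c).endpoint h.1 h.2 = Sum.inl v) (hχ : Γ.χ v = ⊤) :
    conditionConst h x = dataEndValue h x := by
  simp only [conditionConst, hv, hχ]

theorem conditionConst_of_coe (x : CauchyData Γ c) {h : TreeEdge c × Bool} {v : V} {r : ℝ}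
    (hv : (cutTree c).endpoint h.1 h.2 = Sum.inl v) (hχ : Γ.χ v = (r : WithTop ℝ)) :
    conditionConst h x = dataEndValue h x -
      dataEndValue (@Classical.epsilon _ ⟨h⟩ fun h' : TreeEdge c × Bool =>
        (cutTree c).endpoint h'.1 h'.2 = Sum.inl v) x +
      ((cutTree c).vertexSum (fun h' => dataEndDeriv h' x) (Sum.inl v) -
        r * dataEndValue (@Classical.epsilon _ ⟨h⟩ fun h' : TreeEdge c × Bool =>
          (cutTree c).endpoint h'.1 h'.2 = Sum.inl v) x) := by
  have hs : (cutTree c).vertexSum dataEndDeriv (Sum.inl v) x =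
      (cutTree c).vertexSum (fun h' => dataEndDeriv h' x) (Sum.inl v) := by
    rw [MetricGraph.vertexSum, MetricGraph.vertexSum, sum_apply]
    refine Finset.sum_congr rfl fun h' _ => ?_
    split_ifs <;> rfl
  simp only [conditionConst, hv, hχ]
  rw [add_apply, sub_apply, sub_apply, smul_apply, hs, smul_eq_mul]

theorem vertexConditions_of_systemOp {x : CauchyData Γ c} (hx : (systemOp Γ c K α x).2 = 0) :
    VertexConditions Γ c α (lineFun x) (lineDeriv x) := by
  have hx' : ∀ h, (systemOp Γ c K α x).2 h = 0 := fun h => congrFun hx h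
  refine ⟨fun v => ?_, fun j => ?_, fun j => ?_⟩
  · cases hχ : Γ.χ v with
    | top =>
      refine ⟨0, fun e b hv => ?_, fun _ => rfl, fun r hr => by simp at hr⟩
      rw [endValue_lineFun, ← conditionConst_of_top (h := (e, b)) x hv hχ,
        ← systemOp_snd_of_endpoint_eq_inl (h := (e, b)) x hv]
      exact hx' _
    | coe r =>
      by_cases hex : ∃ h : TreeEdge c × Bool, (cutTree c).endpoint h.1 h.2 = Sum.inl v
      · obtain ⟨h₁, hh₁⟩ := id hex
        set h₀ := @Classical.epsilon _ ⟨h₁⟩ fun h' : TreeEdge c × Bool =>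
          (cutTree c).endpoint h'.1 h'.2 = Sum.inl v with hh₀
        have hspec : (cutTree c).endpoint h₀.1 h₀.2 = Sum.inl v := Classical.epsilon_spec hex
        have key : ∀ h : TreeEdge c × Bool, (cutTree c).endpoint h.1 h.2 = Sum.inl v →
            dataEndValue h x - dataEndValue h₀ x +
              ((cutTree c).vertexSum (fun h' => dataEndDeriv h' x) (Sum.inl v) -
                r * dataEndValue h₀ x) = 0 := fun h hv => by
          rw [← hx' h, systemOp_snd_of_endpoint_eq_inl x hv, conditionConst_of_coe x hv hχ]
        -- In the row of `h₀` itself the continuity part cancels.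
        have hsum : (cutTree c).vertexSum (fun h' => dataEndDeriv h' x) (Sum.inl v) =
            r * dataEndValue h₀ x := by
          linear_combination key h₀ hspec
        refine ⟨dataEndValue h₀ x, fun e b hv => ?_, fun h => by simp at h, fun r' hr' => ?_⟩
        · rw [endValue_lineFun]
          linear_combination key (e, b) hv - hsum
        · obtain rfl : r = r' := WithTop.coe_injective hr'
          rw [← hsum]
          refine Finset.sum_congr rfl fun h _ => ?_
          rw [endDeriv_lineDeriv]
      -- An isolated vertex imposes no condition.
      · push Not at hex
        refine ⟨0, fun e b hv => absurd hv (hex (e, b)), fun _ => rfl, fun r' _ => ?_⟩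
        rw [mul_zero]
        exact Finset.sum_eq_zero fun h _ => if_neg (hex h)
  · have h := hx' (Sum.inr (j, false), !false)
    rw [systemOp_snd_inr] at h
    rw [endValue_lineFun, endValue_lineFun]
    have h1 : conditionConst (Γ := Γ) (c := c) (Sum.inr (j, false), !false) x =
        dataEndValue (Sum.inr (j, true), false) x := rfl
    have h2 : conditionPhase (Γ := Γ) (c := c) j false x =
        -dataEndValue (Sum.inr (j, false), true) x := rfl
    rw [h1, h2] at h
    linear_combination h
  · have h := hx' (Sum.inr (j, true), !true)
    rw [systemOp_snd_inr] at h
    rw [endDeriv_lineDeriv, endDeriv_lineDeriv]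
    have h1 : conditionConst (Γ := Γ) (c := c) (Sum.inr (j, true), !true) x =
        dataEndDeriv (Sum.inr (j, true), false) x := rfl
    have h2 : conditionPhase (Γ := Γ) (c := c) j true x =
        dataEndDeriv (Sum.inr (j, false), true) x := rfl
    rw [h1, h2] at h
    linear_combination h

theorem inGraph_of_systemOp {x : CauchyData Γ c} (hx : (systemOp Γ c K α x).2 = 0) :
    InGraph Γ c α (dataL2 x) (x.1 + graphPotential Γ c (dataL2 x)) := by
  have hu : ∀ e, dataL2 x e =ᵐ[volume.restrict (Icc 0 ((cutTree c).length e))] lineFun x e := by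
    intro e
    rw [dataL2_apply]
    exact toEdgeL2_ae _ _
  refine ⟨lineFun x, lineDeriv x, fun e t => -x.1 e t, isSobolevTwo_line x,
    vertexConditions_of_systemOp hx, hu, fun e => ?_⟩
  have h2 := mulPotential_ae (isBoundedPotential_treePotential Γ c e) (dataL2 x e)
  rw [← graphPotential_apply] at h2
  filter_upwards [Lp.coeFn_add (x.1 e) (graphPotential Γ c (dataL2 x) e), h2, hu e] with t h1 h2 h3
  refine h1.trans ?_
  rw [Pi.add_apply, h2, h3, neg_neg]

/-- `K` is larger than minus a lower bound of all the `H^α`. -/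
def IsStrictLowerBound (Γ : QuantumGraph V E) (c : Cut Γ.toMetricGraph) (K : ℝ) : Prop :=
  ∀ (α : Fin Γ.betti → ℝ) (u w : GraphL2 (cutTree c)), InGraph Γ c α u w →
    -((K - 1) * ‖u‖ ^ 2) ≤ (inner ℂ u w).re

theorem inner_self_re {H : Type*} [NormedAddCommGroup H] [InnerProductSpace ℂ H] (u : H) :
    (inner ℂ u u).re = ‖u‖ ^ 2 := by
  rw [inner_self_eq_norm_sq_to_K]
  norm_cast

/-- Testing the bound on `u` gives `(s + K - 1)‖u‖² ≥ 0`, while `s + K - 1 ≤ -1`. -/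
theorem IsStrictLowerBound.eq_zero (hK : IsStrictLowerBound Γ c K) {u : GraphL2 (cutTree c)}
    {s : ℝ} (hs : s ≤ -K) (h : InGraph Γ c α u ((s : ℂ) • u)) : u = 0 := by
  have h1 := hK α u _ h
  rw [inner_smul_right, Complex.re_ofReal_mul, inner_self_re] at h1
  by_contra hu
  have h2 : 0 < ‖u‖ ^ 2 := by positivity
  nlinarith

/-- A kernel element yields `f` with `H^α f = -K f`, so `f = 0` by the lower bound, and `w = 0`
because `H^α` is single valued. Then `f = a + b t` vanishes on an interval of positive length, which
forces `a = b = 0`. -/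
theorem systemOp_injective (hK : IsStrictLowerBound Γ c K) {x : CauchyData Γ c}
    (hx : systemOp Γ c K α x = 0) : x = 0 := by
  have hG := inGraph_of_systemOp (K := K) (α := α) (x := x) (by rw [hx]; rfl)
  have h1 : x.1 + (graphPotential Γ c (dataL2 x) + (K : ℂ) • dataL2 x) = 0 := by
    rw [← systemOp_fst (α := α), hx]
    rfl
  have hu : dataL2 x = 0 := by
    refine hK.eq_zero (s := -K) le_rfl (α := α) ?_
    convert hG using 1
    rw [← add_assoc] at h1
    rw [eq_neg_of_add_eq_zero_left h1]
    simp
  rw [hu, map_zero, add_zero] at hG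
  have hx1 : x.1 = 0 := InGraph.eq_zero hG
  have hx2 : ∀ e, dataFun e x = 0 := fun e => by
    refine toEdgeL2_injective ((cutTree c).length_pos e) ?_
    rw [map_zero, ← dataL2_apply, hu]
    rfl
  have hline : ∀ e, ∀ t ∈ Icc 0 ((cutTree c).length e), lineFun x e t = x.2 (e, false) +
      t * x.2 (e, true) := fun e t ht => by
    rw [lineFun_apply x e ht]
    congr 1
    rw [intervalIntegral.integral_congr (g := fun _ => x.2 (e, true)),
      intervalIntegral.integral_const]
    · simp
    · intro s hs
      rw [uIcc_of_le ht.1] at hs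
      have hs' : s ∈ Icc 0 ((cutTree c).length e) := ⟨hs.1, hs.2.trans ht.2⟩
      have hz : ∀ᵐ τ, τ ∈ uIoc 0 s → x.1 e τ = (0 : ℂ) := by
        have h0 : (x.1 e : ℝ → ℂ) =ᵐ[volume.restrict (Icc 0 ((cutTree c).length e))] 0 := by
          rw [hx1]
          exact Lp.coeFn_zero _ _ _
        filter_upwards [(ae_restrict_iff' measurableSet_Icc).1 h0] with τ hτ hτ'
        rw [uIoc_of_le hs.1] at hτ'
        exact hτ ⟨hτ'.1.le, hτ'.2.trans hs'.2⟩
      show lineDeriv x e s = _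
      rw [lineDeriv_apply x e hs', intervalIntegral.integral_zero_ae hz, sub_zero]
  have hzero : ∀ e, ∀ t ∈ Icc 0 ((cutTree c).length e), lineFun x e t = 0 := fun e t ht => by
    rw [lineFun, IccExtend_of_mem _ _ ht, hx2 e]
    rfl
  refine Prod.ext hx1 (funext fun h => ?_)
  obtain ⟨e, b⟩ := h
  have hL := (cutTree c).length_pos e
  have ha : x.2 (e, false) = 0 := by
    have := hline e 0 (left_mem_Icc.2 hL.le)
    rw [hzero e 0 (left_mem_Icc.2 hL.le)] at this
    simpa using this.symm
  have hb : x.2 (e, true) = 0 := by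
    have := hline e _ (right_mem_Icc.2 hL.le)
    rw [hzero e _ (right_mem_Icc.2 hL.le), ha, zero_add] at this
    exact (mul_eq_zero.1 this.symm).resolve_left (by exact_mod_cast hL.ne')
  cases b
  · exact ha
  · exact hb

theorem isUnit_systemOp (hK : IsStrictLowerBound Γ c K) (α : Fin Γ.betti → ℝ) :
    IsUnit (systemOp Γ c K α) :=
  isUnit_one_add_of_injective (isCompactOperator_system K α) fun _ hx => systemOp_injective hK hx

/-- The resolvent `(H^α + K)⁻¹`. -/
def resolvent (Γ : QuantumGraph V E) (c : Cut Γ.toMetricGraph) (K : ℝ) (α : Fin Γ.betti → ℝ) :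
    GraphL2 (cutTree c) →L[ℂ] GraphL2 (cutTree c) :=
  (dataL2.comp (Ring.inverse (systemOp Γ c K α))).comp
    (ContinuousLinearMap.inl ℂ (GraphL2 (cutTree c)) (TreeEdge c × Bool → ℂ))

theorem isCompactOperator_resolvent : IsCompactOperator (resolvent Γ c K α) :=
  (isCompactOperator_dataL2.comp_clm (Ring.inverse (systemOp Γ c K α))).comp_clm
    (ContinuousLinearMap.inl ℂ (GraphL2 (cutTree c)) (TreeEdge c × Bool → ℂ))

theorem differentiable_resolvent (hK : IsStrictLowerBound Γ c K) :
    Differentiable ℝ (resolvent Γ c K) := by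
  have hφ : ∀ p : Fin Γ.betti × Bool, Differentiable ℝ fun α : Fin Γ.betti → ℝ =>
      Complex.exp (Complex.I * (α p.1 : ℂ)) := fun p => by
    have h1 : Differentiable ℝ fun α : Fin Γ.betti → ℝ => Complex.I * (α p.1 : ℂ) := by
      refine Differentiable.const_mul ?_ _
      exact Complex.ofRealCLM.differentiable.comp (differentiable_apply p.1)
    exact h1.cexp
  have hU : ∀ α : Fin Γ.betti → ℝ, IsUnit (1 + (systemConst Γ c K +
      ∑ p, Complex.exp (Complex.I * α p.1) • systemPhase Γ c p) :
        CauchyData Γ c →L[ℂ] CauchyData Γ c) := isUnit_systemOp hK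
  have h := differentiable_comp_inverse hφ (systemConst Γ c K) (systemPhase Γ c) hU dataL2
    (ContinuousLinearMap.inl ℂ (GraphL2 (cutTree c)) (TreeEdge c × Bool → ℂ))
  exact h

/-- `H^α u = g - K u` for `u = (H^α + K)⁻¹ g`. -/
theorem inGraph_resolvent (hK : IsStrictLowerBound Γ c K) (α : Fin Γ.betti → ℝ)
    (g : GraphL2 (cutTree c)) :
    InGraph Γ c α (resolvent Γ c K α g) (g - (K : ℂ) • resolvent Γ c K α g) := by
  set x : CauchyData Γ c := Ring.inverse (systemOp Γ c K α) (g, 0) with hx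
  have hA : systemOp Γ c K α x = (g, 0) := by
    have := Ring.mul_inverse_cancel _ (isUnit_systemOp hK α)
    exact congrArg (fun T : CauchyData Γ c →L[ℂ] CauchyData Γ c => T (g, 0)) this
  have hr : resolvent Γ c K α g = dataL2 x := rfl
  have h1 := inGraph_of_systemOp (K := K) (α := α) (x := x) (by rw [hA])
  have h2 : x.1 + (graphPotential Γ c (dataL2 x) + (K : ℂ) • dataL2 x) = g := by
    rw [← systemOp_fst (α := α), hA]
  rw [hr]
  convert h1 using 1
  rw [← h2]
  abel

/-- The difference of the two sides would be an eigenvector of `H^α` with eigenvalue `-K`. -/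
theorem resolvent_eq (hK : IsStrictLowerBound Γ c K) {u w : GraphL2 (cutTree c)}
    (h : InGraph Γ c α u w) : resolvent Γ c K α (w + (K : ℂ) • u) = u := by
  have h1 := InGraph.comb 1 (-1) (inGraph_resolvent hK α (w + (K : ℂ) • u)) h
  rw [← sub_eq_zero]
  refine hK.eq_zero (s := -K) le_rfl (α := α) ?_
  convert h1 using 1
  · simp [sub_eq_add_neg]
  · simp only [one_smul, neg_smul, Complex.ofReal_neg, smul_sub]
    abel

theorem isSymmetric_resolvent (hK : IsStrictLowerBound Γ c K) (α : Fin Γ.betti → ℝ) :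
    (resolvent Γ c K α).IsSymmetric := by
  intro g g'
  have h := (inGraph_resolvent hK α g).inner_comm (inGraph_resolvent hK α g')
  simp only [inner_sub_left, inner_sub_right, inner_smul_left, inner_smul_right,
    Complex.conj_ofReal] at h
  have : inner ℂ g (resolvent Γ c K α g') = inner ℂ (resolvent Γ c K α g) g' := by
    linear_combination h
  exact this.symm

/-- With `u = R g`, the form is `⟨u, H^α u⟩ + K‖u‖² ≥ ‖u‖²`, and `u ≠ 0` because `H^α` is single
valued. -/
theorem resolvent_pos (hK : IsStrictLowerBound Γ c K) (α : Fin Γ.betti → ℝ)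
    {g : GraphL2 (cutTree c)} (hg : g ≠ 0) : 0 < (inner ℂ (resolvent Γ c K α g) g).re := by
  have hG := inGraph_resolvent hK α g
  set u := resolvent Γ c K α g with hu
  have hu0 : u ≠ 0 := by
    intro h0
    rw [h0, smul_zero, sub_zero] at hG
    exact hg (InGraph.eq_zero hG)
  have h := hK α _ _ hG
  rw [inner_sub_right, Complex.sub_re, inner_smul_right, Complex.re_ofReal_mul, inner_self_re] at h
  have : 0 < ‖u‖ ^ 2 := by positivity
  linarith

theorem exists_isStrictLowerBound (Γ : QuantumGraph V E) (c : Cut Γ.toMetricGraph) :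
    ∃ K, IsStrictLowerBound Γ c K := by
  obtain ⟨K, -, hK⟩ := exists_lowerBound Γ c
  exact ⟨K + 1, fun α u w h => by simpa using hK α u w h⟩

end Resolvent

/-! ### Spectrum and eigenspaces of `H^α` -/

section Eigenspaces

variable {V E : Type*} [Fintype V] [Fintype E] {Γ : QuantumGraph V E} {c : Cut Γ.toMetricGraph}
  {K : ℝ} {α : Fin Γ.betti → ℝ}

theorem inGraph_iff {u w : GraphL2 (cutTree c)} : InGraph Γ c α u w ↔
    ∃ h : u ∈ (magneticOp Γ c α).domain, magneticOp Γ c α ⟨u, h⟩ = w := by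
  rw [← mem_graph_magneticOp, LinearPMap.mem_graph_iff]
  constructor
  · rintro ⟨⟨y, hy⟩, h1, h2⟩
    obtain rfl : y = u := h1
    exact ⟨hy, h2⟩
  · rintro ⟨h, hw⟩
    exact ⟨⟨u, h⟩, rfl, hw⟩

theorem mem_eigenspace_magneticOp {u : GraphL2 (cutTree c)} {z : ℂ} :
    u ∈ eigenspace (magneticOp Γ c α) z ↔ InGraph Γ c α u (z • u) := by
  rw [inGraph_iff, eigenspace, Submodule.mem_map]
  constructor
  · rintro ⟨⟨y, hy⟩, h1, rfl⟩
    rw [LinearMap.mem_ker, LinearMap.sub_apply, sub_eq_zero] at h1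
    exact ⟨hy, h1⟩
  · rintro ⟨h, hw⟩
    refine ⟨⟨u, h⟩, ?_, rfl⟩
    rw [LinearMap.mem_ker, LinearMap.sub_apply, sub_eq_zero]
    exact hw

theorem notMem_spec_magneticOp {z : ℂ} : z ∉ spec (magneticOp Γ c α) ↔
    ∃ R : GraphL2 (cutTree c) →L[ℂ] GraphL2 (cutTree c),
      (∀ w, InGraph Γ c α (R w) (w + z • R w)) ∧
      ∀ u w, InGraph Γ c α u w → R (w - z • u) = u := by
  rw [spec, mem_ofPred_eq, not_not]
  refine exists_congr fun R => and_congr (forall_congr' fun w => ?_) ⟨fun h u w hu => ?_, fun h u => ?_⟩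
  · rw [inGraph_iff]
    exact exists_congr fun _ => sub_eq_iff_eq_add
  · obtain ⟨hd, rfl⟩ := inGraph_iff.1 hu
    exact h ⟨u, hd⟩
  · exact h u _ (inGraph_iff.2 ⟨u.2, rfl⟩)

theorem eigenspace_eq_bot_of_notMem_spec {z : ℂ} (hz : z ∉ spec (magneticOp Γ c α)) :
    eigenspace (magneticOp Γ c α) z = ⊥ := by
  obtain ⟨R, -, hR⟩ := notMem_spec_magneticOp.1 hz
  rw [Submodule.eq_bot_iff]
  intro u hu
  rw [← hR u _ (mem_eigenspace_magneticOp.1 hu), sub_self, map_zero]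

/-- `H^α` is self-adjoint: its spectrum is real. -/
theorem notMem_spec_of_im_ne_zero {z : ℂ} (hz : z.im ≠ 0) : z ∉ spec (magneticOp Γ c α) := by
  obtain ⟨K, hK⟩ := exists_isStrictLowerBound Γ c
  set R := resolvent Γ c K α with hR
  have hzK : z + K ≠ 0 := fun h => hz (by simpa using congrArg Complex.im h)
  -- The inverse of `H^α - z` will be `R (1 - (z + K) R)⁻¹`. The second factor exists since
  -- otherwise the symmetric operator `R` would have the non-real eigenvalue `(z + K)⁻¹`.
  have hunit : IsUnit (1 + -((z + K) • R) : GraphL2 (cutTree c) →L[ℂ] GraphL2 (cutTree c)) := by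
    refine isUnit_one_add_of_injective ?_ fun x hx => ?_
    · have hRc : IsCompactOperator R := isCompactOperator_resolvent
      exact (hRc.smul (z + K : ℂ)).neg
    · by_contra hx0
      have h1 : R x = (z + K)⁻¹ • x := by
        rw [add_apply, one_apply_eq_self, neg_apply, smul_apply, ← sub_eq_add_neg, sub_eq_zero] at hx
        rw [eq_inv_smul_iff₀ hzK]
        exact hx.symm
      have h2 : Module.End.HasEigenvalue (R : Module.End ℂ (GraphL2 (cutTree c))) (z + K)⁻¹ :=
        Module.End.hasEigenvalue_of_hasEigenvector ⟨Module.End.mem_eigenspace_iff.2 h1, hx0⟩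
      have h3 := (isSymmetric_resolvent hK α).conj_eigenvalue_eq_self h2
      rw [map_inv₀, inv_inj, Complex.conj_eq_iff_im] at h3
      exact hz (by simpa using h3)
  set T := (1 + -((z + K) • R) : GraphL2 (cutTree c) →L[ℂ] GraphL2 (cutTree c)) with hT
  have hTapp : ∀ y, T y = y - (z + K) • R y := fun y => by
    rw [hT, add_apply, one_apply_eq_self, neg_apply, smul_apply, sub_eq_add_neg]
  have h1 : ∀ y, T (Ring.inverse T y) = y := fun y =>
    congrArg (fun S : GraphL2 (cutTree c) →L[ℂ] GraphL2 (cutTree c) => S y)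
      (Ring.mul_inverse_cancel T hunit)
  have h2 : ∀ y, Ring.inverse T (T y) = y := fun y =>
    congrArg (fun S : GraphL2 (cutTree c) →L[ℂ] GraphL2 (cutTree c) => S y)
      (Ring.inverse_mul_cancel T hunit)
  refine notMem_spec_magneticOp.2 ⟨R.comp (Ring.inverse T), fun w => ?_, fun u w hu => ?_⟩
  · have h3 := inGraph_resolvent hK α (Ring.inverse T w)
    have h4 := h1 w
    rw [hTapp, sub_eq_iff_eq_add] at h4
    have e : w + z • R (Ring.inverse T w) =
        Ring.inverse T w - (K : ℂ) • R (Ring.inverse T w) := by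
      rw [eq_sub_iff_add_eq, add_assoc, ← add_smul]
      exact h4.symm
    show InGraph Γ c α (R (Ring.inverse T w)) (w + z • R (Ring.inverse T w))
    rw [e]
    exact h3
  · have h3 := resolvent_eq hK hu
    have h4 : w - z • u = T (w + (K : ℂ) • u) := by
      rw [hTapp, hR, h3, add_smul]
      abel
    rw [ContinuousLinearMap.comp_apply, h4, h2]
    exact h3

theorem eigenResolvent_magneticOp (hK : IsStrictLowerBound Γ c K) (α : Fin Γ.betti → ℝ) :
    EigenResolvent (magneticOp Γ c α) K (resolvent Γ c K α) := by
  refine ⟨fun s hs => ?_, fun s hs => ?_⟩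
  · rw [Submodule.eq_bot_iff]
    exact fun u hu => hK.eq_zero hs (mem_eigenspace_magneticOp.1 hu)
  · have hs0 : ((s + K : ℝ) : ℂ) ≠ 0 := by
      have : s + K ≠ 0 := by linarith
      exact_mod_cast this
    ext u
    rw [mem_eigenspace_magneticOp, Module.End.mem_eigenspace_iff]
    show _ ↔ resolvent Γ c K α u = _
    rw [Complex.ofReal_inv, eq_inv_smul_iff₀ hs0]
    constructor
    · intro h
      have h1 := resolvent_eq hK h
      rw [← add_smul, map_smul] at h1
      simpa using h1
    · intro h
      -- As `u = (s + K) R u`, scaling the pair of `R u` in the graph puts `u` in the domain.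
      have h1 := InGraph.comb ((s + K : ℝ) : ℂ) 0 (inGraph_resolvent hK α u)
        (inGraph_resolvent hK α u)
      rw [zero_smul, zero_smul, add_zero, add_zero, h, smul_sub, smul_comm, h] at h1
      convert h1 using 1
      push_cast
      rw [add_smul]
      abel

theorem not_finiteDimensional_graphL2 [Nonempty (TreeEdge c)] :
    ¬ FiniteDimensional ℂ (GraphL2 (cutTree c)) := by
  intro hfd
  obtain ⟨e⟩ := ‹Nonempty (TreeEdge c)›
  refine not_finiteDimensional_edgeL2 ((cutTree c).length_pos e) ?_
  classical
  refine Module.Finite.of_surjective (PiLp.projₗ 2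
    (fun e : TreeEdge c => EdgeL2 ((cutTree c).length e)) e : GraphL2 (cutTree c) →ₗ[ℂ] _) fun y => ?_
  refine ⟨WithLp.toLp 2 (Pi.single e y), ?_⟩
  simp

end Eigenspaces

/-! ### Complex conjugation -/

section Conjugation

variable {V E : Type*} [Fintype V] [Fintype E] {Γ : QuantumGraph V E} {c : Cut Γ.toMetricGraph}

theorem star_add_edgeL2 {L : ℝ} (f g : EdgeL2 L) : star (f + g) = star f + star g := by
  refine Lp.ext ?_
  filter_upwards [Lp.coeFn_star (f + g), Lp.coeFn_add f g, Lp.coeFn_add (star f) (star g),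
    Lp.coeFn_star f, Lp.coeFn_star g] with x h1 h2 h3 h4 h5
  rw [h1, h3, Pi.star_apply, h2, Pi.add_apply, Pi.add_apply, h4, h5, Pi.star_apply, Pi.star_apply,
    star_add]

theorem star_smul_edgeL2 {L : ℝ} (z : ℂ) (f : EdgeL2 L) : star (z • f) = star z • star f := by
  refine Lp.ext ?_
  filter_upwards [Lp.coeFn_star (z • f), Lp.coeFn_smul z f, Lp.coeFn_smul (star z) (star f),
    Lp.coeFn_star f] with x h1 h2 h3 h4
  simp only [h1, h2, h3, h4, Pi.star_apply, Pi.smul_apply, smul_eq_mul, star_mul']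

theorem norm_star_edgeL2 {L : ℝ} (f : EdgeL2 L) : ‖star f‖ = ‖f‖ := by
  rw [Lp.norm_def, Lp.norm_def, eLpNorm_congr_ae (Lp.coeFn_star f)]
  congr 1
  exact eLpNorm_congr_norm_ae (Eventually.of_forall fun x => by simp)

variable (c) in
/-- Complex conjugation of functions on the cut tree. -/
def conjEquiv : GraphL2 (cutTree c) ≃ₛₗ[starRingEnd ℂ] GraphL2 (cutTree c) :=
  LinearEquiv.ofInvolutive
    { toFun := fun u => WithLp.toLp 2 fun e => star (u e)
      map_add' := fun u v => by
        ext1 e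
        exact star_add_edgeL2 (u e) (v e)
      map_smul' := fun z u => by
        ext1 e
        exact star_smul_edgeL2 z (u e) }
    fun u => by
      ext1 e
      exact star_star (u e)

theorem conjEquiv_apply (u : GraphL2 (cutTree c)) (e : TreeEdge c) :
    conjEquiv c u e = star (u e) := rfl

theorem conjEquiv_conjEquiv (u : GraphL2 (cutTree c)) : conjEquiv c (conjEquiv c u) = u := by
  ext1 e
  exact star_star (u e)

theorem conjEquiv_ae (u : GraphL2 (cutTree c)) (e : TreeEdge c) :
    conjEquiv c u e =ᵐ[volume.restrict (Icc 0 ((cutTree c).length e))] fun x => star (u e x) :=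
  Lp.coeFn_star (u e)

theorem norm_conjEquiv (u : GraphL2 (cutTree c)) : ‖conjEquiv c u‖ = ‖u‖ := by
  rw [PiLp.norm_eq_of_L2, PiLp.norm_eq_of_L2]
  simp only [conjEquiv_apply, norm_star_edgeL2]

variable {α α' : Fin Γ.betti → ℝ}

/-- The coefficients `χ` are real, so conjugation changes only the phases. -/
theorem VertexConditions.conj
    (hα : ∀ j, Complex.exp (Complex.I * α' j) = star (Complex.exp (Complex.I * α j)))
    {f f₁ : TreeEdge c → ℝ → ℂ} (h : VertexConditions Γ c α f f₁) :
    VertexConditions Γ c α' (fun e x => star (f e x)) (fun e x => star (f₁ e x)) := by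
  have hv : ∀ e b, (cutTree c).endValue (fun e x => star (f e x)) e b =
      star ((cutTree c).endValue f e b) := fun e b => by cases b <;> rfl
  have hd : ∀ e b, (cutTree c).endDeriv (fun e x => star (f₁ e x)) e b =
      star ((cutTree c).endDeriv f₁ e b) := fun e b => by
    cases b
    · rfl
    · simp [MetricGraph.endDeriv]
  refine ⟨fun v => ?_, fun j => ?_, fun j => ?_⟩
  · obtain ⟨a, h1, h2, h3⟩ := h.delta v
    refine ⟨star a, fun e b he => by rw [hv, h1 e b he], fun hχ => by rw [h2 hχ, star_zero],
      fun r hr => ?_⟩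
    have h4 := congrArg star (h3 r hr)
    rw [star_sum, star_mul', show star (r : ℂ) = r from Complex.conj_ofReal r] at h4
    rw [← h4]
    refine Finset.sum_congr rfl fun e _ => ?_
    split_ifs
    · exact hd _ _
    · simp
  · rw [hv, hv, h.jump j, star_mul', hα]
  · rw [hd, hd, h.jump_deriv j, star_mul', star_neg, hα]

theorem InGraph.conj
    (hα : ∀ j, Complex.exp (Complex.I * α' j) = star (Complex.exp (Complex.I * α j)))
    {u w : GraphL2 (cutTree c)} (h : InGraph Γ c α u w) :
    InGraph Γ c α' (conjEquiv c u) (conjEquiv c w) := by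
  obtain ⟨f, f₁, f₂, hS, hV, hu, hw⟩ := h
  refine ⟨fun e x => star (f e x), fun e x => star (f₁ e x), fun e x => star (f₂ e x),
    fun e => (hS e).conj, hV.conj hα, fun e => ?_, fun e => ?_⟩
  · filter_upwards [conjEquiv_ae u e, hu e] with x h1 h2
    rw [h1, h2]
  · filter_upwards [conjEquiv_ae w e, hw e] with x h1 h2
    rw [h1, h2]
    simp

/-- If `R` inverts `H^α - z`, conjugating before and after `R` gives a complex linear inverse of
`H^{α'} - z̄`. -/
theorem notMem_spec_conj
    (hα : ∀ j, Complex.exp (Complex.I * α' j) = star (Complex.exp (Complex.I * α j)))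
    {z : ℂ} (hz : z ∉ spec (magneticOp Γ c α)) : star z ∉ spec (magneticOp Γ c α') := by
  obtain ⟨R, h1, h2⟩ := notMem_spec_magneticOp.1 hz
  have hα' : ∀ j, Complex.exp (Complex.I * α j) = star (Complex.exp (Complex.I * α' j)) := fun j => by
    rw [hα, star_star]
  let R' : GraphL2 (cutTree c) →L[ℂ] GraphL2 (cutTree c) := LinearMap.mkContinuous
    { toFun := fun w => conjEquiv c (R (conjEquiv c w))
      map_add' := fun w w' => by simp only [map_add]
      map_smul' := fun y w => by
        simp only [map_smulₛₗ, RingHom.id_apply, Complex.conj_conj] } ‖R‖ fun w => by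
      show ‖conjEquiv c (R (conjEquiv c w))‖ ≤ _
      rw [norm_conjEquiv, ← norm_conjEquiv w]
      exact R.le_opNorm _
  have hR' : ∀ w, R' w = conjEquiv c (R (conjEquiv c w)) := fun w => rfl
  refine notMem_spec_magneticOp.2 ⟨R', fun w => ?_, fun u w hu => ?_⟩
  · have h := (h1 (conjEquiv c w)).conj hα
    rw [map_add, map_smulₛₗ, conjEquiv_conjEquiv] at h
    exact h
  · have h := h2 _ _ (hu.conj hα')
    have e : conjEquiv c w - z • conjEquiv c u = conjEquiv c (w - star z • u) := by
      rw [map_sub, map_smulₛₗ]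
      simp
    rw [hR', ← e, h, conjEquiv_conjEquiv]

theorem map_eigenspace_conj
    (hα : ∀ j, Complex.exp (Complex.I * α' j) = star (Complex.exp (Complex.I * α j))) (s : ℝ) :
    (eigenspace (magneticOp Γ c α) (s : ℂ)).map (conjEquiv c).toLinearMap =
      eigenspace (magneticOp Γ c α') (s : ℂ) := by
  have hα' : ∀ j, Complex.exp (Complex.I * α j) = star (Complex.exp (Complex.I * α' j)) := fun j => by
    rw [hα, star_star]
  ext u
  rw [Submodule.mem_map]
  constructor
  · rintro ⟨v, hv, rfl⟩
    have h := (mem_eigenspace_magneticOp.1 hv).conj hα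
    rw [map_smulₛₗ, Complex.conj_ofReal] at h
    exact mem_eigenspace_magneticOp.2 h
  · intro hu
    refine ⟨conjEquiv c u, ?_, conjEquiv_conjEquiv u⟩
    have h := (mem_eigenspace_magneticOp.1 hu).conj hα'
    rw [map_smulₛₗ, Complex.conj_ofReal] at h
    exact mem_eigenspace_magneticOp.2 h

/-- An antilinear bijection preserves dimension because conjugation is an automorphism of the
scalars. -/
theorem rank_map_conjEquiv (p : Submodule ℂ (GraphL2 (cutTree c))) :
    Module.rank ℂ (p.map (conjEquiv c).toLinearMap) = Module.rank ℂ p :=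
  (rank_eq_of_equiv_equiv (starRingEnd ℂ) ((conjEquiv c).submoduleMap p).toAddEquiv
    (Function.Involutive.bijective fun z => Complex.conj_conj z) fun r m =>
      ((conjEquiv c).submoduleMap p).map_smulₛₗ r m).symm

/-- Conjugation alone matches `z` with its conjugate; reality of the spectrum makes these equal. -/
theorem spec_eq_of_conj
    (hα : ∀ j, Complex.exp (Complex.I * α' j) = star (Complex.exp (Complex.I * α j))) :
    spec (magneticOp Γ c α) = spec (magneticOp Γ c α') := by
  have key : ∀ {β γ : Fin Γ.betti → ℝ},
      (∀ j, Complex.exp (Complex.I * γ j) = star (Complex.exp (Complex.I * β j))) →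
      spec (magneticOp Γ c γ) ⊆ spec (magneticOp Γ c β) := by
    intro β γ h z hz
    by_contra hz'
    by_cases him : z.im = 0
    · have h1 := notMem_spec_conj h hz'
      rw [Complex.star_def, Complex.conj_eq_iff_im.2 him] at h1
      exact h1 hz
    · exact notMem_spec_of_im_ne_zero him hz
  exact Subset.antisymm (key fun j => by rw [hα, star_star]) (key hα)

theorem multiplicity_eq_of_conj
    (hα : ∀ j, Complex.exp (Complex.I * α' j) = star (Complex.exp (Complex.I * α j))) (z : ℂ) :
    multiplicity (magneticOp Γ c α) z = multiplicity (magneticOp Γ c α') z := by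
  by_cases him : z.im = 0
  · obtain ⟨s, rfl⟩ := Complex.conj_eq_iff_real.1 (Complex.conj_eq_iff_im.2 him)
    rw [multiplicity, multiplicity, ← map_eigenspace_conj hα, rank_map_conjEquiv]
  · rw [multiplicity, multiplicity,
      eigenspace_eq_bot_of_notMem_spec (notMem_spec_of_im_ne_zero him),
      eigenspace_eq_bot_of_notMem_spec (notMem_spec_of_im_ne_zero him)]

theorem nthEigenvalue_eq_of_conj
    (hα : ∀ j, Complex.exp (Complex.I * α' j) = star (Complex.exp (Complex.I * α j))) (n : ℕ) :
    nthEigenvalue (magneticOp Γ c α) n = nthEigenvalue (magneticOp Γ c α') n := by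
  have h : ∀ t, eigenCount (magneticOp Γ c α) t = eigenCount (magneticOp Γ c α') t := fun t => by
    have h1 : (⨆ s ∈ Iic t, eigenspace (magneticOp Γ c α) (s : ℂ)).map (conjEquiv c).toLinearMap =
        ⨆ s ∈ Iic t, eigenspace (magneticOp Γ c α') (s : ℂ) := by
      simp only [Submodule.map_iSup, map_eigenspace_conj hα]
    rw [eigenCount, eigenCount, ← h1, rank_map_conjEquiv]
  simp only [nthEigenvalue, h]

theorem exp_symmetryPoints {β : ℕ} {ς : Fin β → ℝ} (hς : ς ∈ symmetryPoints β) (α : Fin β → ℝ)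
    (j : Fin β) : Complex.exp (Complex.I * (ς + α) j) =
      star (Complex.exp (Complex.I * (ς - α) j)) := by
  obtain ⟨b, rfl⟩ := hς
  rw [Complex.star_def, ← Complex.exp_conj]
  -- The two exponents differ by `2iς_j = 2πi b_j`, a period of the exponential.
  have h := Complex.exp_nat_mul_two_pi_mul_I (b j : ℕ)
  rw [← mul_one (Complex.exp ((starRingEnd ℂ) _)), ← h, ← Complex.exp_add]
  congr 1
  simp only [Pi.add_apply, Pi.sub_apply, map_mul, Complex.conj_I, Complex.conj_ofReal]
  push_cast
  ring

end Conjugation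

/-- A differentiable function that is even about `x₀` has derivative zero there. -/
theorem hasFDerivAt_zero_of_even {X : Type*} [NormedAddCommGroup X] [NormedSpace ℝ X] {f : X → ℝ}
    {x₀ : X} (hd : DifferentiableAt ℝ f x₀) (heven : ∀ x, f (x₀ - x) = f (x₀ + x)) :
    HasFDerivAt f (0 : X →L[ℝ] ℝ) x₀ := by
  obtain ⟨f', hf'⟩ := hd
  have h1 : HasFDerivAt (fun x => f (x₀ + x)) f' 0 := by
    have h := (hasFDerivAt_id (𝕜 := ℝ) (0 : X)).const_add x₀
    have hf : HasFDerivAt f f' (x₀ + id 0) := by simpa using hf'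
    have h' := hf.comp (0 : X) h
    rwa [ContinuousLinearMap.comp_id] at h'
  have h2 : HasFDerivAt (fun x => f (x₀ - x)) (-f') 0 := by
    have h := (hasFDerivAt_id (𝕜 := ℝ) (0 : X)).const_sub x₀
    have hf : HasFDerivAt f f' (x₀ - id 0) := by simpa using hf'
    have h' := hf.comp (0 : X) h
    rwa [ContinuousLinearMap.comp_neg, ContinuousLinearMap.comp_id] at h'
  simp only [heven] at h2
  have h3 : f' = -f' := h1.unique h2
  have h4 : f' = 0 := by
    ext v
    have h5 : f' v = -f' v := congrArg (fun g : X →L[ℝ] ℝ => g v) h3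
    rw [zero_apply]
    linarith
  rwa [← h4]

end QG

end

/-! ### The theorem -/

theorem mainTheorem7 {V E : Type*} [Fintype V] [Fintype E] (Γ : QG.QuantumGraph V E)
    (c : QG.Cut Γ.toMetricGraph) (ς : Fin Γ.betti → ℝ) (hς : ς ∈ QG.symmetryPoints Γ.betti) :
    (∀ α : Fin Γ.betti → ℝ,
      QG.spec (QG.magneticOp Γ c (ς - α)) = QG.spec (QG.magneticOp Γ c (ς + α)) ∧
      ∀ z : ℂ, QG.multiplicity (QG.magneticOp Γ c (ς - α)) z =
        QG.multiplicity (QG.magneticOp Γ c (ς + α)) z) ∧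
    ∀ n : ℕ, 1 ≤ n →
      QG.multiplicity (QG.magneticOp Γ c ς) (QG.nthEigenvalue (QG.magneticOp Γ c ς) n : ℂ) = 1 →
      HasFDerivAt (fun α : Fin Γ.betti → ℝ => QG.nthEigenvalue (QG.magneticOp Γ c α) n)
        (0 : (Fin Γ.betti → ℝ) →L[ℝ] ℝ) ς := by
  refine ⟨fun α => ⟨QG.spec_eq_of_conj (QG.exp_symmetryPoints hς α),
    QG.multiplicity_eq_of_conj (QG.exp_symmetryPoints hς α)⟩, fun n hn hsimple => ?_⟩
  refine QG.hasFDerivAt_zero_of_even ?_ fun α =>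
    QG.nthEigenvalue_eq_of_conj (QG.exp_symmetryPoints hς α) n
  obtain ⟨K, hK⟩ := QG.exists_isStrictLowerBound Γ c
  -- Without edges the Hilbert space is zero and no eigenvalue is simple. With an edge it is
  -- infinite-dimensional, so that the `n`-th eigenvalue exists for every `n`.
  have hnonempty : Nonempty (QG.TreeEdge c) := by
    by_contra hempty
    rw [not_nonempty_iff] at hempty
    have hsub : Subsingleton (QG.GraphL2 (QG.cutTree c)) :=
      ⟨fun u v => PiLp.ext fun e => (hempty.false e).elim⟩
    rw [QG.multiplicity, rank_subsingleton'] at hsimple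
    exact zero_ne_one hsimple
  exact QG.differentiableAt_nthEigenvalue (QG.eigenResolvent_magneticOp hK)
    (fun _ => QG.isCompactOperator_resolvent) (QG.isSymmetric_resolvent hK)
    (QG.differentiable_resolvent hK ς) hn
    (QG.exists_le_rank_specSum QG.isCompactOperator_resolvent (QG.isSymmetric_resolvent hK ς)
      (fun _ hx => QG.resolvent_pos hK ς hx) QG.not_finiteDimensional_graphL2 n) hsimple
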